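/- Fix an integer $k\ge 2$. In Max $k$-Cover one is given a collection of $n$ sets $S_1,\dots,S_n$ over a universe $[u]$ (each set as a list of its elements), and the task is to compute the maximum of $|S_{x_1}\cup\dots\cup S_{x_k}|$ over all $x_1,\dots,x_k\in[n]$. Let $\Delta_s$ be an upper bound on the set sizes $|S_i|$ and $\Delta_f$ an upper bound on the frequencies $|\{i : y\in S_i\}|$, $y\in[u]$. Algorithms are deterministic and run on a RAM with words of logarithmic length, and $\omega$ is the exponent of matrix multiplication. Consider the following hypotheses. * Clique Hypothesis (the $k$-Clique Hypothesis of fine-grained complexity): for no $\varepsilon>0$ and $\ell\ge3$ can one decide in time $O(n^{\ell\omega/3-\varepsilon})$ whether an $n$-vertex graph contains a clique of size $\ell$. * $h$-Uniform Hyperclique Hypothesis: for no $\varepsilon>0$ and $\ell\ge h+1$ can one decide in time $O(n^{\ell-\varepsilon})$ whether an $h$-uniform $n$-vertex hypergraph contains $\ell$ vertices all of whose $h$-subsets are edges. * $k$-OV Hypothesis: for no $\varepsilon>0$ and no $d=d(n)=\omega(\log n)$ can one decide in time $O(n^{k-\varepsilon})$, given $V_1,\dots,V_k\subseteq\{0,1\}^d$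 of $n$ vectors each, whether there are $v_i\in V_i$ with $\sum_{y=1}^d v_1[y]\cdots v_k[y]=0$. Let $a,b,c,e$ be arbitrary positive integers, and consider the parameter regime in which $n,u,\Delta_s,\Delta_f$ are bounded by $m^a,m^b,m^c,m^e$ respectively, for an integer $m\ge1$. Suppose that for some $\varepsilon>0$ there is an algorithm that solves Max $k$-Cover on all instances of this regime (for all $m$), in one of the following times, where the bounds are evaluated at $n=m^a$, $u=m^b$, $\Delta_s=m^c$, $\Delta_f=m^e$ and the implied constant is independent of $m$. 1. If the time is $O\big((\min\{n,\Delta_f\cdot\min\{\sqrt u,\Delta_s\}\})^{\frac{\omega}{3}k(1-\varepsilon)}\big)$, then the Clique Hypothesis is false. 2. If, for some integer $h\ge3$, the time is $O\big((\min\{n,\Delta_f\cdot\min\{u^{1/h},\Delta_s^{1/(h-1)}\}\})^{k(1-\varepsilon)}\big)$, then the $h$-Uniform Hyperclique Hypothesis is false. 3. If the time is $O\big((\min\{n,\Delta_f\cdot\min\{u^{1/k},\Delta_s^{1/(k-1)}\}\})^{k(1-\varepsilon)}\big)$, then the $k$-OV Hypothesis is false. -/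

import Mathlib

/-! ### A word RAM with a step count -/

/-- The machine instructions that combine two words. Subtraction is truncated. -/
inductive WordOp
  | add | sub | mul | div | mod | land | lor | lxor | shl | shr

def WordOp.eval : WordOp → ℕ → ℕ → ℕ
  | .add, x, y => x + y
  | .sub, x, y => x - y
  | .mul, x, y => x * y
  | .div, x, y => x / y
  | .mod, x, y => x % y
  | .land, x, y => x &&& y
  | .lor, x, y => x ||| y
  | .lxor, x, y => x ^^^ y
  | .shl, x, y => x <<< y
  | .shr, x, y => x >>> y

/-- Programs. Registers and arrays are named by natural numbers; a program mentions finitely many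
of them. Arrays are addressed through registers (random access). -/
inductive Prog
  | skip
  | const (r v : ℕ)
  | op (o : WordOp) (r x y : ℕ)
  | load (r A x : ℕ)
  | store (A x y : ℕ)
  | seq (p q : Prog)
  | ite (x : ℕ) (p q : Prog)
  | loop (x : ℕ) (p : Prog)

structure RamState where
  reg : ℕ → ℕ
  mem : ℕ → ℕ → ℕ

def RamState.setReg (s : RamState) (r v : ℕ) : RamState :=
  { s with reg := Function.update s.reg r v }

def RamState.setMem (s : RamState) (A x v : ℕ) : RamState :=
  { s with mem := Function.update s.mem A (Function.update (s.mem A) x v) }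

/-- `Exec W p s t s'`: started in `s`, the program `p` halts in state `s'` after `t` steps, and every
word computed on the way is smaller than `W`. Each instruction and each test costs one step. -/
inductive Exec (W : ℕ) : Prog → RamState → ℕ → RamState → Prop
  | skip (s) : Exec W .skip s 1 s
  | const (s r v) (hv : v < W) : Exec W (.const r v) s 1 (s.setReg r v)
  | op (s o r x y) (hv : WordOp.eval o (s.reg x) (s.reg y) < W) :
      Exec W (.op o r x y) s 1 (s.setReg r (WordOp.eval o (s.reg x) (s.reg y)))
  | load (s r A x) : Exec W (.load r A x) s 1 (s.setReg r (s.mem A (s.reg x)))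
  | store (s A x y) : Exec W (.store A x y) s 1 (s.setMem A (s.reg x) (s.reg y))
  | seq {p q s t s' t' s''} (hp : Exec W p s t s') (hq : Exec W q s' t' s'') :
      Exec W (.seq p q) s (t + t') s''
  | ite_true {x p q s t s'} (hx : s.reg x ≠ 0) (hp : Exec W p s t s') :
      Exec W (.ite x p q) s (t + 1) s'
  | ite_false {x p q s t s'} (hx : s.reg x = 0) (hq : Exec W q s t s') :
      Exec W (.ite x p q) s (t + 1) s'
  | loop_done {x p s} (hx : s.reg x = 0) : Exec W (.loop x p) s 1 s
  | loop_step {x p s t s' t' s''} (hx : s.reg x ≠ 0) (hp : Exec W p s t s')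
      (hl : Exec W (.loop x p) s' t' s'') : Exec W (.loop x p) s (t + t' + 1) s''

/-- A computational problem: its instances, the size that determines the word length, the memory
contents that present an instance to the machine, and the answer that is to be computed. -/
structure RamProblem where
  Inst : Type
  size : Inst → ℕ
  input : Inst → RamState
  answer : Inst → ℕ

/-- One program solves all the instances `x i` in time `O(T i)` on a RAM with words of
`O(log size)` bits. The answer is left in register `0`. -/
def RamProblem.SolvableInTime (Q : RamProblem) {ι : Type} (x : ι → Q.Inst) (T : ι → ℝ) : Prop :=
  ∃ (P : Prog) (c : ℕ) (C : ℝ), ∀ i : ι, ∃ (t : ℕ) (s : RamState),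
    Exec ((Q.size (x i) + 2) ^ c) P (Q.input (x i)) t s ∧
      (t : ℝ) ≤ C * T i ∧ s.reg 0 = Q.answer (x i)

/-- Registers that hold `a`, `b`, and then zeros. -/
def twoRegs (a b : ℕ) : ℕ → ℕ := fun r => if r = 0 then a else if r = 1 then b else 0

/-! ### The exponent of matrix multiplication -/

/-- An arithmetic instruction. An operand is an input or the result of an earlier instruction. -/
inductive ArithInstr (ι : Type)
  | const (q : ℚ)
  | add (x y : ι ⊕ ℕ)
  | sub (x y : ι ⊕ ℕ)
  | mul (x y : ι ⊕ ℕ)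

def operandVal {ι : Type} (a : ι → ℚ) (v : List ℚ) : ι ⊕ ℕ → ℚ :=
  Sum.elim a (fun j => v.getD j 0)

def ArithInstr.eval {ι : Type} (a : ι → ℚ) (v : List ℚ) : ArithInstr ι → ℚ
  | .const q => q
  | .add x y => operandVal a v x + operandVal a v y
  | .sub x y => operandVal a v x - operandVal a v y
  | .mul x y => operandVal a v x * operandVal a v y

/-- The results of a straight-line program on the inputs `a`, in the order of computation. -/
def straightLineRun {ι : Type} (a : ι → ℚ) (p : List (ArithInstr ι)) : List ℚ :=
  p.foldl (fun v I => v ++ [I.eval a v]) []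

/-- The straight-line program `p` multiplies two `n × n` matrices. -/
def MultipliesMatrices (n : ℕ) (p : List (ArithInstr ((Fin n × Fin n) ⊕ (Fin n × Fin n)))) : Prop :=
  ∃ out : Fin n → Fin n → ((Fin n × Fin n) ⊕ (Fin n × Fin n)) ⊕ ℕ,
    ∀ (A B : Matrix (Fin n) (Fin n) ℚ) (i j : Fin n),
      operandVal (Sum.elim (fun e => A e.1 e.2) (fun e => B e.1 e.2))
        (straightLineRun (Sum.elim (fun e => A e.1 e.2) (fun e => B e.1 e.2)) p) (out i j)
        = (A * B) i j

/-- The exponent `ω`: the infimum of all `τ` such that `n × n` matrices can be multiplied with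
`O(n ^ τ)` arithmetic operations. -/
noncomputable def matMulExponent : ℝ :=
  sInf {τ : ℝ | ∃ C : ℝ, ∀ n : ℕ, 1 ≤ n →
    ∃ p, MultipliesMatrices n p ∧ (p.length : ℝ) ≤ C * (n : ℝ) ^ τ}

/-! ### Clique detection -/

structure GraphInst where
  n : ℕ
  pos : 0 < n
  G : SimpleGraph (Fin n)

open Classical in
/-- The input is `n` in register `0` and the adjacency matrix in array `0`. -/
noncomputable def cliqueProblem (k : ℕ) : RamProblem where
  Inst := GraphInst
  size I := I.n
  input I :=
    { reg := twoRegs I.n 0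
      mem := fun A t =>
        if A = 0 ∧ ∃ i j : Fin I.n, t = (i : ℕ) * I.n + j ∧ I.G.Adj i j then 1 else 0 }
  answer I := if ∃ K : Finset (Fin I.n), I.G.IsNClique k K then 1 else 0

/-- For no `ε > 0` and `k ≥ 3` can `k`-cliques be detected in time `O(n ^ (kω/3 - ε))`. -/
def CliqueHypothesis : Prop :=
  ∀ k : ℕ, 3 ≤ k → ∀ ε : ℝ, 0 < ε →
    ¬ (cliqueProblem k).SolvableInTime (fun I : GraphInst => I)
      (fun I : GraphInst => (I.n : ℝ) ^ ((k : ℝ) * matMulExponent / 3 - ε))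

/-! ### Hyperclique detection -/

structure HypergraphInst (h : ℕ) where
  n : ℕ
  pos : 0 < n
  E : Set (Finset (Fin n))
  uniform : ∀ e ∈ E, e.card = h

open Classical in
/-- The input is `n` in register `0` and the `n × ⋯ × n` adjacency tensor in array `0`. -/
noncomputable def hypercliqueProblem (h k : ℕ) : RamProblem where
  Inst := HypergraphInst h
  size I := I.n
  input I :=
    { reg := twoRegs I.n 0
      mem := fun A t =>
        if A = 0 ∧ ∃ x : Fin h → Fin I.n, t = ∑ j : Fin h, (x j : ℕ) * I.n ^ (j : ℕ) ∧
            Finset.univ.image x ∈ I.E then 1 else 0 }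
  answer I :=
    if ∃ K : Finset (Fin I.n), K.card = k ∧ ∀ e ⊆ K, e.card = h → e ∈ I.E then 1 else 0

/-- For no `ε > 0` and `k ≥ h + 1` can hypercliques of size `k` be detected in `h`-uniform
hypergraphs in time `O(n ^ (k - ε))`. -/
def HypercliqueHypothesis (h : ℕ) : Prop :=
  ∀ k : ℕ, h + 1 ≤ k → ∀ ε : ℝ, 0 < ε →
    ¬ (hypercliqueProblem h k).SolvableInTime (fun I : HypergraphInst h => I)
      (fun I : HypergraphInst h => (I.n : ℝ) ^ ((k : ℝ) - ε))

/-! ### Orthogonal vectors -/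

structure OVInst (k : ℕ) where
  n : ℕ
  pos : 0 < n
  d : ℕ
  V : Fin k → Fin n → Fin d → Bool

/-- `v₁ ⊙ ⋯ ⊙ v_k`, the sum over the coordinates of the products of the entries. -/
def generalizedInner {k d : ℕ} (v : Fin k → Fin d → Bool) : ℕ :=
  ∑ y : Fin d, ∏ i : Fin k, (v i y).toNat

open Classical in
/-- The input is `n`, `d` in registers `0`, `1` and the vectors, one after the other, in
array `0`. -/
noncomputable def ovProblem (k : ℕ) : RamProblem where
  Inst := OVInst k
  size I := I.n + I.d
  input I :=
    { reg := twoRegs I.n I.d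
      mem := fun A t =>
        if A = 0 ∧ ∃ (i : Fin k) (j : Fin I.n) (y : Fin I.d),
            t = ((i : ℕ) * I.n + j) * I.d + y ∧ I.V i j y = true then 1 else 0 }
  answer I :=
    if ∃ x : Fin k → Fin I.n, generalizedInner (fun i => I.V i (x i)) = 0 then 1 else 0

/-- For no `ε > 0` and no dimension `d = d(n)` that grows faster than `log n` can `k`-OV be solved
in time `O(n ^ (k - ε))`. -/
def OVHypothesis (k : ℕ) : Prop :=
  ∀ ε : ℝ, 0 < ε → ∀ d : ℕ → ℕ,
    (fun n : ℕ => Real.log n) =o[Filter.atTop] (fun n : ℕ => (d n : ℝ)) →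
    ¬ (ovProblem k).SolvableInTime (fun I : {I : OVInst k // I.d = d I.n} => I.1)
      (fun I => (I.1.n : ℝ) ^ ((k : ℝ) - ε))

/-! ### Maximum `k`-coverage -/

/-- A collection of `n` sets over a universe of `u` elements; each set is given by a list of its
elements. -/
structure CoverInst where
  n : ℕ
  pos : 0 < n
  u : ℕ
  S : Fin n → List (Fin u)
  nodup : ∀ i, (S i).Nodup

/-- There are at most `n` sets and `u` elements, every set has at most `Δs` elements, and every
element is in at most `Δf` sets. -/
def CoverInst.Bounded (I : CoverInst) (n u Δs Δf : ℕ) : Prop :=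
  I.n ≤ n ∧ I.u ≤ u ∧ (∀ i, (I.S i).length ≤ Δs) ∧
    ∀ y : Fin I.u, (Finset.univ.filter fun i => y ∈ I.S i).card ≤ Δf

/-- The largest number of elements that `k` of the sets cover. -/
def CoverInst.opt (I : CoverInst) (k : ℕ) : ℕ :=
  Finset.univ.sup fun x : Fin k → Fin I.n =>
    (Finset.univ.biUnion fun j : Fin k => (I.S (x j)).toFinset).card

/-- The input is `n`, `u` in registers `0`, `1`, the concatenation of the lists in array `1`, and
in array `0` the position where each list starts, followed by the total length. -/
def maxCoverProblem (k : ℕ) : RamProblem where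
  Inst := CoverInst
  size I := I.n + I.u
  input I :=
    { reg := twoRegs I.n I.u
      mem := fun A t =>
        if A = 0 then
          if t ≤ I.n then
            ∑ i : Fin I.n, if (i : ℕ) < t then (I.S i).length else 0
          else 0
        else if A = 1 then
          (((List.ofFn I.S).flatten).map fun y => (y : ℕ)).getD t 0
        else 0 }
  answer I := I.opt k

/-- Max `k`-Cover can be solved in time `O(T(n, u, Δs, Δf))` on the instances with
`n ≤ m ^ a`, `u ≤ m ^ b`, `Δs ≤ m ^ c`, `Δf ≤ m ^ e`, where `T` is evaluated at these four bounds
and the constant does not depend on `m`. -/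
def MaxCoverSolvable (k a b c e : ℕ) (T : ℕ → ℕ → ℕ → ℕ → ℝ) : Prop :=
  (maxCoverProblem k).SolvableInTime
    (fun q : {q : ℕ × CoverInst //
      1 ≤ q.1 ∧ q.2.Bounded (q.1 ^ a) (q.1 ^ b) (q.1 ^ c) (q.1 ^ e)} => q.1.2)
    (fun q => T (q.1.1 ^ a) (q.1.1 ^ b) (q.1.1 ^ c) (q.1.1 ^ e))

/-! ### Basic properties of the machine -/

/-! All three lower bounds come from one reduction. Its source is a sparse orthogonality problem
(`SparseOV`): there are k groups of vectors, every group is cut into q blocks, and each of D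
constraints looks at one bit of the vectors chosen in H of the groups, being violated when all H
bits are 1. The k-OV problem has this form with H = k, a coordinate being a constraint. For an
h-uniform hyperclique on kr vertices, a group consists of all r-tuples of vertices and a constraint
is a non-edge placed on h of the kr places; these lie in at most H = min h k groups. Cliques are the
case h = 2.

Every vector becomes a set. The elements that belong to a constraint are the even numbers below a ^
H, read as strings of H digits in the odd base a = 2q + 1. A vector of block B owns the letter 2B +
1 or 2B + 2, the odd one exactly when its bit is 1, and its set contains the strings that show this
letter at its position. With one vector per group, the uncovered strings are those that avoid H
prescribed letters. In an odd base a number has the parity of its digit sum, so a sum over the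
characters 1 and -1 counts them: there are (2q) ^ H / 2, and 2 ^ (H - 1) more exactly when all
prescribed letters are odd (`two_mul_card_avoiding`). Hence the threshold is reached precisely when
no constraint is violated (`SparseOV.Valid.thr_le_opt_iff`).

To force one vector per group, any two sets of the same group share at least W gadget elements,
indexed by pairs of blocks. A second-order estimate (`pow_add_mul_pow_le`) shows that W of order D *
a ^ (H - 2) suffices, so that the gadget has at most the order of the rest. An element is contained
only in sets of at most H blocks of its groups. With blocks of f vectors this gives frequency H * f,
universe of order D * q ^ H and set size of order D * q ^ (H - 1), while there are about k * q * f
sets, which is the shape of the claimed bounds.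

With G vertices (or dimension G) one takes G ^ r vectors per group and G ^ s blocks. The number D is
a fixed power of G, so for large r the base of the running time is at most a constant times G ^ (r +
2), and the factor 1 - ε in the exponent wins more than this loses (`RegimeExponents.time_le`).
Writing down the instance costs G ^ (r + h + s * (H - 1)) up to constants, which is below G ^ (k *
r) because s = 0 or the blocks have a size that is polynomial in the frequency bound.

Only for cliques with k = 2 can the instance be too large for the target time. The exponent ω is at
least 2 (`two_le_matMulExponent`). Either the assumed running time leaves enough slack for the
construction, or it is too short to read the input, and then an adversary argument shows that no
such algorithm exists (`not_maxCoverSolvable_two`).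

The reduction has to be a program of the machine. All data of the coverage instance are values of
arithmetic expressions in the input, so one generic program writes the instance, runs the solver on
disjoint registers and arrays, and compares with the threshold
(`RamProblem.SolvableInTime.of_coverExprs`). -/

theorem Exec.mono {W W' : ℕ} (hW : W ≤ W') {p : Prog} {s s' : RamState} {t : ℕ}
    (H : Exec W p s t s') : Exec W' p s t s' := by
  induction H with
  | skip s => exact .skip s
  | const s r v hv => exact .const s r v (hv.trans_le hW)
  | op s o r x y hv => exact .op s o r x y (hv.trans_le hW)
  | load s r A x => exact .load s r A x
  | store s A x y => exact .store s A x y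
  | seq _ _ h1 h2 => exact .seq h1 h2
  | ite_true hx _ h1 => exact .ite_true hx h1
  | ite_false hx _ h1 => exact .ite_false hx h1
  | loop_done hx => exact .loop_done hx
  | loop_step hx _ _ h1 h2 => exact .loop_step hx h1 h2

theorem Exec.deterministic {W : ℕ} {p : Prog} {s s₁ s₂ : RamState} {t₁ t₂ : ℕ}
    (H₁ : Exec W p s t₁ s₁) (H₂ : Exec W p s t₂ s₂) : s₁ = s₂ := by
  induction H₁ generalizing s₂ t₂ with
  | skip s => cases H₂; rfl
  | const s r v hv => cases H₂; rfl
  | op s o r x y hv => cases H₂; rfl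
  | load s r A x => cases H₂; rfl
  | store s A x y => cases H₂; rfl
  | seq _ _ h1 h2 =>
    cases H₂ with
    | seq hp hq => obtain rfl := h1 hp; exact h2 hq
  | ite_true hx _ h1 =>
    cases H₂ with
    | ite_true _ hp => exact h1 hp
    | ite_false hx' _ => exact absurd hx' hx
  | ite_false hx _ h1 =>
    cases H₂ with
    | ite_true hx' _ => exact absurd hx hx'
    | ite_false _ hp => exact h1 hp
  | loop_done hx =>
    cases H₂ with
    | loop_done _ => rfl
    | loop_step hx' _ _ => exact absurd hx hx'
  | loop_step hx _ _ h1 h2 =>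
    cases H₂ with
    | loop_done hx' => exact absurd hx' hx
    | loop_step _ hp hl => obtain rfl := h1 hp; exact h2 hl

/-- A run of `t` steps depends on at most `t` memory cells of the initial state: changing any other
cell does not change the final registers. -/
theorem Exec.exists_readSet {W : ℕ} {p : Prog} {s s' : RamState} {t : ℕ} (H : Exec W p s t s') :
    ∃ Z : Finset (ℕ × ℕ), Z.card ≤ t ∧ ∀ A x w, (A, x) ∉ Z →
      ∃ s'', Exec W p (s.setMem A x w) t s'' ∧ (s'' = s' ∨ s'' = s'.setMem A x w) := by
  induction H with
  | skip s => exact ⟨∅, by simp, fun A x w _ => ⟨_, .skip _, .inr rfl⟩⟩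
  | const s r v hv => exact ⟨∅, by simp, fun A x w _ => ⟨_, .const _ r v hv, .inr rfl⟩⟩
  | op s o r x y hv => exact ⟨∅, by simp, fun A z w _ => ⟨_, .op _ o r x y hv, .inr rfl⟩⟩
  | load s r A x =>
    refine ⟨{(A, s.reg x)}, by simp, fun B z w hz => ⟨_, .load _ r A x, .inr ?_⟩⟩
    have : (s.setMem B z w).mem A (s.reg x) = s.mem A (s.reg x) := by
      simp only [RamState.setMem, Function.update_apply]
      split_ifs with h1
      · subst h1
        rw [Function.update_apply, if_neg]
        rintro h2
        exact hz (by simp [h2])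
      · rfl
    change RamState.setReg _ r ((s.setMem B z w).mem A (s.reg x)) = _
    rw [this]
    rfl
  -- A store reads no cell. It either overwrites the changed cell, after which the two runs
  -- coincide, or leaves it changed; this is why the conclusion is a disjunction.
  | store s A x y =>
    refine ⟨∅, by simp, fun B z w _ => ⟨_, .store _ A x y, ?_⟩⟩
    change (s.setMem B z w).setMem A (s.reg x) (s.reg y) = s.setMem A (s.reg x) (s.reg y) ∨
      (s.setMem B z w).setMem A (s.reg x) (s.reg y) =
        (s.setMem A (s.reg x) (s.reg y)).setMem B z w
    simp only [RamState.setMem, RamState.mk.injEq, true_and]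
    rcases eq_or_ne A B with rfl | hAB
    · simp only [Function.update_self, Function.update_idem]
      rcases eq_or_ne (s.reg x) z with h | h
      · left; rw [h, Function.update_idem]
      · right; rw [Function.update_comm h]
    · right
      rw [Function.update_of_ne hAB, Function.update_of_ne hAB.symm, Function.update_comm hAB]
  | @seq p q s t s' t' s'' _ _ h1 h2 =>
    obtain ⟨Z1, c1, f1⟩ := h1
    obtain ⟨Z2, c2, f2⟩ := h2
    refine ⟨Z1 ∪ Z2, (Finset.card_union_le _ _).trans (by omega), fun A x w hz => ?_⟩
    rw [Finset.mem_union, not_or] at hz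
    obtain ⟨u, e1, rfl | rfl⟩ := f1 A x w hz.1
    · exact ⟨_, .seq e1 ‹_›, .inl rfl⟩
    · obtain ⟨u', e2, h⟩ := f2 A x w hz.2
      exact ⟨u', .seq e1 e2, h⟩
  | ite_true hx _ h1 =>
    obtain ⟨Z, c, f⟩ := h1
    refine ⟨Z, by omega, fun A x w hz => ?_⟩
    obtain ⟨u, e, h⟩ := f A x w hz
    exact ⟨u, .ite_true hx e, h⟩
  | ite_false hx _ h1 =>
    obtain ⟨Z, c, f⟩ := h1
    refine ⟨Z, by omega, fun A x w hz => ?_⟩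
    obtain ⟨u, e, h⟩ := f A x w hz
    exact ⟨u, .ite_false hx e, h⟩
  | loop_done hx => exact ⟨∅, by simp, fun A x w _ => ⟨_, .loop_done hx, .inr rfl⟩⟩
  | @loop_step x p s t s' t' s'' hx _ _ h1 h2 =>
    obtain ⟨Z1, c1, f1⟩ := h1
    obtain ⟨Z2, c2, f2⟩ := h2
    refine ⟨Z1 ∪ Z2, (Finset.card_union_le _ _).trans (by omega), fun A x w hz => ?_⟩
    rw [Finset.mem_union, not_or] at hz
    obtain ⟨u, e1, rfl | rfl⟩ := f1 A x w hz.1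
    · exact ⟨_, .loop_step hx e1 ‹_›, .inl rfl⟩
    · obtain ⟨u', e2, h⟩ := f2 A x w hz.2
      exact ⟨u', .loop_step hx e1 e2, h⟩

/-! ### Renaming registers and arrays -/

/-- The program `p` moved to the even registers from `10` on and to the arrays from `1` on. -/
def Prog.relocate : Prog → Prog
  | .skip => .skip
  | .const r v => .const (2 * r + 10) v
  | .op o r x y => .op o (2 * r + 10) (2 * x + 10) (2 * y + 10)
  | .load r A x => .load (2 * r + 10) (A + 1) (2 * x + 10)
  | .store A x y => .store (A + 1) (2 * x + 10) (2 * y + 10)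
  | .seq p q => .seq p.relocate q.relocate
  | .ite x p q => .ite (2 * x + 10) p.relocate q.relocate
  | .loop x p => .loop (2 * x + 10) p.relocate

/-- The relocated part of `S` is `s`. -/
def RamState.Embeds (s S : RamState) : Prop :=
  (∀ r, S.reg (2 * r + 10) = s.reg r) ∧ ∀ A, S.mem (A + 1) = s.mem A

/-- What a relocated program cannot touch: its registers start at 10 and its arrays at 1. The
original input therefore survives the run of the solver, and the threshold can be evaluated
afterwards. -/
def RamState.AgreeLow (S S' : RamState) : Prop :=
  (∀ r < 10, S'.reg r = S.reg r) ∧ S'.mem 0 = S.mem 0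

theorem RamState.AgreeLow.trans {S S' S'' : RamState} (h : S.AgreeLow S') (h' : S'.AgreeLow S'') :
    S.AgreeLow S'' :=
  ⟨fun r hr => (h'.1 r hr).trans (h.1 r hr), h'.2.trans h.2⟩

theorem RamState.Embeds.setReg {s S : RamState} (h : s.Embeds S) (r v : ℕ) :
    (s.setReg r v).Embeds (S.setReg (2 * r + 10) v) := by
  refine ⟨fun r' => ?_, h.2⟩
  simp only [RamState.setReg, Function.update_apply]
  have := h.1 r'
  by_cases e : r' = r
  · simp [e]
  · rw [if_neg (by omega), if_neg e, this]

theorem RamState.Embeds.setMem {s S : RamState} (h : s.Embeds S) (A x v : ℕ) :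
    (s.setMem A x v).Embeds (S.setMem (A + 1) x v) := by
  refine ⟨h.1, fun A' => ?_⟩
  simp only [RamState.setMem, Function.update_apply]
  have := h.2 A'
  by_cases e : A' = A
  · subst e; simp [this]
  · rw [if_neg (by omega), if_neg e, this]

theorem RamState.agreeLow_setReg (S : RamState) (r v : ℕ) (hr : 10 ≤ r) :
    S.AgreeLow (S.setReg r v) :=
  ⟨fun r' hr' => by simp only [RamState.setReg]; rw [Function.update_of_ne (by omega)], rfl⟩

theorem RamState.agreeLow_setMem (S : RamState) (A x v : ℕ) :
    S.AgreeLow (S.setMem (A + 1) x v) :=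
  ⟨fun r' hr' => rfl, by simp only [RamState.setMem]; rw [Function.update_of_ne (by omega)]⟩

theorem Exec.relocate {W : ℕ} {p : Prog} {s s' : RamState} {t : ℕ} (H : Exec W p s t s') :
    ∀ S : RamState, s.Embeds S →
      ∃ S', Exec W p.relocate S t S' ∧ s'.Embeds S' ∧ S.AgreeLow S' := by
  induction H with
  | skip s => exact fun S hS => ⟨S, .skip _, hS, fun _ _ => rfl, rfl⟩
  | const s r v hv =>
    exact fun S hS => ⟨_, .const _ _ v hv, hS.setReg r v, S.agreeLow_setReg _ _ (by omega)⟩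
  | op s o r x y hv =>
    intro S hS
    refine ⟨_, .op _ o _ _ _ ?_, ?_, S.agreeLow_setReg _ _ (by omega)⟩
    · rw [hS.1, hS.1]; exact hv
    · rw [hS.1, hS.1]; exact hS.setReg _ _
  | load s r A x =>
    intro S hS
    refine ⟨_, .load _ _ _ _, ?_, S.agreeLow_setReg _ _ (by omega)⟩
    rw [hS.1, hS.2]; exact hS.setReg _ _
  | store s A x y =>
    intro S hS
    refine ⟨_, .store _ _ _ _, ?_, S.agreeLow_setMem _ _ _⟩
    rw [hS.1, hS.1]; exact hS.setMem _ _ _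
  | seq _ _ h1 h2 =>
    intro S hS
    obtain ⟨S1, e1, b1, a1⟩ := h1 S hS
    obtain ⟨S2, e2, b2, a2⟩ := h2 S1 b1
    exact ⟨S2, .seq e1 e2, b2, a1.trans a2⟩
  | ite_true hx _ h1 =>
    intro S hS
    obtain ⟨S1, e1, b1, a1⟩ := h1 S hS
    exact ⟨S1, .ite_true (by rw [hS.1]; exact hx) e1, b1, a1⟩
  | ite_false hx _ h1 =>
    intro S hS
    obtain ⟨S1, e1, b1, a1⟩ := h1 S hS
    exact ⟨S1, .ite_false (by rw [hS.1]; exact hx) e1, b1, a1⟩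
  | loop_done hx =>
    exact fun S hS => ⟨S, .loop_done (by rw [hS.1]; exact hx), hS, fun _ _ => rfl, rfl⟩
  | loop_step hx _ _ h1 h2 =>
    intro S hS
    obtain ⟨S1, e1, b1, a1⟩ := h1 S hS
    obtain ⟨S2, e2, b2, a2⟩ := h2 S1 b1
    exact ⟨S2, .loop_step (by rw [hS.1]; exact hx) e1 e2, b2, a1.trans a2⟩

/-! ### Arithmetic expressions -/

inductive ExprOp
  | add | sub | mul | div | mod

def ExprOp.toWordOp : ExprOp → WordOp
  | .add => .add
  | .sub => .sub
  | .mul => .mul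
  | .div => .div
  | .mod => .mod

/-- The values of the four variables and of the array that expressions refer to. -/
structure RamEnv where
  var : Fin 4 → ℕ
  arr : ℕ → ℕ

inductive RamExpr
  | lit (v : ℕ)
  | var (i : Fin 4)
  | arr (e : RamExpr)
  | bin (o : ExprOp) (e f : RamExpr)

def RamExpr.eval (v : RamEnv) : RamExpr → ℕ
  | .lit c => c
  | .var i => v.var i
  | .arr e => v.arr (e.eval v)
  | .bin o e f => o.toWordOp.eval (e.eval v) (f.eval v)

/-- Code that leaves the value of an expression in register `d`. -/
def RamExpr.compile : RamExpr → ℕ → Prog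
  | .lit c, d => .const d c
  -- The conjunction of a word with itself serves as a copy instruction.
  | .var i, d => .op .land d i i
  | .arr e, d => .seq (e.compile d) (.load d 0 d)
  | .bin o e f, d => .seq (e.compile d) (.seq (f.compile (d + 2)) (.op o.toWordOp d d (d + 2)))

def RamExpr.cost : RamExpr → ℕ
  | .lit _ => 1
  | .var _ => 1
  | .arr e => e.cost + 1
  | .bin _ e f => e.cost + (f.cost + 1)

/-- An exponent that bounds the growth of the values of an expression. -/
def RamExpr.growth : RamExpr → ℕ
  | .lit c => c
  | .var _ => 1
  | .arr e => e.growth + 1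
  | .bin _ e f => e.growth + f.growth + 1

structure RamEnv.BoundedBy (v : RamEnv) (X : ℕ) : Prop where
  two_le : 2 ≤ X
  var_le : ∀ i, v.var i ≤ X
  arr_le : ∀ i, v.arr i ≤ X

/-- Values of an expression grow polynomially in the bound on its variables, which is what words of
logarithmic length allow. Exponents add up under multiplication, and the extra 1 pays for the factor
2 of an addition since 2 ≤ X. -/
theorem RamExpr.eval_le {v : RamEnv} {X : ℕ} (h : v.BoundedBy X) (e : RamExpr) :
    e.eval v ≤ X ^ e.growth := by
  have hX := h.two_le
  have h1 : 1 ≤ X := by omega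
  induction e with
  | lit c => exact (Nat.lt_two_pow_self).le.trans (Nat.pow_le_pow_left hX c)
  | var i => simpa [eval, growth] using h.var_le i
  | arr e ih =>
    calc v.arr _ ≤ X := h.arr_le _
      _ ≤ X ^ (e.growth + 1) := Nat.le_self_pow (by omega) X
  | bin o e f he hf =>
    simp only [eval, growth]
    have b1 : X ^ e.growth ≤ X ^ (e.growth + f.growth) := Nat.pow_le_pow_right h1 (by omega)
    have b2 : X ^ f.growth ≤ X ^ (e.growth + f.growth) := Nat.pow_le_pow_right h1 (by omega)
    have b3 : X ^ (e.growth + f.growth) * 2 ≤ X ^ (e.growth + f.growth + 1) := by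
      rw [pow_succ]; exact Nat.mul_le_mul_left _ hX
    have b4 : e.eval v ≤ X ^ (e.growth + f.growth + 1) := by omega
    cases o with
    | add => simp only [ExprOp.toWordOp, WordOp.eval]; omega
    | sub => exact (Nat.sub_le _ _).trans b4
    | mul =>
      calc e.eval v * f.eval v ≤ X ^ e.growth * X ^ f.growth := Nat.mul_le_mul he hf
        _ = X ^ (e.growth + f.growth) := (pow_add _ _ _).symm
        _ ≤ _ := by omega
    | div => exact (Nat.div_le_self _ _).trans b4
    | mod => exact (Nat.mod_le _ _).trans b4

/-- The state `s` holds the environment `v`. -/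
def RamState.Holds (s : RamState) (v : RamEnv) : Prop :=
  (∀ i : Fin 4, s.reg i = v.var i) ∧ s.mem 0 = v.arr

/-- Only odd registers from `d` on differ. -/
def RamState.SameButTemp (d : ℕ) (s s' : RamState) : Prop :=
  s'.mem = s.mem ∧ ∀ r, r < d ∨ r % 2 = 0 → s'.reg r = s.reg r

theorem RamState.Holds.of_sameButTemp {s s' : RamState} {v : RamEnv} {d : ℕ} (h : s.Holds v)
    (hs : RamState.SameButTemp d s s') (hd : 11 ≤ d) : s'.Holds v :=
  ⟨fun i => (hs.2 i (.inl (by omega))).trans (h.1 i), by rw [hs.1]; exact h.2⟩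

theorem RamState.SameButTemp.setReg {s s' : RamState} {d : ℕ}
    (hs : RamState.SameButTemp d s s') (v : ℕ) (hd : d % 2 = 1) :
    RamState.SameButTemp d s (s'.setReg d v) :=
  ⟨hs.1, fun r hr => by
    simp only [RamState.setReg]
    rw [Function.update_of_ne (by omega)]
    exact hs.2 r hr⟩

theorem RamState.SameButTemp.rfl' {s : RamState} {d : ℕ} : RamState.SameButTemp d s s :=
  ⟨rfl, fun _ _ => rfl⟩

theorem RamExpr.exec_compile {W X : ℕ} {v : RamEnv} (hv : v.BoundedBy X) (e : RamExpr)
    (hW : X ^ e.growth < W) : ∀ (s : RamState) (d : ℕ), s.Holds v → 11 ≤ d → d % 2 = 1 →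
      ∃ s', Exec W (e.compile d) s e.cost s' ∧ s'.reg d = e.eval v ∧
        RamState.SameButTemp d s s' := by
  have h1 : 1 ≤ X := by have := hv.two_le; omega
  induction e with
  | lit c =>
    intro s d _ _ hd
    exact ⟨_, .const _ _ _ (((RamExpr.lit c).eval_le hv).trans_lt hW),
      by simp [RamState.setReg, eval], RamState.SameButTemp.rfl'.setReg _ hd⟩
  | var i =>
    intro s d hs hd hd'
    refine ⟨_, .op _ _ _ _ _ ?_, ?_, RamState.SameButTemp.rfl'.setReg _ hd'⟩
    · simp only [WordOp.eval, Nat.and_self, hs.1]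
      exact ((RamExpr.var i).eval_le hv).trans_lt hW
    · simp [RamState.setReg, eval, WordOp.eval, Nat.and_self, hs.1]
  | arr e ih =>
    intro s d hs hd hd'
    obtain ⟨s1, e1, r1, b1⟩ := ih ((Nat.pow_le_pow_right h1 (by simp [growth])).trans_lt hW)
      s d hs hd hd'
    refine ⟨_, .seq e1 (.load _ _ _ _), ?_, b1.setReg _ hd'⟩
    simp [RamState.setReg, r1, eval, b1.1, hs.2]
  | bin o e f he hf =>
    intro s d hs hd hd'
    obtain ⟨s1, e1, r1, b1⟩ := he ((Nat.pow_le_pow_right h1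
      (by simp only [growth]; omega)).trans_lt hW) s d hs hd hd'
    obtain ⟨s2, e2, r2, b2⟩ := hf ((Nat.pow_le_pow_right h1
      (by simp only [growth]; omega)).trans_lt hW) s1 (d + 2)
      (hs.of_sameButTemp b1 hd) (by omega) (by omega)
    have r3 : s2.reg d = e.eval v := (b2.2 d (.inl (by omega))).trans r1
    have b3 : RamState.SameButTemp d s s2 :=
      ⟨b2.1.trans b1.1, fun r hr => (b2.2 r (by omega)).trans (b1.2 r hr)⟩
    refine ⟨_, .seq e1 (.seq e2 (.op _ _ _ _ _ ?_)), ?_, b3.setReg _ hd'⟩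
    · rw [r2, r3]; exact ((RamExpr.bin o e f).eval_le hv).trans_lt hW
    · simp [RamState.setReg, r2, r3, eval]

/-- The function `f` of the environment is the value of an expression. -/
def IsExpr (f : RamEnv → ℕ) : Prop := ∃ e : RamExpr, ∀ v, e.eval v = f v

namespace IsExpr

theorem const (c : ℕ) : IsExpr fun _ => c := ⟨.lit c, fun _ => rfl⟩

theorem var (i : Fin 4) : IsExpr fun v => v.var i := ⟨.var i, fun _ => rfl⟩

variable {f g : RamEnv → ℕ}

theorem arr (hf : IsExpr f) : IsExpr fun v => v.arr (f v) := by
  obtain ⟨e, he⟩ := hf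
  exact ⟨.arr e, fun v => by simp [RamExpr.eval, he]⟩

theorem bin (o : ExprOp) (hf : IsExpr f) (hg : IsExpr g) :
    IsExpr fun v => o.toWordOp.eval (f v) (g v) := by
  obtain ⟨e, he⟩ := hf
  obtain ⟨e', he'⟩ := hg
  exact ⟨.bin o e e', fun v => by simp [RamExpr.eval, he, he']⟩

theorem add (hf : IsExpr f) (hg : IsExpr g) : IsExpr fun v => f v + g v := bin .add hf hg
theorem sub (hf : IsExpr f) (hg : IsExpr g) : IsExpr fun v => f v - g v := bin .sub hf hg
theorem mul (hf : IsExpr f) (hg : IsExpr g) : IsExpr fun v => f v * g v := bin .mul hf hg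
theorem div (hf : IsExpr f) (hg : IsExpr g) : IsExpr fun v => f v / g v := bin .div hf hg
theorem mod (hf : IsExpr f) (hg : IsExpr g) : IsExpr fun v => f v % g v := bin .mod hf hg

theorem pow (hf : IsExpr f) (n : ℕ) : IsExpr fun v => f v ^ n := by
  induction n with
  | zero => simpa using const 1
  | succ n ih => simpa only [pow_succ] using ih.mul hf

theorem sum {F : ℕ → RamEnv → ℕ} (hF : ∀ i, IsExpr (F i)) (n : ℕ) :
    IsExpr fun v => ∑ i ∈ Finset.range n, F i v := by
  induction n with
  | zero => simpa using const 0
  | succ n ih => simpa only [Finset.sum_range_succ] using ih.add (hF n)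

end IsExpr

open Classical in
/-- The condition `p` on the environment can be tested by an expression. -/
def IsExprCond (p : RamEnv → Prop) : Prop := IsExpr fun v => if p v then 1 else 0

namespace IsExprCond

variable {f g : RamEnv → ℕ} {p p' : RamEnv → Prop}

theorem le (hf : IsExpr f) (hg : IsExpr g) : IsExprCond fun v => f v ≤ g v := by
  -- Subtraction is truncated, so 1 - (f - g) is 1 if f ≤ g and 0 otherwise.
  have := (IsExpr.const 1).sub (hf.sub hg)
  unfold IsExprCond
  convert this using 2 with v
  split_ifs <;> omega

theorem not (hp : IsExprCond p) : IsExprCond fun v => ¬ p v := by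
  have := (IsExpr.const 1).sub hp
  unfold IsExprCond
  convert this using 2 with v
  by_cases h : p v <;> simp [h]

theorem and (hp : IsExprCond p) (hp' : IsExprCond p') : IsExprCond fun v => p v ∧ p' v := by
  have := hp.mul hp'
  unfold IsExprCond
  convert this using 2 with v
  by_cases h : p v <;> by_cases h' : p' v <;> simp [h, h']

theorem lt (hf : IsExpr f) (hg : IsExpr g) : IsExprCond fun v => f v < g v := by
  simpa only [not_le] using (le hg hf).not

theorem eq (hf : IsExpr f) (hg : IsExpr g) : IsExprCond fun v => f v = g v := by
  simpa only [← le_antisymm_iff] using (le hf hg).and (le hg hf)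

theorem imp (hp : IsExprCond p) (hp' : IsExprCond p') : IsExprCond fun v => p v → p' v := by
  simpa only [not_and, not_not] using (hp.and hp'.not).not

theorem ball {P : ℕ → RamEnv → Prop} (hP : ∀ i, IsExprCond (P i)) (n : ℕ) :
    IsExprCond fun v => ∀ i < n, P i v := by
  induction n with
  | zero =>
    unfold IsExprCond
    simpa using IsExpr.const 1
  | succ n ih => simpa only [Nat.forall_lt_succ_right] using ih.and (hP n)

theorem ite [DecidablePred p] (hp : IsExprCond p) (hf : IsExpr f) (hg : IsExpr g) :
    IsExpr fun v => if p v then f v else g v := by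
  have := (hp.mul hf).add (hp.not.mul hg)
  convert this using 2 with v
  by_cases h : p v <;> simp [h]

end IsExprCond

/-- Selecting one of finitely many values by an index. -/
theorem IsExpr.select {F : ℕ → RamEnv → ℕ} (hF : ∀ i, IsExpr (F i)) {g : RamEnv → ℕ}
    (hg : IsExpr g) (n : ℕ) : IsExpr fun v => if g v < n then F (g v) v else 0 := by
  have := IsExpr.sum (F := fun i v => if g v = i then F i v else 0)
    (fun i => IsExprCond.ite (.eq hg (.const i)) (hF i) (.const 0)) n
  convert this using 2 with v
  simp

/-! ### Programs up to temporary registers -/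

/-- From every state that agrees with `s` up to temporary registers, `p` halts within `T` steps in a
state that agrees with `s'` up to temporary registers. -/
def Runs (W : ℕ) (p : Prog) (s : RamState) (T : ℕ) (s' : RamState) : Prop :=
  ∀ u, RamState.SameButTemp 11 s u → ∃ t ≤ T, ∃ u', Exec W p u t u' ∧
    RamState.SameButTemp 11 s' u'

namespace Runs

variable {W : ℕ} {p q : Prog} {s s' s'' : RamState} {T T' : ℕ}

theorem mono (h : Runs W p s T s') (hT : T ≤ T') : Runs W p s T' s' := fun u hu => by
  obtain ⟨t, ht, r⟩ := h u hu
  exact ⟨t, ht.trans hT, r⟩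

theorem seq (h : Runs W p s T s') (h' : Runs W q s' T' s'') :
    Runs W (.seq p q) s (T + T') s'' := fun u hu => by
  obtain ⟨t, ht, u1, e1, b1⟩ := h u hu
  obtain ⟨t', ht', u2, e2, b2⟩ := h' u1 b1
  exact ⟨t + t', by omega, u2, .seq e1 e2, b2⟩

theorem setReg_sameButTemp {u : RamState} (h : RamState.SameButTemp 11 s u) (r v : ℕ) :
    RamState.SameButTemp 11 (s.setReg r v) (u.setReg r v) := by
  refine ⟨h.1, fun r' hr' => ?_⟩
  simp only [RamState.setReg, Function.update_apply]
  split_ifs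
  · rfl
  · exact h.2 r' hr'

theorem setMem_sameButTemp {u : RamState} (h : RamState.SameButTemp 11 s u) (A x v : ℕ) :
    RamState.SameButTemp 11 (s.setMem A x v) (u.setMem A x v) :=
  ⟨by simp only [RamState.setMem, h.1], h.2⟩

theorem skip : Runs W .skip s 1 s := fun u hu => ⟨1, le_rfl, u, .skip _, hu⟩

theorem const (r v : ℕ) (hv : v < W) : Runs W (.const r v) s 1 (s.setReg r v) :=
  fun _ hu => ⟨1, le_rfl, _, .const _ _ _ hv, setReg_sameButTemp hu _ _⟩

theorem op (o : WordOp) (r x y : ℕ) (hx : x < 11) (hy : y < 11)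
    (hv : o.eval (s.reg x) (s.reg y) < W) :
    Runs W (.op o r x y) s 1 (s.setReg r (o.eval (s.reg x) (s.reg y))) := fun u hu => by
  have e1 := hu.2 x (.inl hx)
  have e2 := hu.2 y (.inl hy)
  refine ⟨1, le_rfl, _, .op _ o r x y (by rw [e1, e2]; exact hv), ?_⟩
  rw [e1, e2]
  exact setReg_sameButTemp hu _ _

theorem store (A x y : ℕ) (hx : x < 11) (hy : y < 11) :
    Runs W (.store A x y) s 1 (s.setMem A (s.reg x) (s.reg y)) := fun u hu => by
  have e1 := hu.2 x (.inl hx)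
  have e2 := hu.2 y (.inl hy)
  refine ⟨1, le_rfl, _, .store _ A x y, ?_⟩
  rw [e1, e2]
  exact setMem_sameButTemp hu _ _ _

/-- An expression followed by an instruction that uses its value. -/
theorem compile_seq {X : ℕ} {v : RamEnv} (hv : v.BoundedBy X) (e : RamExpr)
    (hW : X ^ e.growth < W) (hs : s.Holds v)
    (h : ∀ u, RamState.SameButTemp 11 s u → u.reg 11 = e.eval v →
      ∃ t ≤ T, ∃ u', Exec W p u t u' ∧ RamState.SameButTemp 11 s' u') :
    Runs W (.seq (e.compile 11) p) s (e.cost + T) s' := fun u hu => by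
  have hs' : u.Holds v := hs.of_sameButTemp hu le_rfl
  obtain ⟨u1, e1, r1, b1⟩ := e.exec_compile hv hW u 11 hs' le_rfl (by norm_num)
  have b2 : RamState.SameButTemp 11 s u1 :=
    ⟨b1.1.trans hu.1, fun r hr => (b1.2 r hr).trans (hu.2 r hr)⟩
  obtain ⟨t, ht, u2, e2, b3⟩ := h u1 b2 r1
  exact ⟨_, by omega, u2, .seq e1 e2, b3⟩

theorem move {X : ℕ} {v : RamEnv} (hv : v.BoundedBy X) (e : RamExpr)
    (hW : X ^ e.growth < W) (hs : s.Holds v) (r : ℕ) :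
    Runs W (.seq (e.compile 11) (.op .land r 11 11)) s (e.cost + 1)
      (s.setReg r (e.eval v)) := by
  refine compile_seq hv e hW hs fun u hu h => ⟨1, le_rfl, _, .op _ _ _ _ _ ?_, ?_⟩
  · simp only [WordOp.eval, Nat.and_self, h]
    exact (e.eval_le hv).trans_lt hW
  · simp only [WordOp.eval, Nat.and_self, h]
    exact setReg_sameButTemp hu _ _

theorem storeExpr {X : ℕ} {v : RamEnv} (hv : v.BoundedBy X) (e : RamExpr)
    (hW : X ^ e.growth < W) (hs : s.Holds v) (A x : ℕ) (hx : x < 11) :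
    Runs W (.seq (e.compile 11) (.store A x 11)) s (e.cost + 1)
      (s.setMem A (s.reg x) (e.eval v)) := by
  refine compile_seq hv e hW hs fun u hu h => ⟨1, le_rfl, _, .store _ _ _ _, ?_⟩
  rw [h, hu.2 x (.inl hx)]
  exact setMem_sameButTemp hu _ _ _

theorem iteExpr {X : ℕ} {v : RamEnv} (hv : v.BoundedBy X) (e : RamExpr)
    (hW : X ^ e.growth < W) (hs : s.Holds v) (h1 : e.eval v ≠ 0 → Runs W p s T s')
    (h2 : e.eval v = 0 → Runs W q s T s') :
    Runs W (.seq (e.compile 11) (.ite 11 p q)) s (e.cost + (T + 1)) s' := by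
  refine compile_seq hv e hW hs fun u hu h => ?_
  by_cases h0 : e.eval v = 0
  · obtain ⟨t, ht, w, hw, b⟩ := h2 h0 u hu
    exact ⟨t + 1, by omega, w, .ite_false (h.trans h0) hw, b⟩
  · obtain ⟨t, ht, w, hw, b⟩ := h1 h0 u hu
    exact ⟨t + 1, by omega, w, .ite_true (by rwa [h]) hw, b⟩

/-- A counted loop. -/
theorem loop (x : ℕ) (hx : x < 11) (N : ℕ) (σ : ℕ → RamState)
    (hσ : ∀ i ≤ N, (σ i).reg x = N - i) (hp : ∀ i < N, Runs W p (σ i) T (σ (i + 1))) :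
    Runs W (.loop x p) (σ 0) (N * (T + 1) + 1) (σ N) := by
  -- The induction runs over the number of remaining iterations.
  suffices h : ∀ j ≤ N, Runs W (.loop x p) (σ (N - j)) (j * (T + 1) + 1) (σ N) by
    simpa using h N le_rfl
  intro j
  induction j with
  | zero =>
    intro _ u hu
    refine ⟨1, by omega, u, .loop_done ?_, hu⟩
    rw [hu.2 x (.inl hx), hσ _ (by omega)]
    omega
  | succ j ih =>
    intro hj u hu
    obtain ⟨t, ht, u1, e1, b1⟩ := hp (N - (j + 1)) (by omega) u hu
    rw [show N - (j + 1) + 1 = N - j by omega] at b1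
    obtain ⟨t', ht', u2, e2, b2⟩ := ih (by omega) u1 b1
    refine ⟨t + t' + 1, ?_, u2, .loop_step ?_ e1 e2, b2⟩
    · rw [Nat.succ_mul]; omega
    · rw [hu.2 x (.inl hx), hσ _ (by omega)]
      omega

end Runs

/-! ### A program that writes down a coverage instance -/

/-- The expressions that describe a coverage instance: the number of sets, the size of the universe,
the number of candidates for the elements of a set, the test which candidates are taken, the
elements they stand for, and a threshold. -/
structure CoverExprs where
  sets : RamExpr
  univ : RamExpr
  cands : RamExpr
  test : RamExpr
  elem : RamExpr
  thr : RamExpr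

/-- Roles of the registers: 2 is the current set, 3 the current candidate, 4 and 7 count the
remaining sets and candidates, 5 is the output position, 6 holds the constant 1. Registers 10 and 12
and arrays 1 and 2 are the relocated registers 0 and 1 and arrays 0 and 1 of the solver. -/
def CoverExprs.inner (b : CoverExprs) : Prog :=
  .seq (.seq (b.test.compile 11)
      (.ite 11 (.seq (.seq (b.elem.compile 11) (.store 2 5 11)) (.op .add 5 5 6)) .skip))
    (.seq (.op .add 3 3 6) (.op .sub 7 7 6))

def CoverExprs.outer (b : CoverExprs) : Prog :=
  .seq (.store 1 2 5) (.seq (.seq (b.cands.compile 11) (.op .land 7 11 11))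
    (.seq (.loop 7 b.inner) (.seq (.const 3 0) (.seq (.op .add 2 2 6) (.op .sub 4 4 6)))))

def CoverExprs.build (b : CoverExprs) : Prog :=
  .seq (.seq (b.sets.compile 11) (.op .land 10 11 11))
    (.seq (.seq (b.univ.compile 11) (.op .land 12 11 11))
      (.seq (.seq (b.sets.compile 11) (.op .land 4 11 11))
        (.seq (.const 6 1) (.seq (.loop 4 b.outer) (.store 1 2 5)))))

/-- Register 10 is the relocated register 0 and holds the optimum after the run. The truncated
difference of threshold and optimum vanishes exactly when the threshold is reached, hence the order
of the two branches. -/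
def CoverExprs.reduction (b : CoverExprs) (P : Prog) : Prog :=
  .seq b.build (.seq P.relocate
    (.seq (b.thr.compile 11) (.seq (.op .sub 0 11 10) (.ite 0 (.const 0 0) (.const 0 1)))))

/-- The values that the building program works with. -/
structure BuildState where
  n : ℕ
  d : ℕ
  x : ℕ
  c : ℕ
  rx : ℕ
  pos : ℕ
  one : ℕ
  rc : ℕ
  nn : ℕ
  uu : ℕ
  arr : ℕ → ℕ
  starts : ℕ → ℕ
  out : ℕ → ℕ

namespace BuildState

def toState (b : BuildState) : RamState where
  reg r := if r = 0 then b.n else if r = 1 then b.d else if r = 2 then b.x else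
    if r = 3 then b.c else if r = 4 then b.rx else if r = 5 then b.pos else
    if r = 6 then b.one else if r = 7 then b.rc else if r = 10 then b.nn else
    if r = 12 then b.uu else 0
  mem A := if A = 0 then b.arr else if A = 1 then b.starts else if A = 2 then b.out else fun _ => 0

def env (b : BuildState) : RamEnv := ⟨![b.n, b.d, b.x, b.c], b.arr⟩

theorem holds (b : BuildState) : b.toState.Holds b.env := by
  refine ⟨fun i => ?_, by simp [toState, env]⟩
  fin_cases i <;> simp [toState, env]

variable (b : BuildState) (v : ℕ)

theorem setReg_two : b.toState.setReg 2 v = { b with x := v }.toState := by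
  simp only [RamState.setReg, toState, RamState.mk.injEq, and_true]
  funext r; by_cases h : r = 2 <;> simp [h]

theorem setReg_three : b.toState.setReg 3 v = { b with c := v }.toState := by
  simp only [RamState.setReg, toState, RamState.mk.injEq, and_true]
  funext r; by_cases h : r = 3 <;> simp [h]

theorem setReg_four : b.toState.setReg 4 v = { b with rx := v }.toState := by
  simp only [RamState.setReg, toState, RamState.mk.injEq, and_true]
  funext r; by_cases h : r = 4 <;> simp [h]

theorem setReg_five : b.toState.setReg 5 v = { b with pos := v }.toState := by
  simp only [RamState.setReg, toState, RamState.mk.injEq, and_true]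
  funext r; by_cases h : r = 5 <;> simp [h]

theorem setReg_six : b.toState.setReg 6 v = { b with one := v }.toState := by
  simp only [RamState.setReg, toState, RamState.mk.injEq, and_true]
  funext r; by_cases h : r = 6 <;> simp [h]

theorem setReg_seven : b.toState.setReg 7 v = { b with rc := v }.toState := by
  simp only [RamState.setReg, toState, RamState.mk.injEq, and_true]
  funext r; by_cases h : r = 7 <;> simp [h]

theorem setReg_ten : b.toState.setReg 10 v = { b with nn := v }.toState := by
  simp only [RamState.setReg, toState, RamState.mk.injEq, and_true]
  funext r; by_cases h : r = 10 <;> simp [h]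

theorem setReg_twelve : b.toState.setReg 12 v = { b with uu := v }.toState := by
  simp only [RamState.setReg, toState, RamState.mk.injEq, and_true]
  funext r; by_cases h : r = 12 <;> simp [h]

theorem setMem_one (x : ℕ) :
    b.toState.setMem 1 x v = { b with starts := Function.update b.starts x v }.toState := by
  simp only [RamState.setMem, toState, RamState.mk.injEq, true_and]
  funext A; by_cases h : A = 1 <;> simp [h]

theorem setMem_two (x : ℕ) :
    b.toState.setMem 2 x v = { b with out := Function.update b.out x v }.toState := by
  simp only [RamState.setMem, toState, RamState.mk.injEq, true_and]
  funext A; by_cases h : A = 2 <;> simp [h]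

end BuildState

theorem update_getD_length (l : List ℕ) (v : ℕ) :
    Function.update (fun t => l.getD t 0) l.length v = fun t => (l ++ [v]).getD t 0 := by
  funext t
  rcases lt_trichotomy t l.length with h | h | h
  · rw [Function.update_of_ne h.ne, List.getD_append _ _ _ _ h]
  · subst h; simp
  · rw [Function.update_of_ne h.ne', List.getD_eq_default _ _ h.le,
      List.getD_eq_default _ _ (by simpa using h)]

section Build

variable {W X : ℕ} (e : CoverExprs) (n d nn uu M : ℕ) (arr : ℕ → ℕ)

/-- The elements of the set `x` among the first `c` candidates. -/
def CoverExprs.setPrefix (x c : ℕ) : List ℕ :=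
  ((List.range c).filter fun c => e.test.eval ⟨![n, d, x, c], arr⟩ ≠ 0).map
    fun c => e.elem.eval ⟨![n, d, x, c], arr⟩

/-- The concatenation of the first `x` sets. -/
def CoverExprs.concat (x : ℕ) : List ℕ :=
  (List.range x).flatMap fun x => e.setPrefix n d arr x M

theorem CoverExprs.length_setPrefix_le (x c : ℕ) : (e.setPrefix n d arr x c).length ≤ c := by
  rw [CoverExprs.setPrefix, List.length_map]
  simpa using List.length_filter_le
    (fun c => decide (e.test.eval ⟨![n, d, x, c], arr⟩ ≠ 0)) (List.range c)

theorem CoverExprs.concat_succ (x : ℕ) :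
    e.concat n d M arr (x + 1) = e.concat n d M arr x ++ e.setPrefix n d arr x M := by
  simp [CoverExprs.concat, List.range_succ]

theorem CoverExprs.length_concat_le (x : ℕ) : (e.concat n d M arr x).length ≤ x * M := by
  induction x with
  | zero => simp [CoverExprs.concat]
  | succ x ih =>
    rw [CoverExprs.concat_succ, List.length_append, Nat.succ_mul]
    exact Nat.add_le_add ih (e.length_setPrefix_le ..)

/-- The start positions of the first `x` sets. -/
def CoverExprs.startsBelow (x : ℕ) : ℕ → ℕ :=
  fun t => if t < x then (e.concat n d M arr t).length else 0

/-- The state before candidate `c` of set `x`, where `st` are the start positions and `l` is the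
output so far. -/
def BuildState.writing (x c rx rc : ℕ) (st : ℕ → ℕ) (l : List ℕ) : BuildState where
  n := n
  d := d
  x := x
  c := c
  rx := rx
  pos := l.length
  one := 1
  rc := rc
  nn := nn
  uu := uu
  arr := arr
  starts := st
  out := fun t => l.getD t 0

theorem CoverExprs.runs_inner (x c rx rc : ℕ) (st : ℕ → ℕ) (l : List ℕ)
    (hX : RamEnv.BoundedBy ⟨![n, d, x, c], arr⟩ X)
    (hW1 : X ^ e.test.growth < W) (hW2 : X ^ e.elem.growth < W) (hW3 : l.length + c + 1 < W)
    (hW5 : rc < W) :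
    Runs W e.inner
      (BuildState.writing n d nn uu arr x c rx rc st (l ++ e.setPrefix n d arr x c)).toState
      (e.test.cost + e.elem.cost + 5)
      (BuildState.writing n d nn uu arr x (c + 1) rx (rc - 1) st
        (l ++ e.setPrefix n d arr x (c + 1))).toState := by
  set b := BuildState.writing n d nn uu arr x c rx rc st (l ++ e.setPrefix n d arr x c) with hb
  have hlen' : (l ++ e.setPrefix n d arr x c).length ≤ l.length + c := by
    rw [List.length_append]
    have := e.length_setPrefix_le n d arr x c
    omega
  set b' := BuildState.writing n d nn uu arr x c rx rc st
    (l ++ e.setPrefix n d arr x (c + 1)) with hb'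
  have hpre : e.setPrefix n d arr x (c + 1) = e.setPrefix n d arr x c ++
      if e.test.eval ⟨![n, d, x, c], arr⟩ ≠ 0 then [e.elem.eval ⟨![n, d, x, c], arr⟩] else [] := by
    simp only [CoverExprs.setPrefix, List.range_succ, List.filter_append, List.map_append]
    congr 1
    by_cases h : e.test.eval ⟨![n, d, x, c], arr⟩ = 0 <;> simp [h]
  have h1 : Runs W (.seq (e.test.compile 11)
      (.ite 11 (.seq (.seq (e.elem.compile 11) (.store 2 5 11)) (.op .add 5 5 6)) .skip))
      b.toState (e.test.cost + (e.elem.cost + 1 + 1 + 1)) b'.toState := by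
    refine Runs.iteExpr (v := b.env) hX _ hW1 b.holds (fun h => ?_) (fun h => ?_)
    · have r1 := Runs.storeExpr (v := b.env) hX e.elem hW2 b.holds 2 5 (by norm_num)
      rw [BuildState.setMem_two] at r1
      have r2 := Runs.op (W := W) (s := ({ b with
        out := Function.update b.out (b.toState.reg 5) (e.elem.eval b.env) }).toState) .add 5 5 6
        (by norm_num) (by norm_num) (by
          simp only [BuildState.toState, WordOp.eval, hb, BuildState.writing]
          norm_num
          rw [List.length_append] at hlen'
          omega)
      rw [BuildState.setReg_five] at r2
      convert r1.seq r2 using 2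
      have h' : e.test.eval ⟨![n, d, x, c], arr⟩ ≠ 0 := h
      rw [hb', hpre, if_pos h', hb]
      simp only [BuildState.writing, BuildState.mk.injEq, true_and]
      refine ⟨by simp [BuildState.toState, WordOp.eval]; omega, ?_⟩
      rw [← List.append_assoc, ← update_getD_length]
      simp only [BuildState.toState]
      rfl
    · have h' : e.test.eval ⟨![n, d, x, c], arr⟩ = 0 := h
      have : b' = b := by rw [hb', hpre, if_neg (by simpa using h'), List.append_nil]
      rw [this]
      exact Runs.skip.mono (by omega)
  have h2 := Runs.op (W := W) (s := b'.toState) .add 3 3 6 (by norm_num) (by norm_num) (by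
    simp only [BuildState.toState, WordOp.eval, hb', BuildState.writing]; norm_num; omega)
  rw [BuildState.setReg_three] at h2
  have h3 := Runs.op (W := W)
    (s := ({ b' with c := WordOp.add.eval (b'.toState.reg 3) (b'.toState.reg 6) }).toState)
    .sub 7 7 6 (by norm_num) (by norm_num) (by
    simp only [BuildState.toState, WordOp.eval, hb', BuildState.writing]; norm_num; omega)
  rw [BuildState.setReg_seven] at h3
  refine Runs.mono (T := e.test.cost + (e.elem.cost + 1 + 1 + 1) + (1 + 1)) ?_ (by omega)
  exact h1.seq (h2.seq h3)

theorem CoverExprs.runs_outer (x rx : ℕ)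
    (hX : ∀ c ≤ M, RamEnv.BoundedBy ⟨![n, d, x, c], arr⟩ X)
    (hM : e.cands.eval ⟨![n, d, x, 0], arr⟩ = M)
    (hW0 : X ^ e.cands.growth < W)
    (hW1 : X ^ e.test.growth < W) (hW2 : X ^ e.elem.growth < W) (hW3 : (x + 1) * (M + 1) < W)
    (hW5 : rx < W) :
    Runs W e.outer
      (BuildState.writing n d nn uu arr x 0 rx 0 (e.startsBelow n d M arr x)
        (e.concat n d M arr x)).toState
      ((e.cands.cost + e.test.cost + e.elem.cost + 11) * (M + 1))
      (BuildState.writing n d nn uu arr (x + 1) 0 (rx - 1) 0 (e.startsBelow n d M arr (x + 1))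
        (e.concat n d M arr (x + 1))).toState := by
  have hlen := e.length_concat_le n d M arr x
  rw [Nat.succ_mul, Nat.mul_succ] at hW3
  have h1 := Runs.store (W := W) (s := (BuildState.writing n d nn uu arr x 0 rx 0
    (e.startsBelow n d M arr x) (e.concat n d M arr x)).toState) 1 2 5 (by norm_num) (by norm_num)
  rw [BuildState.setMem_one] at h1
  have e1 : ({ BuildState.writing n d nn uu arr x 0 rx 0
      (e.startsBelow n d M arr x) (e.concat n d M arr x) with
      starts := Function.update (e.startsBelow n d M arr x) x (e.concat n d M arr x).length } :
        BuildState) =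
      BuildState.writing n d nn uu arr x 0 rx 0
        (e.startsBelow n d M arr (x + 1)) (e.concat n d M arr x) := by
    simp only [BuildState.writing, BuildState.mk.injEq, true_and, and_true]
    funext t
    simp only [Function.update_apply, CoverExprs.startsBelow]
    split_ifs <;> first | omega | simp_all
  have h1' : Runs W (.store 1 2 5) (BuildState.writing n d nn uu arr x 0 rx 0
    (e.startsBelow n d M arr x) (e.concat n d M arr x)).toState 1
    (BuildState.writing n d nn uu arr x 0 rx 0
        (e.startsBelow n d M arr (x + 1)) (e.concat n d M arr x)).toState := by
    rw [← e1]; exact h1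
  have h2 := Runs.move (W := W) (hX 0 (Nat.zero_le _)) e.cands hW0 (BuildState.writing n d nn uu
    arr x 0 rx 0 (e.startsBelow n d M arr (x + 1)) (e.concat n d M arr x)).holds 7
  rw [BuildState.setReg_seven, hM] at h2
  have h3 := Runs.loop (W := W) (p := e.inner) (T := e.test.cost + e.elem.cost + 5) 7
    (by norm_num) M
    (fun c => (BuildState.writing n d nn uu arr x c rx (M - c) (e.startsBelow n d M arr (x + 1))
      (e.concat n d M arr x ++ e.setPrefix n d arr x c)).toState)
    (fun c hc => by simp [BuildState.toState, BuildState.writing])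
    (fun c hc => by
      have := e.runs_inner (W := W) n d nn uu arr x c rx (M - c) (e.startsBelow n d M arr (x + 1))
        (e.concat n d M arr x) (hX c hc.le) hW1 hW2 (by omega) (by omega)
      rwa [Nat.sub_sub] at this)
  have e3 : e.setPrefix n d arr x 0 = [] := by simp [CoverExprs.setPrefix]
  rw [e3, List.append_nil, ← CoverExprs.concat_succ, Nat.sub_zero, Nat.sub_self] at h3
  set b := BuildState.writing n d nn uu arr x M rx 0 (e.startsBelow n d M arr (x + 1))
    (e.concat n d M arr (x + 1)) with hb
  have h4 := Runs.const (W := W) (s := b.toState) 3 0 (by omega)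
  rw [BuildState.setReg_three] at h4
  have h5 := Runs.op (W := W) (s := ({b with c := 0}).toState) .add 2 2 6 (by norm_num)
    (by norm_num) (by
      simp only [BuildState.toState, WordOp.eval, hb, BuildState.writing]; norm_num; omega)
  rw [BuildState.setReg_two] at h5
  have h6 := Runs.op (W := W) (s := ({b with
      c := 0, x := WordOp.add.eval (({b with c := 0} : BuildState).toState.reg 2)
        (({b with c := 0} : BuildState).toState.reg 6) }).toState) .sub 4 4 6 (by norm_num)
    (by norm_num) (by
      simp only [BuildState.toState, WordOp.eval, hb, BuildState.writing]; norm_num; omega)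
  rw [BuildState.setReg_four] at h6
  refine Runs.mono (h1'.seq (h2.seq (h3.seq (h4.seq (h5.seq h6))))) ?_
  nlinarith

theorem CoverExprs.runs_build
    (hX : ∀ x ≤ nn, ∀ c ≤ M, RamEnv.BoundedBy ⟨![n, d, x, c], arr⟩ X)
    (hN : e.sets.eval ⟨![n, d, 0, 0], arr⟩ = nn) (hU : e.univ.eval ⟨![n, d, 0, 0], arr⟩ = uu)
    (hM : ∀ x, e.cands.eval ⟨![n, d, x, 0], arr⟩ = M)
    (hWN : X ^ e.sets.growth < W) (hWU : X ^ e.univ.growth < W)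
    (hW0 : X ^ e.cands.growth < W)
    (hW1 : X ^ e.test.growth < W) (hW2 : X ^ e.elem.growth < W) (hW3 : (nn + 1) * (M + 1) < W) :
    Runs W e.build
      (BuildState.toState ⟨n, d, 0, 0, 0, 0, 0, 0, 0, 0, arr, fun _ => 0, fun _ => 0⟩)
      ((e.sets.cost + e.sets.cost + e.univ.cost + e.cands.cost + e.test.cost + e.elem.cost + 18)
        * ((nn + 1) * (M + 1)))
      (BuildState.writing n d nn uu arr nn 0 0 0 (e.startsBelow n d M arr (nn + 1))
        (e.concat n d M arr nn)).toState := by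
  have hle : nn + 1 ≤ (nn + 1) * (M + 1) := Nat.le_mul_of_pos_right _ (by omega)
  have h00 := hX 0 (by omega) 0 (by omega)
  have h1 := Runs.move (W := W) h00 e.sets hWN (BuildState.holds
    ⟨n, d, 0, 0, 0, 0, 0, 0, 0, 0, arr, fun _ => 0, fun _ => 0⟩) 10
  rw [BuildState.setReg_ten, hN] at h1
  have h2 := Runs.move (W := W) h00 e.univ hWU (BuildState.holds
    ⟨n, d, 0, 0, 0, 0, 0, 0, nn, 0, arr, fun _ => 0, fun _ => 0⟩) 12
  rw [BuildState.setReg_twelve, hU] at h2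
  have h3 := Runs.move (W := W) h00 e.sets hWN (BuildState.holds
    ⟨n, d, 0, 0, 0, 0, 0, 0, nn, uu, arr, fun _ => 0, fun _ => 0⟩) 4
  rw [BuildState.setReg_four, hN] at h3
  have h4 := Runs.const (W := W) (s := BuildState.toState
    ⟨n, d, 0, 0, nn, 0, 0, 0, nn, uu, arr, fun _ => 0, fun _ => 0⟩) 6 1 (by nlinarith)
  rw [BuildState.setReg_six] at h4
  have h5 := Runs.loop (W := W) (p := e.outer)
    (T := (e.cands.cost + e.test.cost + e.elem.cost + 11) * (M + 1)) 4
    (by norm_num) nn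
    (fun x => (BuildState.writing n d nn uu arr x 0 (nn - x) 0 (e.startsBelow n d M arr x)
        (e.concat n d M arr x)).toState)
    (fun x _ => by simp [BuildState.toState, BuildState.writing])
    (fun x hx => by
      have := e.runs_outer (W := W) n d nn uu M arr x (nn - x) (hX x hx.le) (hM x) hW0 hW1 hW2
        ((Nat.mul_le_mul_right _ (by omega)).trans_lt hW3) (by omega)
      rwa [Nat.sub_sub] at this)
  rw [Nat.sub_self] at h5
  have h6 := Runs.store (W := W) (s := (BuildState.writing n d nn uu arr nn 0 0 0
    (e.startsBelow n d M arr nn) (e.concat n d M arr nn)).toState) 1 2 5 (by norm_num)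
    (by norm_num)
  rw [BuildState.setMem_one] at h6
  have e6 : ({ BuildState.writing n d nn uu arr nn 0 0 0
      (e.startsBelow n d M arr nn) (e.concat n d M arr nn) with
      starts := Function.update (e.startsBelow n d M arr nn) nn (e.concat n d M arr nn).length } :
        BuildState) =
      BuildState.writing n d nn uu arr nn 0 0 0
        (e.startsBelow n d M arr (nn + 1)) (e.concat n d M arr nn) := by
    simp only [BuildState.writing, BuildState.mk.injEq, true_and, and_true]
    funext t
    simp only [Function.update_apply, CoverExprs.startsBelow]
    split_ifs <;> first | omega | simp_all
  have h6' : Runs W (.store 1 2 5) (BuildState.writing n d nn uu arr nn 0 0 0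
    (e.startsBelow n d M arr nn) (e.concat n d M arr nn)).toState 1
    (BuildState.writing n d nn uu arr nn 0 0 0
        (e.startsBelow n d M arr (nn + 1)) (e.concat n d M arr nn)).toState := by
    rw [← e6]; exact h6
  have h7 := h5.seq h6'
  refine Runs.mono (h1.seq (h2.seq (h3.seq (h4.seq h7)))) ?_
  nlinarith [Nat.zero_le (nn * M)]

end Build

theorem maxCoverProblem_mem_one (k : ℕ) (I : CoverInst) :
    ((maxCoverProblem k).input I).mem 1 =
      fun t => ((List.ofFn I.S).flatten.map Fin.val).getD t 0 := by
  funext t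
  simp only [maxCoverProblem, one_ne_zero, if_false, if_true]
  congr 1
  rw [List.map_id', ← List.flatMap_pure_eq_map]
  rfl

/-- Running a solver for maximum coverage on the instance that the expressions describe and comparing
its answer with the threshold. -/
theorem CoverExprs.exec_reduction (e : CoverExprs) {W X n d M th : ℕ} {arr : ℕ → ℕ} {k : ℕ}
    (I : CoverInst) {P : Prog} {t : ℕ} {s : RamState}
    (hP : Exec W P ((maxCoverProblem k).input I) t s) (hs : s.reg 0 = I.opt k)
    (hX : ∀ x ≤ I.n, ∀ c ≤ M, RamEnv.BoundedBy ⟨![n, d, x, c], arr⟩ X)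
    (hN : e.sets.eval ⟨![n, d, 0, 0], arr⟩ = I.n) (hU : e.univ.eval ⟨![n, d, 0, 0], arr⟩ = I.u)
    (hM : ∀ x, e.cands.eval ⟨![n, d, x, 0], arr⟩ = M)
    (hth : e.thr.eval ⟨![n, d, I.n, 0], arr⟩ = th)
    (hS : ∀ x : Fin I.n, (I.S x).map Fin.val = e.setPrefix n d arr x M)
    (hWN : X ^ e.sets.growth < W) (hWU : X ^ e.univ.growth < W)
    (hW0 : X ^ e.cands.growth < W) (hWt : X ^ e.thr.growth < W)
    (hW1 : X ^ e.test.growth < W) (hW2 : X ^ e.elem.growth < W)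
    (hW3 : (I.n + 1) * (M + 1) < W) :
    ∃ t' s', Exec W (e.reduction P)
      ⟨twoRegs n d, fun A t => if A = 0 then arr t else 0⟩ t' s' ∧
      t' ≤ (e.sets.cost + e.sets.cost + e.univ.cost + e.cands.cost + e.test.cost + e.elem.cost +
        e.thr.cost + 21) * ((I.n + 1) * (M + 1)) + t ∧
      s'.reg 0 = if th ≤ I.opt k then 1 else 0 := by
  have hle : I.n + 1 ≤ (I.n + 1) * (M + 1) := Nat.le_mul_of_pos_right _ (by omega)
  have hinit : (⟨twoRegs n d, fun A t => if A = 0 then arr t else 0⟩ : RamState) =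
      BuildState.toState ⟨n, d, 0, 0, 0, 0, 0, 0, 0, 0, arr, fun _ => 0, fun _ => 0⟩ := by
    simp only [BuildState.toState, RamState.mk.injEq]
    constructor
    · funext r
      simp only [twoRegs]
      split_ifs <;> rfl
    · funext A t
      split_ifs <;> rfl
  rw [hinit]
  obtain ⟨t1, ht1, u1, e1, b1⟩ := e.runs_build (W := W) n d I.n I.u M arr hX hN hU hM hWN hWU hW0
    hW1 hW2 hW3 _ RamState.SameButTemp.rfl'
  have hconcat : ∀ x ≤ I.n, e.concat n d M arr x =
      (((List.ofFn I.S).take x).flatten).map Fin.val := by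
    intro x hx
    induction x with
    | zero => simp [CoverExprs.concat]
    | succ x ih =>
      rw [CoverExprs.concat_succ, ih (by omega), List.take_succ_eq_append_getElem (by simpa using hx)]
      simp only [List.getElem_ofFn, List.flatten_append, List.map_append, List.flatten_singleton]
      rw [hS ⟨x, hx⟩]
  -- The instance was written directly to the relocated places, so the solver can start without any
  -- copying.
  have hemb : ((maxCoverProblem k).input I).Embeds u1 := by
    constructor
    · intro r
      rw [b1.2 _ (.inr (by omega))]
      simp only [BuildState.toState, BuildState.writing, maxCoverProblem, twoRegs]
      rcases r with _ | _ | r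
      · simp
      · simp
      · simp [show 2 * (r + 1 + 1) ≠ 2 by omega]
    · intro A
      rw [b1.1]
      rcases A with _ | _ | A
      · funext t
        simp only [BuildState.toState, BuildState.writing, maxCoverProblem, zero_add, one_ne_zero,
          if_false, if_true, CoverExprs.startsBelow,
          Nat.lt_succ_iff]
        split_ifs with ht
        · rw [hconcat t ht, List.length_map, List.length_flatten]
          rw [List.map_take, List.map_ofFn, List.sum_take_ofFn]
          rw [Finset.sum_filter]
          rfl
        · rfl
      · rw [zero_add, maxCoverProblem_mem_one]
        simp only [BuildState.toState, BuildState.writing]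
        rw [hconcat I.n le_rfl, List.take_of_length_le (by simp)]
        rfl
      · funext t
        simp [BuildState.toState, maxCoverProblem]
  obtain ⟨u2, e2, b2, a2⟩ := hP.relocate u1 hemb
  have hholds : u2.Holds ⟨![n, d, I.n, 0], arr⟩ := by
    have h1 := (BuildState.holds (BuildState.writing n d I.n I.u arr I.n 0 0 0
      (e.startsBelow n d M arr (I.n + 1)) (e.concat n d M arr I.n))).of_sameButTemp b1 le_rfl
    exact ⟨fun i => (a2.1 i (by omega)).trans (h1.1 i), a2.2.trans h1.2⟩
  obtain ⟨u3, e3, r3, b3⟩ := e.thr.exec_compile (hX I.n le_rfl 0 (by omega)) hWt u2 11 hholds le_rfl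
    (by norm_num)
  rw [hth] at r3
  have r4 : u3.reg 10 = I.opt k := by
    rw [b3.2 10 (.inl (by norm_num)), ← hs]
    exact b2.1 0
  have hth' : th < W := by
    rw [← hth]; exact (e.thr.eval_le (hX I.n le_rfl 0 (by omega))).trans_lt hWt
  have e4 : Exec W (.op .sub 0 11 10) u3 1 (u3.setReg 0 (th - I.opt k)) := by
    have := Exec.op (W := W) u3 .sub 0 11 10 (by rw [r3, r4]; exact (Nat.sub_le _ _).trans_lt hth')
    rwa [r3, r4] at this
  have htime : t1 + (t + (e.thr.cost + (1 + (1 + 1)))) ≤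
      (e.sets.cost + e.sets.cost + e.univ.cost + e.cands.cost + e.test.cost + e.elem.cost +
        e.thr.cost + 21) * ((I.n + 1) * (M + 1)) + t := by
    generalize e.sets.cost + e.sets.cost + e.univ.cost + e.cands.cost + e.test.cost +
      e.elem.cost = K at ht1 ⊢
    have h1 : 1 ≤ (I.n + 1) * (M + 1) := by omega
    generalize (I.n + 1) * (M + 1) = q at ht1 h1 ⊢
    have h2 : e.thr.cost + 3 ≤ (e.thr.cost + 3) * q := Nat.le_mul_of_pos_right _ h1
    calc _ ≤ (K + 18) * q + (e.thr.cost + 3) * q + t := by omega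
      _ = _ := by ring
  by_cases hc : th ≤ I.opt k
  · refine ⟨_, _, .seq e1 (.seq e2 (.seq e3 (.seq e4 (.ite_false ?_ (.const _ 0 1 ?_))))), ?_, ?_⟩
    · simp [RamState.setReg, hc]
    · have := I.pos; omega
    · exact htime
    · simp [RamState.setReg, hc]
  · refine ⟨_, _, .seq e1 (.seq e2 (.seq e3 (.seq e4 (.ite_true ?_ (.const _ 0 0 ?_))))), ?_, ?_⟩
    · simp [RamState.setReg]; omega
    · omega
    · exact htime
    · simp [RamState.setReg, hc]

/-- A reduction to maximum coverage that is described by expressions. The instances `f i` are solved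
in time `T (f i)`, and writing them down takes time proportional to the number of sets times the
number of candidates. -/
theorem RamProblem.SolvableInTime.of_coverExprs {k : ℕ} {κ : Type} {y : κ → CoverInst} {T : κ → ℝ}
    (hsolve : (maxCoverProblem k).SolvableInTime y T) (hT0 : ∀ j, 0 ≤ T j)
    (Q : RamProblem) {ι : Type} (x : ι → Q.Inst) (T' : ι → ℝ) (f : ι → κ)
    {fN fU fM fX fI fT : RamEnv → ℕ} (hfN : IsExpr fN) (hfU : IsExpr fU) (hfM : IsExpr fM)
    (hfX : IsExpr fX) (hfI : IsExpr fI) (hfT : IsExpr fT)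
    (n d : ι → ℕ) (arr : ι → ℕ → ℕ) (M th : ι → ℕ)
    (hin : ∀ i, Q.input (x i) = ⟨twoRegs (n i) (d i), fun A t => if A = 0 then arr i t else 0⟩)
    (hsize : ∀ i, n i + d i ≤ Q.size (x i)) (harr : ∀ i t, arr i t ≤ 1)
    (hN : ∀ i, fN ⟨![n i, d i, 0, 0], arr i⟩ = (y (f i)).n)
    (hU : ∀ i, fU ⟨![n i, d i, 0, 0], arr i⟩ = (y (f i)).u)
    (hM : ∀ i a, fM ⟨![n i, d i, a, 0], arr i⟩ = M i)
    (hth : ∀ i a, fT ⟨![n i, d i, a, 0], arr i⟩ = th i)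
    (hS : ∀ i (z : Fin (y (f i)).n), ((y (f i)).S z).map Fin.val =
      ((List.range (M i)).filter fun c => fX ⟨![n i, d i, z, c], arr i⟩ ≠ 0).map
        fun c => fI ⟨![n i, d i, z, c], arr i⟩)
    (hans : ∀ i, Q.answer (x i) = if th i ≤ (y (f i)).opt k then 1 else 0)
    (C : ℝ) (hT : ∀ i, T (f i) ≤ C * T' i)
    (hT' : ∀ i, ((((y (f i)).n + 1) * (M i + 1) : ℕ) : ℝ) ≤ C * T' i) :
    Q.SolvableInTime x T' := by
  obtain ⟨P, cP, CP, hP⟩ := hsolve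
  obtain ⟨eN, hN'⟩ := hfN
  obtain ⟨eU, hU'⟩ := hfU
  obtain ⟨eM, hM'⟩ := hfM
  obtain ⟨eX, hX'⟩ := hfX
  obtain ⟨eI, hI'⟩ := hfI
  obtain ⟨eT, hT''⟩ := hfT
  set g := eN.growth + eU.growth + eM.growth + eX.growth + eI.growth + eT.growth + 1 with hg
  set e : CoverExprs := ⟨eN, eU, eM, eX, eI, eT⟩ with he
  set K := e.sets.cost + e.sets.cost + e.univ.cost + e.cands.cost + e.test.cost + e.elem.cost +
        e.thr.cost + 21 with hK
  -- The word exponent has a summand g * g for expressions whose arguments are bounded by B ^ g, a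
  -- summand (g + 2) * cP for the words of the solver, whose instance has size at most B ^ (g + 2),
  -- and 2 * g + 5 for the length of the output and for strictness.
  refine ⟨e.reduction P, g * g + 2 * g + (g + 2) * cP + 5, (K + |CP|) * C, fun i => ?_⟩
  obtain ⟨t, s, hex, ht, hs⟩ := hP (f i)
  set B := Q.size (x i) + 2 with hB
  have hB2 : 2 ≤ B := by omega
  have hmono : ∀ {a b : ℕ}, a ≤ b → B ^ a ≤ B ^ b := fun h => Nat.pow_le_pow_right (by omega) h
  have hn : n i ≤ B := by have := hsize i; omega
  have hd : d i ≤ B := by have := hsize i; omega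
  have hb0 : RamEnv.BoundedBy ⟨![n i, d i, 0, 0], arr i⟩ B :=
    ⟨hB2, fun j => by fin_cases j <;> simp [hn, hd],
      fun t => (harr i t).trans (by omega)⟩
  have hnn : (y (f i)).n ≤ B ^ g := by
    rw [← hN i, ← hN']
    exact (eN.eval_le hb0).trans (hmono (by omega))
  have huu : (y (f i)).u ≤ B ^ g := by
    rw [← hU i, ← hU']
    exact (eU.eval_le hb0).trans (hmono (by omega))
  have hMM : M i ≤ B ^ g := by
    rw [← hM i 0, ← hM']
    exact (eM.eval_le hb0).trans (hmono (by omega))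
  have hBg : B ≤ B ^ g := Nat.le_self_pow (by omega) B
  have hXb : ∀ a ≤ (y (f i)).n, ∀ c ≤ M i,
      RamEnv.BoundedBy ⟨![n i, d i, a, c], arr i⟩ (B ^ g) := by
    intro a ha c hc
    refine ⟨hB2.trans hBg, fun j => ?_, fun t => (harr i t).trans (by omega)⟩
    fin_cases j <;> simp
    · exact hn.trans hBg
    · exact hd.trans hBg
    · exact ha.trans hnn
    · exact hc.trans hMM
  set W := B ^ (g * g + 2 * g + (g + 2) * cP + 5) with hW
  have hgrow : ∀ a ≤ g, (B ^ g) ^ a < W := by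
    intro a ha
    rw [← pow_mul]
    refine Nat.pow_lt_pow_right (by omega) ?_
    have := Nat.mul_le_mul_left g ha
    omega
  have hsum : (y (f i)).n + (y (f i)).u + 2 ≤ B ^ (g + 2) := by
    have h4 : B ^ g * 4 ≤ B ^ (g + 2) := by
      rw [pow_add B g 2]
      exact Nat.mul_le_mul_left _ (by nlinarith)
    omega
  have hexW : Exec W P ((maxCoverProblem k).input (y (f i))) t s := by
    refine Exec.mono ?_ hex
    calc ((maxCoverProblem k).size (y (f i)) + 2) ^ cP ≤ (B ^ (g + 2)) ^ cP :=
          Nat.pow_le_pow_left hsum _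
      _ = B ^ ((g + 2) * cP) := (pow_mul _ _ _).symm
      _ ≤ W := hmono (by omega)
  have hprod : ((y (f i)).n + 1) * (M i + 1) < W := by
    calc ((y (f i)).n + 1) * (M i + 1) ≤ (B ^ g * B) * (B ^ g * B) := by
          refine Nat.mul_le_mul ?_ ?_ <;> nlinarith
      _ = B ^ (2 * g + 2) := by ring
      _ < W := Nat.pow_lt_pow_right (by omega) (by omega)
  obtain ⟨t', s', hex', ht', hs'⟩ := e.exec_reduction (W := W) (X := B ^ g) (n := n i) (d := d i)
    (M := M i) (th := th i) (arr := arr i) (k := k) (y (f i)) hexW hs hXb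
    ((hN' _).trans (hN i)) ((hU' _).trans (hU i)) (fun a => (hM' _).trans (hM i a))
    ((hT'' _).trans (hth i _)) (fun z => by
      rw [hS i z]
      simp only [CoverExprs.setPrefix, he, hX', hI'])
    (hgrow _ (by simp only [he]; omega)) (hgrow _ (by simp only [he]; omega))
    (hgrow _ (by simp only [he]; omega)) (hgrow _ (by simp only [he]; omega))
    (hgrow _ (by simp only [he]; omega)) (hgrow _ (by simp only [he]; omega)) hprod
  refine ⟨t', s', ?_, ?_, hs'.trans (hans i).symm⟩
  · rw [hin i]; exact hex'
  · have h1 : (t' : ℝ) ≤ K * ((((y (f i)).n + 1) * (M i + 1) : ℕ) : ℝ) + t := by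
      exact_mod_cast ht'
    have h2 : (t : ℝ) ≤ |CP| * T (f i) :=
      ht.trans (mul_le_mul_of_nonneg_right (le_abs_self _) (hT0 _))
    have h3 : |CP| * T (f i) ≤ |CP| * (C * T' i) :=
      mul_le_mul_of_nonneg_left (hT i) (abs_nonneg _)
    have h4 : (K : ℝ) * ((((y (f i)).n + 1) * (M i + 1) : ℕ) : ℝ) ≤ K * (C * T' i) :=
      mul_le_mul_of_nonneg_left (hT' i) (Nat.cast_nonneg _)
    calc (t' : ℝ) ≤ K * (C * T' i) + |CP| * (C * T' i) := by linarith
      _ = _ := by ring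

/-! ### Counting digit strings -/

theorem Finset.sum_range_mul_eq {R : Type*} [AddCommMonoid R] (f : ℕ → R) (m n : ℕ) :
    ∑ e ∈ Finset.range (m * n), f e =
      ∑ y ∈ Finset.range m, ∑ c ∈ Finset.range n, f (y * n + c) := by
  induction m with
  | zero => simp
  | succ m ih => rw [Nat.succ_mul, Finset.sum_range_add, ih, Finset.sum_range_succ]

/-- Because s ^ a = s, the power s ^ c is the product of the s ^ d over the digits d of c in base a.
The sum over all digit strings then factors into one sum per position. It is applied with s = 1 and,
for odd a, with s = -1. -/
theorem sum_pow_mul_prod_digits (a : ℕ) (s : ℤ) (hs : s ^ a = s) (H : ℕ) (g : ℕ → ℕ → ℤ) :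
    ∑ c ∈ Finset.range (a ^ H), s ^ c * ∏ p ∈ Finset.range H, g p (c / a ^ p % a) =
      ∏ p ∈ Finset.range H, ∑ d ∈ Finset.range a, s ^ d * g p d := by
  induction H generalizing g with
  | zero => simp
  | succ H ih =>
    rw [pow_succ, Finset.sum_range_mul_eq, Finset.prod_range_succ', ← ih fun p => g (p + 1),
      Finset.sum_mul]
    refine Finset.sum_congr rfl fun c _ => ?_
    rw [Finset.mul_sum]
    refine Finset.sum_congr rfl fun d hd => ?_
    rw [Finset.mem_range] at hd
    have h1 : s ^ (c * a + d) = s ^ c * s ^ d := by rw [pow_add, mul_comm c, pow_mul, hs]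
    have h2 : (c * a + d) / a ^ 0 % a = d := by
      rw [pow_zero, Nat.div_one, mul_comm, Nat.mul_add_mod, Nat.mod_eq_of_lt hd]
    have h3 : ∀ p, (c * a + d) / a ^ (p + 1) % a = c / a ^ p % a := fun p => by
      rw [pow_succ', ← Nat.div_div_eq_div_mul, mul_comm c a, Nat.mul_add_div (by omega),
        Nat.div_eq_of_lt hd, add_zero]
    rw [Finset.prod_range_succ', h1, h2]
    simp only [h3]
    ring

theorem sum_neg_one_pow_odd (q : ℕ) : ∑ d ∈ Finset.range (2 * q + 1), (-1 : ℤ) ^ d = 1 := by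
  induction q with
  | zero => simp
  | succ q ih =>
    rw [show 2 * (q + 1) + 1 = 2 * q + 1 + 1 + 1 by ring, Finset.sum_range_succ,
      Finset.sum_range_succ, ih]
    simp [pow_succ, pow_mul]

/-- The even codes with odd base, none of whose digits takes the forbidden value. -/
theorem two_mul_card_avoiding (q H : ℕ) (b : ℕ → ℕ) (hb : ∀ p < H, b p < 2 * q + 1) :
    2 * ((Finset.range ((2 * q + 1) ^ H)).filter fun c =>
        c % 2 = 0 ∧ ∀ p < H, c / (2 * q + 1) ^ p % (2 * q + 1) ≠ b p).card =
      (2 * q) ^ H + if ∀ p < H, b p % 2 = 1 then 2 ^ H else 0 := by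
  set a := 2 * q + 1 with ha
  have hodd : Odd a := ⟨q, ha⟩
  let g : ℕ → ℕ → ℤ := fun p d => if d ≠ b p then 1 else 0
  -- The sum with s = 1 counts all avoiding strings, the one with s = -1 counts them with the sign
  -- of their parity; added together they count the even ones twice.
  have h1 := sum_pow_mul_prod_digits a 1 (one_pow _) H g
  have h2 := sum_pow_mul_prod_digits a (-1) hodd.neg_one_pow H g
  have e1 : ∀ p ∈ Finset.range H, ∑ d ∈ Finset.range a, (1 : ℤ) ^ d * g p d = 2 * q := by
    intro p hp
    have hb' := hb p (Finset.mem_range.1 hp)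
    have : ∀ d, (1 : ℤ) ^ d * g p d = 1 - if d = b p then 1 else 0 := fun d => by
      by_cases h : d = b p <;> simp [g, h]
    simp only [this, Finset.sum_sub_distrib, Finset.sum_ite_eq', Finset.mem_range, hb', if_true]
    simp [ha]
  -- The alternating sum over all 2q + 1 digits is 1, so leaving out b p gives 1 - (-1) ^ b p, which
  -- is 2 or 0. The product over the positions survives only if every forbidden digit is odd.
  have e2 : ∀ p ∈ Finset.range H, ∑ d ∈ Finset.range a, (-1 : ℤ) ^ d * g p d =
      if b p % 2 = 1 then 2 else 0 := by
    intro p hp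
    have hb' := hb p (Finset.mem_range.1 hp)
    have : ∀ d, (-1 : ℤ) ^ d * g p d = (-1) ^ d - if d = b p then (-1) ^ d else 0 := fun d => by
      by_cases h : d = b p <;> simp [g, h]
    simp only [this, Finset.sum_sub_distrib, Finset.sum_ite_eq', Finset.mem_range, hb', if_true]
    rw [ha, sum_neg_one_pow_odd]
    split_ifs with h
    · rw [(Nat.odd_iff.2 h).neg_one_pow]; norm_num
    · rw [(Nat.even_iff.2 (by omega)).neg_one_pow]; norm_num
  rw [Finset.prod_congr rfl e1, Finset.prod_const, Finset.card_range] at h1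
  rw [Finset.prod_congr rfl e2] at h2
  have e3 : (∏ p ∈ Finset.range H, if b p % 2 = 1 then (2 : ℤ) else 0) =
      if ∀ p < H, b p % 2 = 1 then 2 ^ H else 0 := by
    split_ifs with h
    · rw [Finset.prod_congr rfl fun p hp => if_pos (h p (Finset.mem_range.1 hp))]
      simp
    · push Not at h
      obtain ⟨p, hp, hp'⟩ := h
      exact Finset.prod_eq_zero (Finset.mem_range.2 hp) (if_neg hp')
  rw [e3] at h2
  have key : (2 * ((Finset.range (a ^ H)).filter fun c =>
        c % 2 = 0 ∧ ∀ p < H, c / a ^ p % a ≠ b p).card : ℤ) =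
      (2 * q : ℤ) ^ H + if ∀ p < H, b p % 2 = 1 then 2 ^ H else 0 := by
    rw [← h1, ← h2, ← Finset.sum_add_distrib, Finset.card_filter]
    push_cast
    rw [Finset.mul_sum]
    refine Finset.sum_congr rfl fun c _ => ?_
    have hg : ∏ p ∈ Finset.range H, g p (c / a ^ p % a) =
        if ∀ p < H, c / a ^ p % a ≠ b p then 1 else 0 := by
      simp only [g]
      split_ifs with h
      · exact Finset.prod_eq_one fun p hp => if_pos (h p (Finset.mem_range.1 hp))
      · push Not at h
        obtain ⟨p, hp, hp'⟩ := h
        exact Finset.prod_eq_zero (Finset.mem_range.2 hp) (if_neg (not_not.2 hp'))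
    rw [hg]
    by_cases h1 : c % 2 = 0
    · rw [(Nat.even_iff.2 h1).neg_one_pow]
      by_cases h2 : ∀ p < H, c / a ^ p % a ≠ b p
      · rw [if_pos ⟨h1, h2⟩, if_pos h2]; norm_num
      · rw [if_neg fun h => h2 h.2, if_neg h2]; norm_num
    · rw [(Nat.odd_iff.2 (by omega)).neg_one_pow, if_neg fun h => h1 h.1]; ring
  split_ifs at key ⊢ <;> exact_mod_cast key

theorem two_mul_card_even_range_odd (n : ℕ) (hn : n % 2 = 1) :
    2 * ((Finset.range n).filter fun c => c % 2 = 0).card = n + 1 := by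
  obtain ⟨m, rfl⟩ : ∃ m, n = 2 * m + 1 := ⟨n / 2, by omega⟩
  clear hn
  induction m with
  | zero => decide
  | succ m ih =>
    rw [show 2 * (m + 1) + 1 = 2 * m + 1 + 1 + 1 by ring, Finset.range_add_one, Finset.filter_insert,
      if_pos (by omega), Finset.range_add_one, Finset.filter_insert, if_neg (by omega),
      Finset.card_insert_of_notMem (by simp)]
    omega

/-! ### Inserting and deleting a digit. -/

/-- The number `c` with the digit `b` inserted at position `p`. -/
def insertDigit (a p b c : ℕ) : ℕ := c % a ^ p + a ^ p * (b + a * (c / a ^ p))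

/-- The number `c` with the digit at position `p` deleted. -/
def deleteDigit (a p c : ℕ) : ℕ := c % a ^ p + a ^ p * (c / a ^ (p + 1))

theorem insertDigit_deleteDigit {a p b c : ℕ} (ha : 0 < a) (hc : c / a ^ p % a = b) :
    insertDigit a p b (deleteDigit a p c) = c := by
  have hp : 0 < a ^ p := Nat.pow_pos ha
  have hlt := Nat.mod_lt c hp
  have h1 : deleteDigit a p c % a ^ p = c % a ^ p := by
    rw [deleteDigit, Nat.add_mul_mod_self_left, Nat.mod_mod]
  have h2 : deleteDigit a p c / a ^ p = c / a ^ p / a := by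
    rw [deleteDigit, Nat.add_mul_div_left _ _ hp, Nat.div_eq_of_lt hlt, zero_add, pow_succ,
      Nat.div_div_eq_div_mul]
  rw [insertDigit, h1, h2, ← hc, Nat.mod_add_div, Nat.mod_add_div]

theorem digit_insertDigit {a p b c : ℕ} (hb : b < a) : insertDigit a p b c / a ^ p % a = b := by
  have hp : 0 < a ^ p := Nat.pow_pos (by omega)
  rw [insertDigit, Nat.add_mul_div_left _ _ hp, Nat.div_eq_of_lt (Nat.mod_lt _ hp), zero_add,
    Nat.add_mul_mod_self_left, Nat.mod_eq_of_lt hb]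

theorem deleteDigit_insertDigit {a p b c : ℕ} (hb : b < a) :
    deleteDigit a p (insertDigit a p b c) = c := by
  have hp : 0 < a ^ p := Nat.pow_pos (by omega)
  have hlt := Nat.mod_lt c hp
  have h1 : insertDigit a p b c % a ^ p = c % a ^ p := by
    rw [insertDigit, Nat.add_mul_mod_self_left, Nat.mod_mod]
  have h2 : insertDigit a p b c / a ^ (p + 1) = c / a ^ p := by
    rw [pow_succ, ← Nat.div_div_eq_div_mul, insertDigit, Nat.add_mul_div_left _ _ hp,
      Nat.div_eq_of_lt hlt, zero_add, Nat.add_mul_div_left _ _ (by omega), Nat.div_eq_of_lt hb,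
      zero_add]
  rw [deleteDigit, h1, h2, Nat.mod_add_div]

theorem insertDigit_lt {a p b c H : ℕ} (hb : b < a) (hp : p < H) (hc : c < a ^ (H - 1)) :
    insertDigit a p b c < a ^ H := by
  have ha : 0 < a ^ p := Nat.pow_pos (by omega)
  obtain ⟨r, rfl⟩ : ∃ r, H = p + 1 + r := ⟨H - (p + 1), by omega⟩
  rw [show p + 1 + r - 1 = p + r by omega, pow_add] at hc
  have h1 : c / a ^ p < a ^ r := by rwa [Nat.div_lt_iff_lt_mul ha, mul_comm]
  have h2 : a * (c / a ^ p + 1) ≤ a * a ^ r := Nat.mul_le_mul_left _ h1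
  have h3 : a ^ p * (b + a * (c / a ^ p) + 1) ≤ a ^ p * (a * a ^ r) :=
    Nat.mul_le_mul_left _ (by rw [Nat.mul_add, mul_one] at h2; omega)
  have h4 := Nat.mod_lt c ha
  rw [insertDigit, pow_add, pow_succ, mul_assoc]
  rw [Nat.mul_add, mul_one] at h3
  omega

theorem deleteDigit_lt {a p c H : ℕ} (hp : p < H) (hc : c < a ^ H) :
    deleteDigit a p c < a ^ (H - 1) := by
  have ha : 0 < a := by
    rcases Nat.eq_zero_or_pos a with rfl | h
    · rw [zero_pow (by omega)] at hc; omega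
    · exact h
  have ha' : 0 < a ^ p := Nat.pow_pos ha
  obtain ⟨r, rfl⟩ : ∃ r, H = p + 1 + r := ⟨H - (p + 1), by omega⟩
  rw [pow_add] at hc
  have h1 : c / a ^ (p + 1) < a ^ r := by rwa [Nat.div_lt_iff_lt_mul (Nat.pow_pos ha), mul_comm]
  have h2 : a ^ p * (c / a ^ (p + 1) + 1) ≤ a ^ p * a ^ r := Nat.mul_le_mul_left _ h1
  have h4 := Nat.mod_lt c ha'
  rw [deleteDigit, show p + 1 + r - 1 = p + r by omega, pow_add a p r]
  rw [Nat.mul_add, mul_one] at h2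
  omega

/-- All powers of an odd base are odd, so the parity of a number is that of its digit sum. -/
theorem insertDigit_mod_two {a p b c : ℕ} (ha : a % 2 = 1) :
    insertDigit a p b c % 2 = (c + b) % 2 := by
  have hp : a ^ p % 2 = 1 := by simp [Nat.pow_mod, ha]
  have h1 : c % a ^ p + a ^ p * (c / a ^ p) = c := Nat.mod_add_div _ _
  have h2 : (c % a ^ p + c / a ^ p) % 2 = c % 2 := by
    conv_rhs => rw [← h1, Nat.add_mod, Nat.mul_mod, hp, one_mul, Nat.mod_mod, ← Nat.add_mod]
  have h3 : insertDigit a p b c % 2 = (c % a ^ p + (b + c / a ^ p)) % 2 := by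
    rw [insertDigit, Nat.add_mod, Nat.mul_mod, hp, one_mul, Nat.mod_mod, Nat.add_mod b, Nat.mul_mod a,
      ha, one_mul, Nat.mod_mod]
    omega
  omega

/-- The even codes with a given digit. -/
theorem two_mul_card_digit_eq_le {a p b H : ℕ} (ha : a % 2 = 1) (hp : p < H) :
    2 * ((Finset.range (a ^ H)).filter fun c => c % 2 = 0 ∧ c / a ^ p % a = b).card ≤
      a ^ (H - 1) + 1 := by
  have hle : ((Finset.range (a ^ H)).filter fun c => c % 2 = 0 ∧ c / a ^ p % a = b).card ≤
      (Finset.range ((a ^ (H - 1) + 1) / 2)).card := by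
    -- Deleting the prescribed digit is injective, and evenness of c fixes the parity of what
    -- remains, so halving loses nothing.
    refine Finset.card_le_card_of_injOn (fun c => deleteDigit a p c / 2) ?_ ?_
    · intro c hc
      simp only [Finset.coe_filter, Finset.mem_range, Set.mem_ofPred_eq] at hc
      simp only [Finset.coe_range, Set.mem_Iio]
      have := deleteDigit_lt hp hc.1
      omega
    · intro c hc c' hc' h
      simp only [Finset.coe_filter, Finset.mem_range, Set.mem_ofPred_eq] at hc hc'
      have e1 := insertDigit_deleteDigit (by omega) hc.2.2
      have e2 := insertDigit_deleteDigit (by omega) hc'.2.2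
      have m1 := insertDigit_mod_two (p := p) (b := b) (c := deleteDigit a p c) ha
      have m2 := insertDigit_mod_two (p := p) (b := b) (c := deleteDigit a p c') ha
      rw [e1, hc.2.1] at m1
      rw [e2, hc'.2.1] at m2
      rw [← e1, ← e2]
      congr 1
      simp only at h
      omega
  rw [Finset.card_range] at hle
  omega

/-- With H = n + 2 and base b + 1, the left terms compare the strings that hit a prescribed letter
somewhere, (b + 1) ^ H - b ^ H of them, with the first-order count H * (b + 1) ^ (H - 1). As in the
Bonferroni inequalities, overlaps at pairs of positions account for the difference, here bounded
generously by H ^ 2 * (b + 1) ^ (H - 2). -/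
theorem pow_add_mul_pow_le (b n : ℕ) :
    b ^ (n + 2) + (n + 2) * (b + 1) ^ (n + 1) ≤ (b + 1) ^ (n + 2) + (n + 2) ^ 2 * (b + 1) ^ n := by
  induction n with
  | zero => ring_nf; omega
  | succ n ih =>
    have h1 : b * (b ^ (n + 2) + (n + 2) * (b + 1) ^ (n + 1)) ≤
        b * ((b + 1) ^ (n + 2) + (n + 2) ^ 2 * (b + 1) ^ n) := Nat.mul_le_mul_left _ ih
    have h2 : (b + 1) ^ (n + 1) = b * (b + 1) ^ n + (b + 1) ^ n := by ring
    have h3 : (b + 1) ^ (n + 2) = b * (b + 1) ^ (n + 1) + (b + 1) ^ (n + 1) := by ring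
    have h4 : (b + 1) ^ (n + 3) = b * (b + 1) ^ (n + 2) + (b + 1) ^ (n + 2) := by ring
    have h5 : b ^ (n + 3) = b * b ^ (n + 2) := by ring
    rw [show n + 1 + 2 = n + 3 by ring, show n + 1 + 1 = n + 2 by ring, h4, h5]
    generalize (b + 1) ^ n = A at *
    generalize (b + 1) ^ (n + 1) = B at *
    generalize (b + 1) ^ (n + 2) = C at *
    generalize b ^ (n + 2) = E at *
    subst h2
    subst h3
    nlinarith [Nat.zero_le (n * A), Nat.zero_le (n * (b * A))]

/-- Two members of a family of finite sets that overlap. -/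
theorem card_biUnion_add_card_inter_le {ι α : Type*} [DecidableEq ι] [DecidableEq α]
    (s : Finset ι) (f : ι → Finset α) {i j : ι} (hi : i ∈ s) (hj : j ∈ s) (hij : i ≠ j) :
    (s.biUnion f).card + (f i ∩ f j).card ≤ ∑ t ∈ s, (f t).card := by
  have hj' : j ∈ s.erase i := Finset.mem_erase.2 ⟨hij.symm, hj⟩
  have h1 : s.biUnion f = (f i ∪ f j) ∪ ((s.erase i).erase j).biUnion f := by
    conv_lhs => rw [← Finset.insert_erase hi, ← Finset.insert_erase hj', Finset.biUnion_insert,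
      Finset.biUnion_insert]
    rw [Finset.union_assoc]
  have h2 := Finset.card_union_le (f i ∪ f j) (((s.erase i).erase j).biUnion f)
  have h3 := Finset.card_union_add_card_inter (f i) (f j)
  have h4 : (((s.erase i).erase j).biUnion f).card ≤ ∑ t ∈ (s.erase i).erase j, (f t).card :=
    Finset.card_biUnion_le
  rw [← Finset.add_sum_erase s _ hi, ← Finset.add_sum_erase _ _ hj', h1]
  omega

/-! ### The coverage instance of a sparse orthogonality problem -/

/-- There are `k` groups of `L` vectors, divided into `q` blocks, and `D` constraints. The constraint
`y` concerns the groups `grp y 0, …, grp y (H - 1)`; `bit y p j` tells whether the vector `j` of the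
group `grp y p` takes part in a violation of `y`, and `y` is violated if all `H` chosen vectors do. -/
structure SparseOV where
  k : ℕ
  H : ℕ
  L : ℕ
  q : ℕ
  D : ℕ
  blk : ℕ → ℕ
  grp : ℕ → ℕ → ℕ
  bit : ℕ → ℕ → ℕ → ℕ

namespace SparseOV

variable (X : SparseOV)

/-- The condition `balanced` says that every group occurs in equally many constraints. It bounds the
constraint part of any choice of k sets by the same number, even if several sets come from one
group. -/
structure Valid : Prop where
  two_le : 2 ≤ X.H
  k_pos : 0 < X.k
  L_pos : 0 < X.L
  q_pos : 0 < X.q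
  blk_lt : ∀ j < X.L, X.blk j < X.q
  grp_lt : ∀ y < X.D, ∀ p < X.H, X.grp y p < X.k
  grp_inj : ∀ y < X.D, ∀ p < X.H, ∀ p' < X.H, X.grp y p = X.grp y p' → p = p'
  bit_le : ∀ y p j, X.bit y p j ≤ 1
  balanced : ∀ i < X.k, ((Finset.range X.D).filter fun y => ∃ p < X.H, X.grp y p = i).card =
    ((Finset.range X.D).filter fun y => ∃ p < X.H, X.grp y p = 0).card

/-- No constraint is violated by the vectors `v i`. -/
def Solution (v : ℕ → ℕ) : Prop :=
  (∀ i < X.k, v i < X.L) ∧ ∀ y < X.D, ∃ p < X.H, X.bit y p (v (X.grp y p)) = 0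

/-- The number of letters. -/
def a : ℕ := 2 * X.q + 1

/-- The multiplicity of the elements that punish two sets from the same group. -/
def W : ℕ := X.D * X.H ^ 2 * X.a ^ (X.H - 2) + 1

/-- The letter is 2B + 1 for bit 1 and 2B + 2 for bit 0, where B is the block. The letter 0 is never
used; it makes the number of letters odd. -/
def letter (y p j : ℕ) : ℕ := 2 * X.blk j + 2 - X.bit y p j

/-- The code of an unordered pair of blocks of the group `i`. -/
def pairCode (i B B' : ℕ) : ℕ := (i * X.q + (B - (B - B'))) * X.q + (B' + (B - B'))

/-- A candidate is a constraint, a position and the H - 1 digits at the other positions; the digit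
at the position is the letter of the set. Enumerating these instead of the whole universe keeps the
writing time near the number of sets times the set size. -/
def mainCands : ℕ := X.D * (X.H * X.a ^ (X.H - 1))

def cands : ℕ := X.mainCands + X.q * X.W

def sets : ℕ := X.k * X.L

def univ : ℕ := X.D * X.a ^ X.H + X.k * X.q * X.q * X.W

/-- The gadget part of k sets from distinct groups, plus, for each constraint, the even codes
covered when it is not violated: half of a ^ H + 1, less half of (2q) ^ H. -/
def thr : ℕ := X.k * (X.q * X.W) + X.D * ((X.a ^ X.H + 1 - (2 * X.q) ^ X.H) / 2)

def candY (c : ℕ) : ℕ := c / (X.H * X.a ^ (X.H - 1))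

def candP (c : ℕ) : ℕ := c / X.a ^ (X.H - 1) % X.H

def mainCode (x c : ℕ) : ℕ :=
  insertDigit X.a (X.candP c) (X.letter (X.candY c) (X.candP c) (x % X.L))
    (c % X.a ^ (X.H - 1))

def test (x c : ℕ) : ℕ :=
  if c < X.mainCands then
    if X.grp (X.candY c) (X.candP c) = x / X.L ∧ X.mainCode x c % 2 = 0 then 1 else 0
  else 1

def elem (x c : ℕ) : ℕ :=
  if c < X.mainCands then X.candY c * X.a ^ X.H + X.mainCode x c
  else X.D * X.a ^ X.H + (X.pairCode (x / X.L) (X.blk (x % X.L)) ((c - X.mainCands) / X.W) * X.W +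
    (c - X.mainCands) % X.W)

def setList (x : ℕ) : List ℕ :=
  ((List.range X.cands).filter fun c => X.test x c ≠ 0).map fun c => X.elem x c

/-- The set `x` contains the element with code `c` of the constraint `y`. -/
def Main (x y c : ℕ) : Prop :=
  c % 2 = 0 ∧ ∃ p < X.H, X.grp y p = x / X.L ∧ c / X.a ^ p % X.a = X.letter y p (x % X.L)

/-- The set `x` contains the element `g` of the gadget for the groups. -/
def Gadget (x g : ℕ) : Prop :=
  ∃ B < X.q, ∃ w < X.W, g = X.pairCode (x / X.L) (X.blk (x % X.L)) B * X.W + w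

variable {X}

theorem a_pos : 0 < X.a := by simp [a]

theorem W_pos : 0 < X.W := by simp [W]

theorem a_mod_two : X.a % 2 = 1 := by simp only [a]; omega

/-- Truncated subtraction expresses minimum and maximum by the operations of expressions. The code
is therefore symmetric in the two blocks. -/
theorem pairCode_eq (i B B' : ℕ) :
    X.pairCode i B B' = (i * X.q + min B B') * X.q + max B B' := by
  simp only [pairCode]
  congr 1
  · congr 2; omega
  · omega

theorem pairCode_lt {i B B' : ℕ} (hi : i < X.k) (hB : B < X.q) (hB' : B' < X.q) :
    X.pairCode i B B' < X.k * X.q * X.q := by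
  rw [pairCode_eq]
  have h1 : i * X.q + min B B' + 1 ≤ X.k * X.q := by
    have : (i + 1) * X.q ≤ X.k * X.q := Nat.mul_le_mul_right _ hi
    rw [Nat.succ_mul] at this
    omega
  have h2 := Nat.mul_le_mul_right X.q h1
  rw [Nat.succ_mul] at h2
  omega

theorem pairCode_inj {i i' B B' C C' : ℕ} (hB : B < X.q) (hB' : B' < X.q)
    (hC : C < X.q) (hC' : C' < X.q) (h : X.pairCode i B C = X.pairCode i' B' C') :
    i = i' ∧ min B C = min B' C' ∧ max B C = max B' C' := by
  rw [pairCode_eq, pairCode_eq] at h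
  have hq : 0 < X.q := by omega
  have e1 := congrArg (· / X.q) h
  have e2 := congrArg (· % X.q) h
  simp only [Nat.mul_comm _ X.q, Nat.mul_add_div hq, Nat.mul_add_mod] at e1 e2
  rw [Nat.div_eq_of_lt (by omega), Nat.div_eq_of_lt (by omega), add_zero, add_zero] at e1
  rw [Nat.mod_eq_of_lt (by omega), Nat.mod_eq_of_lt (by omega)] at e2
  have e3 := congrArg (· / X.q) e1
  have e4 := congrArg (· % X.q) e1
  simp only [Nat.mul_add_div hq, Nat.mul_add_mod] at e3 e4
  rw [Nat.div_eq_of_lt (by omega), Nat.div_eq_of_lt (by omega), add_zero, add_zero] at e3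
  rw [Nat.mod_eq_of_lt (by omega), Nat.mod_eq_of_lt (by omega)] at e4
  exact ⟨e3, e4, e2⟩

theorem div_lt_k {x : ℕ} (hx : x < X.sets) : x / X.L < X.k := by
  rw [sets, mul_comm] at hx
  exact Nat.div_lt_of_lt_mul hx

theorem Valid.mod_lt_L (hX : X.Valid) (x : ℕ) : x % X.L < X.L := Nat.mod_lt _ hX.L_pos

theorem Valid.letter_lt (hX : X.Valid) {y p j : ℕ} (hj : j < X.L) : X.letter y p j < X.a := by
  have := hX.blk_lt j hj
  simp only [letter, a]; omega

theorem Valid.letter_mod_two (hX : X.Valid) {y p j : ℕ} :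
    X.letter y p j % 2 = 1 ↔ X.bit y p j = 1 := by
  have := hX.bit_le y p j
  simp only [letter]; omega

theorem Valid.letter_div_two (hX : X.Valid) {y p j : ℕ} :
    (X.letter y p j - 1) / 2 = X.blk j := by
  have := hX.bit_le y p j
  simp only [letter]; omega

theorem Valid.candY_lt (hX : X.Valid) {c : ℕ} (hc : c < X.mainCands) : X.candY c < X.D := by
  have := hX.two_le
  rw [mainCands] at hc
  exact (Nat.div_lt_iff_lt_mul (Nat.mul_pos (by omega) (Nat.pow_pos a_pos))).2 hc

theorem Valid.candP_lt (hX : X.Valid) (c : ℕ) : X.candP c < X.H :=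
  Nat.mod_lt _ (by have := hX.two_le; omega)

theorem Valid.mainCode_lt (hX : X.Valid) (x c : ℕ) : X.mainCode x c < X.a ^ X.H :=
  insertDigit_lt (hX.letter_lt (hX.mod_lt_L x)) (hX.candP_lt c) (Nat.mod_lt _ (Nat.pow_pos a_pos))

theorem Valid.mem_setList (hX : X.Valid) {x : ℕ} {e : ℕ} :
    e ∈ X.setList x ↔ (∃ y < X.D, ∃ c < X.a ^ X.H, e = y * X.a ^ X.H + c ∧ X.Main x y c) ∨
      ∃ g, e = X.D * X.a ^ X.H + g ∧ X.Gadget x g := by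
  have hA : 0 < X.a ^ (X.H - 1) := Nat.pow_pos a_pos
  have hH := hX.two_le
  have hL := hX.mod_lt_L x
  simp only [setList, List.mem_map, List.mem_filter, List.mem_range, decide_eq_true_eq]
  constructor
  · rintro ⟨c, ⟨hc, ht⟩, rfl⟩
    by_cases hm : c < X.mainCands
    · left
      rw [test, if_pos hm] at ht
      obtain ⟨h1, h2⟩ : X.grp (X.candY c) (X.candP c) = x / X.L ∧ X.mainCode x c % 2 = 0 := by
        by_contra h
        rw [if_neg h] at ht
        exact ht rfl
      refine ⟨X.candY c, hX.candY_lt hm, X.mainCode x c, hX.mainCode_lt x c, ?_, h2, X.candP c,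
        hX.candP_lt c, h1, digit_insertDigit (hX.letter_lt hL)⟩
      rw [elem, if_pos hm]
    · right
      rw [elem, if_neg hm]
      refine ⟨_, rfl, (c - X.mainCands) / X.W, ?_, (c - X.mainCands) % X.W,
        Nat.mod_lt _ W_pos, rfl⟩
      rw [Nat.div_lt_iff_lt_mul W_pos]
      rw [cands] at hc
      omega
  · rintro (⟨y, hy, c, hc, rfl, h2, p, hp, hg, hl⟩ | ⟨g, rfl, B, hB, w, hw, rfl⟩)
    · have hdel := deleteDigit_lt hp hc
      -- The candidate that stands for the constraint y, the position p and the code without its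
      -- digit at p.
      set c' := (y * X.H + p) * X.a ^ (X.H - 1) + deleteDigit X.a p c with hc'
      have e1 : c' / X.a ^ (X.H - 1) = y * X.H + p := by
        rw [hc', mul_comm, Nat.mul_add_div hA, Nat.div_eq_of_lt hdel, add_zero]
      have e2 : c' % X.a ^ (X.H - 1) = deleteDigit X.a p c := by
        rw [hc', mul_comm, Nat.mul_add_mod, Nat.mod_eq_of_lt hdel]
      have e3 : X.candY c' = y := by
        rw [candY, mul_comm, ← Nat.div_div_eq_div_mul, e1, mul_comm, Nat.mul_add_div (by omega),
          Nat.div_eq_of_lt hp, add_zero]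
      have e4 : X.candP c' = p := by
        rw [candP, e1, mul_comm, Nat.mul_add_mod, Nat.mod_eq_of_lt hp]
      have e5 : X.mainCode x c' = c := by
        rw [mainCode, e2, e3, e4]
        exact insertDigit_deleteDigit a_pos hl
      have hlt : c' < X.mainCands := by
        have h1 : y * X.H + p + 1 ≤ X.D * X.H := by
          have : (y + 1) * X.H ≤ X.D * X.H := Nat.mul_le_mul_right _ hy
          rw [Nat.succ_mul] at this
          omega
        have h3 := Nat.mul_le_mul_right (X.a ^ (X.H - 1)) h1
        rw [Nat.succ_mul] at h3
        rw [mainCands, ← mul_assoc]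
        omega
      refine ⟨c', ⟨hlt.trans_le (Nat.le_add_right _ _), ?_⟩, ?_⟩
      · rw [test, if_pos hlt, e3, e4, e5, if_pos ⟨hg, h2⟩]
        norm_num
      · rw [elem, if_pos hlt, e3, e5]
    · have hlt : ¬ (X.mainCands + (B * X.W + w) < X.mainCands) := by omega
      refine ⟨X.mainCands + (B * X.W + w), ⟨?_, ?_⟩, ?_⟩
      · have : (B + 1) * X.W ≤ X.q * X.W := Nat.mul_le_mul_right _ hB
        rw [Nat.succ_mul] at this
        rw [cands]
        omega
      · rw [test, if_neg hlt]
        norm_num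
      · rw [elem, if_neg hlt, Nat.add_sub_cancel_left, mul_comm B, Nat.mul_add_div W_pos,
          Nat.div_eq_of_lt hw, Nat.mul_add_mod, Nat.mod_eq_of_lt hw, add_zero]

theorem Valid.gadget_lt (hX : X.Valid) {x g : ℕ} (hx : x < X.sets) (hg : X.Gadget x g) :
    g < X.k * X.q * X.q * X.W := by
  obtain ⟨B, hB, w, hw, rfl⟩ := hg
  have h1 := pairCode_lt (div_lt_k hx) (hX.blk_lt _ (hX.mod_lt_L x)) hB
  have h2 := Nat.mul_le_mul_right X.W h1
  rw [Nat.succ_mul] at h2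
  omega

theorem Valid.lt_univ (hX : X.Valid) {x e : ℕ} (hx : x < X.sets) (he : e ∈ X.setList x) :
    e < X.univ := by
  rcases hX.mem_setList.1 he with ⟨y, hy, c, hc, rfl, -⟩ | ⟨g, rfl, hg⟩
  · have : (y + 1) * X.a ^ X.H ≤ X.D * X.a ^ X.H := Nat.mul_le_mul_right _ hy
    rw [Nat.succ_mul] at this
    rw [univ]
    omega
  · have := hX.gadget_lt hx hg
    rw [univ]
    omega

/-- A candidate can be recovered from its element. In the main part the element gives the constraint
and the code; the position is determined by the group of the set through `grp_inj`, and the other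
digits by deletion. In the gadget, the pair and the block of the set determine the second block. -/
theorem Valid.nodup_setList (hX : X.Valid) (x : ℕ) : (X.setList x).Nodup := by
  have hH := hX.two_le
  refine List.Nodup.map_on ?_ (List.nodup_range.filter _)
  intro c hc c' hc' h
  simp only [List.mem_filter, List.mem_range, decide_eq_true_eq] at hc hc'
  have hbound : ∀ c < X.mainCands, X.elem x c < X.D * X.a ^ X.H := fun c hc => by
    have h1 : (X.candY c + 1) * X.a ^ X.H ≤ X.D * X.a ^ X.H :=
      Nat.mul_le_mul_right _ (hX.candY_lt hc)
    have h2 := hX.mainCode_lt x c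
    rw [Nat.succ_mul] at h1
    rw [elem, if_pos hc]
    omega
  have hbound' : ∀ c, ¬ c < X.mainCands → X.D * X.a ^ X.H ≤ X.elem x c := fun c hc => by
    rw [elem, if_neg hc]
    exact Nat.le_add_right _ _
  by_cases hm : c < X.mainCands <;> by_cases hm' : c' < X.mainCands
  · have hcode := hX.mainCode_lt x c
    have hcode' := hX.mainCode_lt x c'
    have hP := Nat.pow_pos (n := X.H) (a_pos (X := X))
    rw [elem, elem, if_pos hm, if_pos hm', mul_comm, mul_comm (X.candY c')] at h
    have hy := congrArg (· / X.a ^ X.H) h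
    have hcd := congrArg (· % X.a ^ X.H) h
    simp only [Nat.mul_add_div hP, Nat.mul_add_mod] at hy hcd
    rw [Nat.div_eq_of_lt hcode, Nat.div_eq_of_lt hcode', add_zero, add_zero] at hy
    rw [Nat.mod_eq_of_lt hcode, Nat.mod_eq_of_lt hcode'] at hcd
    have ht := hc.2
    have ht' := hc'.2
    rw [test, if_pos hm] at ht
    rw [test, if_pos hm'] at ht'
    obtain ⟨g, -⟩ : X.grp (X.candY c) (X.candP c) = x / X.L ∧ X.mainCode x c % 2 = 0 := by
      by_contra h
      rw [if_neg h] at ht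
      exact ht rfl
    obtain ⟨g', -⟩ : X.grp (X.candY c') (X.candP c') = x / X.L ∧ X.mainCode x c' % 2 = 0 := by
      by_contra h
      rw [if_neg h] at ht'
      exact ht' rfl
    rw [← hy] at g'
    have hp := hX.grp_inj _ (hX.candY_lt hm) _ (hX.candP_lt c) _ (hX.candP_lt c') (g.trans g'.symm)
    have hmod : c % X.a ^ (X.H - 1) = c' % X.a ^ (X.H - 1) := by
      have h1 := congrArg (deleteDigit X.a (X.candP c)) hcd
      rw [mainCode, mainCode, ← hp, deleteDigit_insertDigit (hX.letter_lt (hX.mod_lt_L x)),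
        deleteDigit_insertDigit (hX.letter_lt (hX.mod_lt_L x))] at h1
      exact h1
    rw [candY, candY, mul_comm, ← Nat.div_div_eq_div_mul, ← Nat.div_div_eq_div_mul] at hy
    rw [candP, candP] at hp
    rw [← Nat.div_add_mod c (X.a ^ (X.H - 1)), ← Nat.div_add_mod c' (X.a ^ (X.H - 1)), hmod,
      ← Nat.div_add_mod (c / X.a ^ (X.H - 1)) X.H, ← Nat.div_add_mod (c' / X.a ^ (X.H - 1)) X.H,
      hy, hp]
  · have := hbound c hm
    have := hbound' c' hm'
    omega
  · have := hbound c' hm'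
    have := hbound' c hm
    omega
  · rw [elem, elem, if_neg hm, if_neg hm'] at h
    have h := Nat.add_left_cancel h
    have hB : ∀ c < X.cands, ¬ c < X.mainCands → (c - X.mainCands) / X.W < X.q := by
      intro c hc hm
      rw [Nat.div_lt_iff_lt_mul W_pos]
      rw [cands] at hc
      omega
    rw [mul_comm, mul_comm (X.pairCode _ _ ((c' - X.mainCands) / X.W))] at h
    have h1 := congrArg (· / X.W) h
    have h2 := congrArg (· % X.W) h
    simp only [Nat.mul_add_div W_pos, Nat.mul_add_mod, Nat.mod_mod] at h1 h2
    rw [Nat.div_eq_of_lt (Nat.mod_lt _ W_pos), Nat.div_eq_of_lt (Nat.mod_lt _ W_pos), add_zero,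
      add_zero] at h1
    have hb := hX.blk_lt _ (hX.mod_lt_L x)
    obtain ⟨-, h3, h4⟩ := pairCode_inj hb hb (hB c hc.1 hm) (hB c' hc'.1 hm') h1
    have h5 : (c - X.mainCands) / X.W = (c' - X.mainCands) / X.W := by omega
    have h6 : c - X.mainCands = c' - X.mainCands := by
      rw [← Nat.div_add_mod (c - X.mainCands) X.W, ← Nat.div_add_mod (c' - X.mainCands) X.W, h5, h2]
    omega

/-- The coverage instance. -/
def Valid.inst (hX : X.Valid) : CoverInst where
  n := X.sets
  pos := Nat.mul_pos hX.k_pos hX.L_pos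
  u := X.univ
  S x := (X.setList x).pmap Fin.mk fun _ he => hX.lt_univ x.2 he
  nodup x := (hX.nodup_setList x).pmap fun _ _ _ _ h => Fin.mk.inj h

theorem Valid.map_val_inst (hX : X.Valid) (x : Fin hX.inst.n) :
    (hX.inst.S x).map Fin.val = X.setList x := by
  simp [Valid.inst, List.map_pmap]

theorem Valid.mem_inst (hX : X.Valid) (x : Fin hX.inst.n) (e : Fin hX.inst.u) :
    e ∈ hX.inst.S x ↔ (e : ℕ) ∈ X.setList x := by
  rw [← hX.map_val_inst x, List.mem_map_of_injective Fin.val_injective]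

instance (x y c : ℕ) : Decidable (X.Main x y c) := by unfold Main; infer_instance

instance (x g : ℕ) : Decidable (X.Gadget x g) := by unfold Gadget; infer_instance

/-- The elements of the constraint `y` in the set `x`. -/
def mainSet (X : SparseOV) (x y : ℕ) : Finset ℕ :=
  (Finset.range (X.a ^ X.H)).filter fun c => X.Main x y c

/-- The elements of the gadget in the set `x`. -/
def gadgetSet (X : SparseOV) (x : ℕ) : Finset ℕ :=
  (Finset.range (X.k * X.q * X.q * X.W)).filter fun g => X.Gadget x g

/-- The universe is cut into one interval of length a ^ H per constraint and the interval of the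
gadget, and membership in a set is decided within each interval separately. -/
theorem Valid.card_cover (hX : X.Valid) {m : ℕ} (x : Fin m → Fin hX.inst.n) :
    (Finset.univ.biUnion fun t : Fin m => (hX.inst.S (x t)).toFinset).card =
      ∑ y ∈ Finset.range X.D, (Finset.univ.biUnion fun t => X.mainSet (x t) y).card +
        (Finset.univ.biUnion fun t => X.gadgetSet (x t)).card := by
  have h1 : (Finset.univ.biUnion fun t : Fin m => (hX.inst.S (x t)).toFinset).map Fin.valEmbedding =
      (Finset.range X.univ).filter fun e => ∃ t, e ∈ X.setList (x t) := by
    ext e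
    simp only [Finset.mem_map, Finset.mem_biUnion, Finset.mem_univ, true_and, List.mem_toFinset,
      Finset.mem_filter, Finset.mem_range, Fin.valEmbedding_apply]
    constructor
    · rintro ⟨e, ⟨t, ht⟩, rfl⟩
      exact ⟨e.2, t, (hX.mem_inst _ _).1 ht⟩
    · rintro ⟨he, t, ht⟩
      exact ⟨⟨e, he⟩, ⟨t, (hX.mem_inst _ _).2 ht⟩, rfl⟩
  have hP : 0 < X.a ^ X.H := Nat.pow_pos a_pos
  rw [← Finset.card_map Fin.valEmbedding, h1, Finset.card_filter, univ, Finset.sum_range_add,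
    Finset.sum_range_mul_eq]
  congr 1
  · refine Finset.sum_congr rfl fun y hy => ?_
    rw [← Finset.card_filter]
    congr 1
    ext c
    simp only [Finset.mem_filter, Finset.mem_range, Finset.mem_biUnion, Finset.mem_univ, true_and,
      mainSet, exists_and_left]
    refine and_congr_right fun hc => exists_congr fun t => ?_
    rw [Finset.mem_range] at hy
    rw [hX.mem_setList]
    constructor
    · rintro (⟨y', _, c', hc', h, hm⟩ | ⟨g, h, -⟩)
      · rw [mul_comm, mul_comm y'] at h
        have e1 := congrArg (· / X.a ^ X.H) h
        have e2 := congrArg (· % X.a ^ X.H) h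
        simp only [Nat.mul_add_div hP, Nat.mul_add_mod] at e1 e2
        rw [Nat.div_eq_of_lt hc, Nat.div_eq_of_lt hc', add_zero, add_zero] at e1
        rw [Nat.mod_eq_of_lt hc, Nat.mod_eq_of_lt hc'] at e2
        rwa [e1, e2]
      · have : (y + 1) * X.a ^ X.H ≤ X.D * X.a ^ X.H := Nat.mul_le_mul_right _ hy
        rw [Nat.succ_mul] at this
        omega
    · exact fun h => .inl ⟨y, hy, c, hc, rfl, h⟩
  · rw [← Finset.card_filter]
    congr 1
    ext g
    simp only [Finset.mem_filter, Finset.mem_range, Finset.mem_biUnion, Finset.mem_univ, true_and,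
      gadgetSet, exists_and_left]
    refine and_congr_right fun hg => exists_congr fun t => ?_
    rw [hX.mem_setList]
    constructor
    · rintro (⟨y', hy', c', hc', h, hm⟩ | ⟨g', h, hm⟩)
      · have : (y' + 1) * X.a ^ X.H ≤ X.D * X.a ^ X.H := Nat.mul_le_mul_right _ hy'
        rw [Nat.succ_mul] at this
        omega
      · rwa [Nat.add_left_cancel h]
    · exact fun h => .inr ⟨g, rfl, h⟩

end SparseOV

namespace SparseOV

variable {X : SparseOV}

/-! ### The optimum of the coverage instance -/

theorem Valid.card_gadgetSet (hX : X.Valid) {x : ℕ} (hx : x < X.sets) :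
    (X.gadgetSet x).card = X.q * X.W := by
  have hb := hX.blk_lt _ (hX.mod_lt_L x)
  have h : X.gadgetSet x = (Finset.range X.q ×ˢ Finset.range X.W).image fun z =>
      X.pairCode (x / X.L) (X.blk (x % X.L)) z.1 * X.W + z.2 := by
    ext g
    simp only [gadgetSet, Finset.mem_filter, Finset.mem_range, Finset.mem_image, Finset.mem_product,
      Prod.exists]
    constructor
    · rintro ⟨_, B, hB, w, hw, rfl⟩
      exact ⟨B, w, ⟨hB, hw⟩, rfl⟩
    · rintro ⟨B, w, ⟨hB, hw⟩, rfl⟩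
      have : X.Gadget x (X.pairCode (x / X.L) (X.blk (x % X.L)) B * X.W + w) :=
        ⟨B, hB, w, hw, rfl⟩
      exact ⟨hX.gadget_lt hx this, this⟩
  rw [h, Finset.card_image_of_injOn, Finset.card_product, Finset.card_range, Finset.card_range]
  rintro ⟨B, w⟩ hz ⟨B', w'⟩ hz' he
  simp only [Finset.coe_product, Finset.coe_range, Set.mem_prod, Set.mem_Iio] at hz hz' he
  rw [mul_comm, mul_comm (X.pairCode _ _ B')] at he
  have h1 := congrArg (· / X.W) he
  have h2 := congrArg (· % X.W) he
  simp only [Nat.mul_add_div W_pos, Nat.mul_add_mod] at h1 h2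
  rw [Nat.div_eq_of_lt hz.2, Nat.div_eq_of_lt hz'.2, add_zero, add_zero] at h1
  rw [Nat.mod_eq_of_lt hz.2, Nat.mod_eq_of_lt hz'.2] at h2
  obtain ⟨-, h3, h4⟩ := pairCode_inj hb hb hz.1 hz'.1 h1
  rw [Prod.mk.injEq]
  exact ⟨by omega, h2⟩

/-- Both sets contain the W elements of the pair formed by their two blocks. The blocks may
coincide, which is why pairs (B, B) are included. -/
theorem Valid.le_card_gadgetSet_inter (hX : X.Valid) {x x' : ℕ} (hx : x < X.sets)
    (h : x / X.L = x' / X.L) : X.W ≤ (X.gadgetSet x ∩ X.gadgetSet x').card := by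
  have hb := hX.blk_lt _ (hX.mod_lt_L x)
  have hb' := hX.blk_lt _ (hX.mod_lt_L x')
  have hsub : (Finset.range X.W).image (fun w =>
      X.pairCode (x / X.L) (X.blk (x % X.L)) (X.blk (x' % X.L)) * X.W + w) ⊆
      X.gadgetSet x ∩ X.gadgetSet x' := by
    intro g hg
    obtain ⟨w, hw, rfl⟩ := Finset.mem_image.1 hg
    rw [Finset.mem_range] at hw
    have h1 : X.Gadget x (X.pairCode (x / X.L) (X.blk (x % X.L)) (X.blk (x' % X.L)) * X.W + w) :=
      ⟨_, hb', w, hw, rfl⟩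
    have h2 : X.Gadget x' (X.pairCode (x / X.L) (X.blk (x % X.L)) (X.blk (x' % X.L)) * X.W + w) :=
      ⟨_, hb, w, hw, by rw [h, pairCode_eq, pairCode_eq, min_comm, max_comm]⟩
    have h3 := hX.gadget_lt hx h1
    simp only [gadgetSet, Finset.mem_inter, Finset.mem_filter, Finset.mem_range]
    exact ⟨⟨h3, h1⟩, h3, h2⟩
  calc X.W = _ := by
        rw [Finset.card_image_of_injective _ fun w w' h => Nat.add_left_cancel h, Finset.card_range]
    _ ≤ _ := Finset.card_le_card hsub

theorem Valid.disjoint_gadgetSet (hX : X.Valid) {x x' : ℕ} (h : x / X.L ≠ x' / X.L) :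
    Disjoint (X.gadgetSet x) (X.gadgetSet x') := by
  rw [Finset.disjoint_left]
  intro g hg hg'
  simp only [gadgetSet, Finset.mem_filter] at hg hg'
  obtain ⟨-, B, hB, w, hw, rfl⟩ := hg
  obtain ⟨-, B', hB', w', hw', he⟩ := hg'
  rw [mul_comm, mul_comm (X.pairCode _ _ B')] at he
  have h1 := congrArg (· / X.W) he
  simp only [Nat.mul_add_div W_pos] at h1
  rw [Nat.div_eq_of_lt hw, Nat.div_eq_of_lt hw', add_zero, add_zero] at h1
  exact h (pairCode_inj (hX.blk_lt _ (hX.mod_lt_L x)) (hX.blk_lt _ (hX.mod_lt_L x')) hB hB' h1).1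

theorem Valid.two_mul_card_mainSet_le (hX : X.Valid) {x y : ℕ} (hy : y < X.D) :
    2 * (X.mainSet x y).card ≤
      if ∃ p < X.H, X.grp y p = x / X.L then X.a ^ (X.H - 1) + 1 else 0 := by
  split_ifs with h
  · obtain ⟨p, hp, hg⟩ := h
    refine le_trans ?_ (two_mul_card_digit_eq_le (b := X.letter y p (x % X.L)) a_mod_two hp)
    refine Nat.mul_le_mul_left _ (Finset.card_le_card fun c hc => ?_)
    simp only [mainSet, Finset.mem_filter] at hc ⊢
    obtain ⟨h1, h2, p', hp', hg', hl⟩ := hc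
    obtain rfl := hX.grp_inj y hy _ hp _ hp' (hg.trans hg'.symm)
    exact ⟨h1, h2, hl⟩
  · have : X.mainSet x y = ∅ := by
      refine Finset.filter_eq_empty_iff.2 ?_
      rintro c - ⟨-, p, hp, hg, -⟩
      exact h ⟨p, hp, hg⟩
    rw [this]
    simp

/-- Double counting of the incidences between groups and constraints: each constraint concerns
exactly H groups, and by `balanced` each group is concerned equally often. -/
theorem Valid.k_mul_card_eq (hX : X.Valid) :
    X.k * ((Finset.range X.D).filter fun y => ∃ p < X.H, X.grp y p = 0).card = X.D * X.H := by
  have h1 : ∑ i ∈ Finset.range X.k,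
      ((Finset.range X.D).filter fun y => ∃ p < X.H, X.grp y p = i).card =
      X.k * ((Finset.range X.D).filter fun y => ∃ p < X.H, X.grp y p = 0).card := by
    rw [Finset.sum_congr rfl fun i hi => hX.balanced i (Finset.mem_range.1 hi), Finset.sum_const,
      Finset.card_range, smul_eq_mul]
  have h2 := Finset.sum_card_bipartiteAbove_eq_sum_card_bipartiteBelow
    (s := Finset.range X.k) (t := Finset.range X.D) fun i y => ∃ p < X.H, X.grp y p = i
  simp only [Finset.bipartiteAbove, Finset.bipartiteBelow] at h2
  rw [← h1, h2]
  have h3 : ∀ y ∈ Finset.range X.D,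
      ((Finset.range X.k).filter fun i => ∃ p < X.H, X.grp y p = i).card = X.H := by
    intro y hy
    rw [Finset.mem_range] at hy
    have : ((Finset.range X.k).filter fun i => ∃ p < X.H, X.grp y p = i) =
        (Finset.range X.H).image (X.grp y) := by
      ext i
      simp only [Finset.mem_filter, Finset.mem_range, Finset.mem_image]
      constructor
      · exact fun h => h.2
      · rintro ⟨p, hp, rfl⟩
        exact ⟨hX.grp_lt y hy p hp, p, hp, rfl⟩
    rw [this, Finset.card_image_of_injOn, Finset.card_range]
    intro p hp p' hp' h
    simp only [Finset.coe_range, Set.mem_Iio] at hp hp'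
    exact hX.grp_inj y hy p hp p' hp' h
  rw [Finset.sum_congr rfl h3, Finset.sum_const, Finset.card_range, smul_eq_mul]

theorem Valid.pow_le (hX : X.Valid) :
    (2 * X.q) ^ X.H + X.H * X.a ^ (X.H - 1) ≤ X.a ^ X.H + X.H ^ 2 * X.a ^ (X.H - 2) := by
  obtain ⟨n, hn⟩ : ∃ n, X.H = n + 2 := ⟨X.H - 2, by have := hX.two_le; omega⟩
  rw [hn]
  exact pow_add_mul_pow_le _ _

/-- Both a ^ H + 1 and (2q) ^ H are even, so the division by 2 in the threshold is exact. -/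
theorem Valid.two_mul_thr (hX : X.Valid) :
    2 * X.thr + X.D * (2 * X.q) ^ X.H = 2 * (X.k * (X.q * X.W)) + X.D * (X.a ^ X.H + 1) := by
  have h1 : (2 * X.q) ^ X.H ≤ X.a ^ X.H := Nat.pow_le_pow_left (by simp [a]) _
  have h2 : (2 * X.q) ^ X.H % 2 = 0 := by
    rw [Nat.pow_mod, Nat.mul_mod_right, zero_pow (by have := hX.two_le; omega), Nat.zero_mod]
  have h3 : X.a ^ X.H % 2 = 1 := by simp [Nat.pow_mod, a_mod_two]
  rw [thr]
  obtain ⟨z, hz⟩ : ∃ z, (X.a ^ X.H + 1 - (2 * X.q) ^ X.H) / 2 = z := ⟨_, rfl⟩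
  have h4 : X.a ^ X.H + 1 = 2 * z + (2 * X.q) ^ X.H := by omega
  rw [hz, h4]
  ring

/-- Choosing two sets from the same group is not optimal. -/
theorem Valid.card_cover_lt_thr (hX : X.Valid) (x : Fin X.k → Fin hX.inst.n) {t t' : Fin X.k}
    (htt : t ≠ t') (h : (x t : ℕ) / X.L = (x t' : ℕ) / X.L) :
    (Finset.univ.biUnion fun t => (hX.inst.S (x t)).toFinset).card < X.thr := by
  rw [hX.card_cover x]
  have hlt : ∀ t, (x t : ℕ) < X.sets := fun t => (x t).2
  -- The coincidence of two groups costs at least W gadget elements.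
  have hg : (Finset.univ.biUnion fun t => X.gadgetSet (x t)).card + X.W ≤ X.k * (X.q * X.W) := by
    have h1 := card_biUnion_add_card_inter_le Finset.univ (fun t => X.gadgetSet (x t))
      (Finset.mem_univ t) (Finset.mem_univ t') htt
    have h2 := hX.le_card_gadgetSet_inter (hlt t) h
    rw [Finset.sum_congr rfl fun t _ => hX.card_gadgetSet (hlt t)] at h1
    simp only [Finset.sum_const, Finset.card_univ, Fintype.card_fin, smul_eq_mul] at h1
    omega
  have hm : 2 * ∑ y ∈ Finset.range X.D, (Finset.univ.biUnion fun t => X.mainSet (x t) y).card ≤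
      X.D * X.H * (X.a ^ (X.H - 1) + 1) := by
    calc 2 * ∑ y ∈ Finset.range X.D, (Finset.univ.biUnion fun t => X.mainSet (x t) y).card
        ≤ ∑ y ∈ Finset.range X.D, ∑ t, 2 * (X.mainSet (x t) y).card := by
          rw [Finset.mul_sum]
          refine Finset.sum_le_sum fun y _ => ?_
          rw [← Finset.mul_sum]
          exact Nat.mul_le_mul_left _ Finset.card_biUnion_le
      _ ≤ ∑ y ∈ Finset.range X.D, ∑ t, if ∃ p < X.H, X.grp y p = (x t : ℕ) / X.L then
            X.a ^ (X.H - 1) + 1 else 0 :=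
          Finset.sum_le_sum fun y hy => Finset.sum_le_sum fun t _ =>
            hX.two_mul_card_mainSet_le (Finset.mem_range.1 hy)
      _ = ∑ t, ((Finset.range X.D).filter fun y => ∃ p < X.H, X.grp y p = (x t : ℕ) / X.L).card *
            (X.a ^ (X.H - 1) + 1) := by
          rw [Finset.sum_comm]
          refine Finset.sum_congr rfl fun t _ => ?_
          rw [← Finset.sum_filter, Finset.sum_const, smul_eq_mul]
      _ = X.D * X.H * (X.a ^ (X.H - 1) + 1) := by
          -- By `balanced` the chosen groups no longer matter, and the total is that of one set per
          -- group.
          rw [Finset.sum_congr rfl fun t _ => by rw [hX.balanced _ (div_lt_k (hlt t))]]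
          simp only [Finset.sum_const, Finset.card_univ, Fintype.card_fin, smul_eq_mul]
          rw [← mul_assoc, hX.k_mul_card_eq]
  have hthr := hX.two_mul_thr
  -- The union bound overestimates the constraint part at the threshold by second-order terms and
  -- rounding only; twice W exceeds this gain.
  have hpow := Nat.mul_le_mul_left X.D hX.pow_le
  have hH : X.D * X.H ≤ X.D * X.H ^ 2 * X.a ^ (X.H - 2) := by
    rw [pow_two, mul_assoc]
    refine Nat.mul_le_mul_left _ ?_
    calc X.H = X.H * 1 * 1 := by ring
      _ ≤ X.H * X.H * X.a ^ (X.H - 2) :=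
        Nat.mul_le_mul (Nat.mul_le_mul_left _ (by have := hX.two_le; omega)) (Nat.pow_pos a_pos)
  have hW : X.W = X.D * X.H ^ 2 * X.a ^ (X.H - 2) + 1 := rfl
  generalize (∑ y ∈ Finset.range X.D,
    (Finset.univ.biUnion fun t => X.mainSet (x t) y).card) = u at hm ⊢
  generalize X.k * (X.q * X.W) = v at hg hthr
  generalize X.a ^ (X.H - 2) = z at hpow hH hW
  generalize (2 * X.q) ^ X.H = z' at hpow hthr
  linarith

/-- Within the even codes, the complement of the union consists of the codes that avoid the letters
of the chosen vectors at all H positions, and `two_mul_card_avoiding` counts it. A violated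
constraint thus loses 2 ^ (H - 1) elements. -/
theorem Valid.two_mul_card_biUnion_mainSet (hX : X.Valid) {m : ℕ} (x : Fin m → ℕ) (v : ℕ → ℕ)
    (hv : ∀ t, x t % X.L = v (x t / X.L)) (hs : ∀ i < X.k, ∃ t, x t / X.L = i)
    {y : ℕ} (hy : y < X.D) :
    2 * (Finset.univ.biUnion fun t => X.mainSet (x t) y).card + (2 * X.q) ^ X.H +
      (if ∀ p < X.H, X.bit y p (v (X.grp y p)) = 1 then 2 ^ X.H else 0) = X.a ^ X.H + 1 := by
  have hvL : ∀ i < X.k, v i < X.L := fun i hi => by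
    obtain ⟨t, rfl⟩ := hs i hi
    rw [← hv]
    exact hX.mod_lt_L _
  have h1 := two_mul_card_avoiding X.q X.H (fun p => X.letter y p (v (X.grp y p)))
    (fun p hp => hX.letter_lt (hvL _ (hX.grp_lt y hy p hp)))
  simp only [hX.letter_mod_two] at h1
  have h2 := two_mul_card_even_range_odd (X.a ^ X.H) (by simp [Nat.pow_mod, a_mod_two])
  have h3 : (Finset.univ.biUnion fun t => X.mainSet (x t) y) =
      ((Finset.range (X.a ^ X.H)).filter fun c => c % 2 = 0).filter fun c =>
        ¬ ∀ p < X.H, c / X.a ^ p % X.a ≠ X.letter y p (v (X.grp y p)) := by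
    ext c
    simp only [Finset.mem_biUnion, Finset.mem_univ, true_and, mainSet, Finset.mem_filter,
      Finset.mem_range]
    push Not
    constructor
    · rintro ⟨t, hc, he, p, hp, hg, hl⟩
      refine ⟨⟨hc, he⟩, p, hp, ?_⟩
      rw [hl, hg, hv]
    · rintro ⟨⟨hc, he⟩, p, hp, hl⟩
      obtain ⟨t, ht⟩ := hs _ (hX.grp_lt y hy p hp)
      refine ⟨t, hc, he, p, hp, ht.symm, ?_⟩
      rw [hl, hv, ht]
  have h4 := Finset.card_filter_add_card_filter_not (s := (Finset.range (X.a ^ X.H)).filter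
    fun c => c % 2 = 0) (fun c => ∀ p < X.H, c / X.a ^ p % X.a ≠ X.letter y p (v (X.grp y p)))
  rw [Finset.filter_filter] at h4
  rw [h3]
  have h1' : 2 * ((Finset.range (X.a ^ X.H)).filter fun c => c % 2 = 0 ∧
      ∀ p < X.H, c / X.a ^ p % X.a ≠ X.letter y p (v (X.grp y p))).card = _ := h1
  omega

/-- Choosing one set from each group. -/
theorem Valid.two_mul_card_cover (hX : X.Valid) (x : Fin X.k → Fin hX.inst.n) (v : ℕ → ℕ)
    (hv : ∀ t, (x t : ℕ) % X.L = v ((x t : ℕ) / X.L))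
    (hs : ∀ i < X.k, ∃ t, (x t : ℕ) / X.L = i) :
    2 * (Finset.univ.biUnion fun t => (hX.inst.S (x t)).toFinset).card +
      ∑ y ∈ Finset.range X.D, (if ∀ p < X.H, X.bit y p (v (X.grp y p)) = 1 then 2 ^ X.H else 0) =
      2 * X.thr := by
  rw [hX.card_cover x]
  have hlt : ∀ t, (x t : ℕ) < X.sets := fun t => (x t).2
  have hinj : Function.Injective fun t => (⟨(x t : ℕ) / X.L, div_lt_k (hlt t)⟩ : Fin X.k) := by
    refine Finite.injective_iff_surjective.2 fun i => ?_
    obtain ⟨t, ht⟩ := hs i i.2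
    exact ⟨t, Fin.ext ht⟩
  have hg : (Finset.univ.biUnion fun t => X.gadgetSet (x t)).card = X.k * (X.q * X.W) := by
    rw [Finset.card_biUnion fun t _ t' _ htt => hX.disjoint_gadgetSet fun h =>
      htt (hinj (Fin.ext h)), Finset.sum_congr rfl fun t _ => hX.card_gadgetSet (hlt t)]
    simp
  have hm := Finset.sum_congr (rfl : Finset.range X.D = _) fun y hy =>
    hX.two_mul_card_biUnion_mainSet (fun t => (x t : ℕ)) v hv hs (Finset.mem_range.1 hy)
  rw [Finset.sum_add_distrib, Finset.sum_add_distrib, ← Finset.mul_sum, Finset.sum_const,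
    Finset.sum_const, Finset.card_range, smul_eq_mul, smul_eq_mul] at hm
  have hthr := hX.two_mul_thr
  rw [hg]
  omega

/-- A choice that reaches the threshold uses distinct groups by `card_cover_lt_thr`, hence each of
the k groups once. Then `two_mul_card_cover` expresses the deficit as a sum of nonnegative terms
over the violated constraints, so there are none. Conversely, a solution has deficit 0. -/
theorem Valid.thr_le_opt_iff (hX : X.Valid) :
    X.thr ≤ hX.inst.opt X.k ↔ ∃ v, X.Solution v := by
  have hL := hX.L_pos
  constructor
  · intro h
    have : Nonempty (Fin hX.inst.n) := ⟨⟨0, hX.inst.pos⟩⟩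
    obtain ⟨x, -, hx⟩ := Finset.exists_mem_eq_sup
      (Finset.univ : Finset (Fin X.k → Fin hX.inst.n)) Finset.univ_nonempty fun x =>
      (Finset.univ.biUnion fun j : Fin X.k => (hX.inst.S (x j)).toFinset).card
    rw [CoverInst.opt, hx] at h
    have hlt : ∀ t, (x t : ℕ) < X.sets := fun t => (x t).2
    have hinj : Function.Injective fun t => (⟨(x t : ℕ) / X.L, div_lt_k (hlt t)⟩ : Fin X.k) := by
      intro t t' htt
      by_contra hne
      have := hX.card_cover_lt_thr x hne (congrArg Fin.val htt)
      omega
    obtain ⟨f, hf⟩ := (Finite.injective_iff_surjective.1 hinj).hasRightInverse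
    have hf' : ∀ i, (x (f i) : ℕ) / X.L = i := fun i => congrArg Fin.val (hf i)
    set v : ℕ → ℕ := fun i => if hi : i < X.k then (x (f ⟨i, hi⟩) : ℕ) % X.L else 0 with hv
    have hvt : ∀ t, (x t : ℕ) % X.L = v ((x t : ℕ) / X.L) := by
      intro t
      simp only [hv]
      rw [dif_pos (div_lt_k (hlt t))]
      have : f ⟨(x t : ℕ) / X.L, div_lt_k (hlt t)⟩ = t := hinj (hf _)
      rw [this]
    have hcov := hX.two_mul_card_cover x v hvt fun i hi => ⟨f ⟨i, hi⟩, hf' ⟨i, hi⟩⟩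
    have h0 : ∑ y ∈ Finset.range X.D,
        (if ∀ p < X.H, X.bit y p (v (X.grp y p)) = 1 then 2 ^ X.H else 0) = 0 := by omega
    refine ⟨v, fun i hi => ?_, fun y hy => ?_⟩
    · simp only [hv]
      rw [dif_pos hi]
      exact hX.mod_lt_L _
    · by_contra hne
      push Not at hne
      have := Finset.sum_eq_zero_iff.1 h0 y (Finset.mem_range.2 hy)
      rw [if_pos fun p hp => by
        have h1 := hne p hp
        have h2 := hX.bit_le y p (v (X.grp y p))
        omega] at this
      exact absurd this (by positivity)
  · rintro ⟨v, hv, hsol⟩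
    have hlt : ∀ t : Fin X.k, (t : ℕ) * X.L + v t < X.sets := fun t => by
      have h1 : ((t : ℕ) + 1) * X.L ≤ X.k * X.L := Nat.mul_le_mul_right _ t.2
      have h2 := hv t t.2
      rw [Nat.succ_mul] at h1
      rw [sets]
      omega
    set x : Fin X.k → Fin hX.inst.n := fun t => ⟨(t : ℕ) * X.L + v t, hlt t⟩ with hxdef
    have hdiv : ∀ t, (x t : ℕ) / X.L = t := fun t => by
      simp only [hxdef]
      rw [mul_comm, Nat.mul_add_div hL, Nat.div_eq_of_lt (hv t t.2), add_zero]
    have hmod : ∀ t, (x t : ℕ) % X.L = v ((x t : ℕ) / X.L) := fun t => by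
      rw [hdiv]
      simp only [hxdef]
      rw [mul_comm, Nat.mul_add_mod, Nat.mod_eq_of_lt (hv t t.2)]
    have hcov := hX.two_mul_card_cover x v hmod fun i hi => ⟨⟨i, hi⟩, hdiv ⟨i, hi⟩⟩
    rw [Finset.sum_eq_zero fun y hy => if_neg fun h => by
      obtain ⟨p, hp, hz⟩ := hsol y (Finset.mem_range.1 hy)
      have := h p hp
      omega] at hcov
    have hle := Finset.le_sup (f := fun x : Fin X.k → Fin hX.inst.n =>
      (Finset.univ.biUnion fun j : Fin X.k => (hX.inst.S (x j)).toFinset).card) (Finset.mem_univ x)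
    rw [CoverInst.opt]
    omega

/-! ### Bounds on the parameters of the coverage instance -/

theorem Valid.length_inst_le (hX : X.Valid) (x : Fin hX.inst.n) :
    (hX.inst.S x).length ≤ X.cands := by
  rw [← List.length_map Fin.val, hX.map_val_inst, setList, List.length_map]
  simpa using List.length_filter_le (fun c => decide (X.test x c ≠ 0)) (List.range X.cands)

theorem Valid.card_group_block_le (hX : X.Valid) {F : ℕ}
    (hF : ∀ B, ((Finset.range X.L).filter fun j => X.blk j = B).card ≤ F) (i B : ℕ) :
    (Finset.univ.filter fun x : Fin hX.inst.n =>
      (x : ℕ) / X.L = i ∧ X.blk ((x : ℕ) % X.L) = B).card ≤ F := by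
  refine le_trans ?_ (hF B)
  refine Finset.card_le_card_of_injOn (fun x : Fin hX.inst.n => (x : ℕ) % X.L) ?_ ?_
  · intro x hx
    simp only [Finset.coe_filter, Finset.mem_univ, true_and, Set.mem_ofPred_eq] at hx
    simp only [Finset.coe_filter, Finset.mem_range, Set.mem_ofPred_eq]
    exact ⟨hX.mod_lt_L _, hx.2⟩
  · intro x hx x' hx' h
    simp only [Finset.coe_filter, Finset.mem_univ, true_and, Set.mem_ofPred_eq] at hx hx' h
    refine Fin.ext ?_
    rw [← Nat.div_add_mod (x : ℕ) X.L, ← Nat.div_add_mod (x' : ℕ) X.L, hx.1, hx'.1, h]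

/-- Each digit of a code names a block, so a main element lies only in sets of at most H blocks, one
for each position. A gadget element lies only in the two blocks of its pair, and 2 ≤ H. -/
theorem Valid.card_freq_le (hX : X.Valid) {F : ℕ}
    (hF : ∀ B, ((Finset.range X.L).filter fun j => X.blk j = B).card ≤ F) (e : Fin hX.inst.u) :
    (Finset.univ.filter fun x => e ∈ hX.inst.S x).card ≤ X.H * F := by
  by_cases hne : ∃ x, e ∈ hX.inst.S x
  swap
  · push Not at hne
    rw [Finset.filter_false_of_mem fun x _ => hne x]
    simp
  obtain ⟨x0, hx0⟩ := hne
  rw [hX.mem_inst, hX.mem_setList] at hx0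
  rcases hx0 with ⟨y, hy, c, hc, he, -⟩ | ⟨g, he, B0, hB0, w0, hw0, hg0⟩
  · have hsub : (Finset.univ.filter fun x => e ∈ hX.inst.S x) ⊆
        (Finset.range X.H).biUnion fun p => Finset.univ.filter fun x : Fin hX.inst.n =>
          (x : ℕ) / X.L = X.grp y p ∧
            X.blk ((x : ℕ) % X.L) = (c / X.a ^ p % X.a - 1) / 2 := by
      intro x hx
      simp only [Finset.mem_filter, Finset.mem_univ, true_and] at hx
      rw [hX.mem_inst, hX.mem_setList] at hx
      simp only [Finset.mem_biUnion, Finset.mem_range, Finset.mem_filter, Finset.mem_univ, true_and]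
      have hP : 0 < X.a ^ X.H := Nat.pow_pos a_pos
      rcases hx with ⟨y', hy', c', hc', he', hm⟩ | ⟨g, he', -⟩
      · rw [he, mul_comm, mul_comm y'] at he'
        have e1 := congrArg (· / X.a ^ X.H) he'
        have e2 := congrArg (· % X.a ^ X.H) he'
        simp only [Nat.mul_add_div hP, Nat.mul_add_mod] at e1 e2
        rw [Nat.div_eq_of_lt hc, Nat.div_eq_of_lt hc', add_zero, add_zero] at e1
        rw [Nat.mod_eq_of_lt hc, Nat.mod_eq_of_lt hc'] at e2
        rw [← e1, ← e2] at hm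
        obtain ⟨-, p, hp, hg, hl⟩ := hm
        exact ⟨p, hp, hg.symm, by rw [hl, hX.letter_div_two]⟩
      · have : (y + 1) * X.a ^ X.H ≤ X.D * X.a ^ X.H := Nat.mul_le_mul_right _ hy
        rw [Nat.succ_mul] at this
        omega
    refine (Finset.card_le_card hsub).trans (Finset.card_biUnion_le.trans ?_)
    refine (Finset.sum_le_sum fun p _ => hX.card_group_block_le hF _ _).trans ?_
    simp
  · set i0 := (x0 : ℕ) / X.L
    set b0 := X.blk ((x0 : ℕ) % X.L)
    have hsub : (Finset.univ.filter fun x => e ∈ hX.inst.S x) ⊆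
        (Finset.univ.filter fun x : Fin hX.inst.n =>
          (x : ℕ) / X.L = i0 ∧ X.blk ((x : ℕ) % X.L) = b0) ∪
        Finset.univ.filter fun x : Fin hX.inst.n =>
          (x : ℕ) / X.L = i0 ∧ X.blk ((x : ℕ) % X.L) = B0 := by
      intro x hx
      simp only [Finset.mem_filter, Finset.mem_univ, true_and] at hx
      rw [hX.mem_inst, hX.mem_setList] at hx
      simp only [Finset.mem_union, Finset.mem_filter, Finset.mem_univ, true_and]
      rcases hx with ⟨y', hy', c', hc', he', -⟩ | ⟨g', he', B, hB, w, hw, hg⟩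
      · have : (y' + 1) * X.a ^ X.H ≤ X.D * X.a ^ X.H := Nat.mul_le_mul_right _ hy'
        rw [Nat.succ_mul] at this
        omega
      · rw [he] at he'
        have h := Nat.add_left_cancel he'
        rw [hg0, hg, mul_comm, mul_comm (X.pairCode _ _ B)] at h
        have h1 := congrArg (· / X.W) h
        simp only [Nat.mul_add_div W_pos] at h1
        rw [Nat.div_eq_of_lt hw, Nat.div_eq_of_lt hw0, add_zero, add_zero] at h1
        obtain ⟨h2, h3, h4⟩ := pairCode_inj (hX.blk_lt _ (hX.mod_lt_L x0))
          (hX.blk_lt _ (hX.mod_lt_L x)) hB0 hB h1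
        rw [← h2]
        simp only [true_and, i0]
        change min b0 B0 = _ at h3
        change max b0 B0 = _ at h4
        omega
    refine (Finset.card_le_card hsub).trans ((Finset.card_union_le _ _).trans ?_)
    have h1 := hX.card_group_block_le hF i0 b0
    have h2 := hX.card_group_block_le hF i0 B0
    have h3 := Nat.mul_le_mul_right F hX.two_le
    omega

theorem Valid.bounded (hX : X.Valid) {F : ℕ}
    (hF : ∀ B, ((Finset.range X.L).filter fun j => X.blk j = B).card ≤ F) :
    hX.inst.Bounded X.sets X.univ X.cands (X.H * F) :=
  ⟨le_rfl, le_rfl, hX.length_inst_le, hX.card_freq_le hF⟩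

end SparseOV

/-! ### Sparse orthogonality problems computed by expressions. -/

theorem IsExpr.pow_of_lt {f g : RamEnv → ℕ} (hf : IsExpr f) (hg : IsExpr g) (n : ℕ)
    (hlt : ∀ v, g v < n) : IsExpr fun v => f v ^ g v := by
  -- Powers are not among the operations of expressions. The exponent is below a constant, so the
  -- value is selected among finitely many fixed powers.
  have := IsExpr.select (F := fun i v => f v ^ i) (fun i => hf.pow i) hg n
  simpa only [hlt, if_true] using this

theorem CoverInst.Bounded.mono {I : CoverInst} {n u s f n' u' s' f' : ℕ} (h : I.Bounded n u s f)
    (hn : n ≤ n') (hu : u ≤ u') (hs : s ≤ s') (hf : f ≤ f') : I.Bounded n' u' s' f' :=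
  ⟨h.1.trans hn, h.2.1.trans hu, fun i => (h.2.2.1 i).trans hs, fun y => (h.2.2.2 y).trans hf⟩

namespace SparseOV

/-- The data of the family `X` are computed by expressions. -/
structure Computable (X : RamEnv → SparseOV) (k H : ℕ) : Prop where
  k_eq : ∀ v, (X v).k = k
  H_eq : ∀ v, (X v).H = H
  L : IsExpr fun v => (X v).L
  q : IsExpr fun v => (X v).q
  D : IsExpr fun v => (X v).D
  blk : ∀ {f}, IsExpr f → IsExpr fun v => (X v).blk (f v)
  grp : ∀ {f g}, IsExpr f → IsExpr g → IsExpr fun v => (X v).grp (f v) (g v)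
  bit : ∀ {f g h}, IsExpr f → IsExpr g → IsExpr h → IsExpr fun v => (X v).bit (f v) (g v) (h v)

namespace Computable

variable {X : RamEnv → SparseOV} {k H : ℕ}

theorem a (h : Computable X k H) : IsExpr fun v => (X v).a :=
  ((IsExpr.const 2).mul h.q).add (.const 1)

theorem W (h : Computable X k H) : IsExpr fun v => (X v).W := by
  simp only [SparseOV.W, h.H_eq]
  exact ((h.D.mul (.const _)).mul (h.a.pow _)).add (.const 1)

theorem mainCands (h : Computable X k H) : IsExpr fun v => (X v).mainCands := by
  simp only [SparseOV.mainCands, h.H_eq]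
  exact h.D.mul ((IsExpr.const H).mul (h.a.pow _))

theorem cands (h : Computable X k H) : IsExpr fun v => (X v).cands :=
  h.mainCands.add (h.q.mul h.W)

theorem sets (h : Computable X k H) : IsExpr fun v => (X v).sets := by
  simp only [SparseOV.sets, h.k_eq]
  exact (IsExpr.const k).mul h.L

theorem univ (h : Computable X k H) : IsExpr fun v => (X v).univ := by
  simp only [SparseOV.univ, h.H_eq, h.k_eq]
  exact (h.D.mul (h.a.pow H)).add ((((IsExpr.const k).mul h.q).mul h.q).mul h.W)

theorem thr (h : Computable X k H) : IsExpr fun v => (X v).thr := by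
  simp only [SparseOV.thr, h.H_eq, h.k_eq]
  exact ((IsExpr.const k).mul (h.q.mul h.W)).add (h.D.mul
    ((((h.a.pow H).add (.const 1)).sub (((IsExpr.const 2).mul h.q).pow H)).div (.const 2)))

theorem mainCode (h : Computable X k H) (hH : 0 < H) {x c : RamEnv → ℕ} (hx : IsExpr x)
    (hc : IsExpr c) : IsExpr fun v => (X v).mainCode (x v) (c v) := by
  have hY : IsExpr fun v => (X v).candY (c v) := by
    simp only [SparseOV.candY, h.H_eq]
    exact hc.div ((IsExpr.const H).mul (h.a.pow _))
  have hP : IsExpr fun v => (X v).candP (c v) := by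
    simp only [SparseOV.candP, h.H_eq]
    exact (hc.div (h.a.pow _)).mod (.const H)
  have hlt : ∀ v, (X v).candP (c v) < H := fun v => by
    simp only [SparseOV.candP, h.H_eq]
    exact Nat.mod_lt _ hH
  have hj := hx.mod h.L
  have hl : IsExpr fun v => (X v).letter ((X v).candY (c v)) ((X v).candP (c v)) (x v % (X v).L) :=
    (((IsExpr.const 2).mul (h.blk hj)).add (.const 2)).sub (h.bit hY hP hj)
  have hpow := h.a.pow_of_lt hP H hlt
  simp only [SparseOV.mainCode, insertDigit]
  have hm : IsExpr fun v => c v % (X v).a ^ ((X v).H - 1) := by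
    simp only [h.H_eq]
    exact hc.mod (h.a.pow _)
  exact (hm.mod hpow).add (hpow.mul (hl.add (h.a.mul (hm.div hpow))))

theorem test (h : Computable X k H) (hH : 0 < H) {x c : RamEnv → ℕ} (hx : IsExpr x)
    (hc : IsExpr c) : IsExpr fun v => (X v).test (x v) (c v) := by
  have hY : IsExpr fun v => (X v).candY (c v) := by
    simp only [SparseOV.candY, h.H_eq]
    exact hc.div ((IsExpr.const H).mul (h.a.pow _))
  have hP : IsExpr fun v => (X v).candP (c v) := by
    simp only [SparseOV.candP, h.H_eq]
    exact (hc.div (h.a.pow _)).mod (.const H)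
  exact (IsExprCond.lt hc h.mainCands).ite (((IsExprCond.eq (h.grp hY hP) (hx.div h.L)).and
    (.eq ((h.mainCode hH hx hc).mod (.const 2)) (.const 0))).ite (.const 1) (.const 0)) (.const 1)

theorem elem (h : Computable X k H) (hH : 0 < H) {x c : RamEnv → ℕ} (hx : IsExpr x)
    (hc : IsExpr c) : IsExpr fun v => (X v).elem (x v) (c v) := by
  have hY : IsExpr fun v => (X v).candY (c v) := by
    simp only [SparseOV.candY, h.H_eq]
    exact hc.div ((IsExpr.const H).mul (h.a.pow _))
  have hA : IsExpr fun v => (X v).a ^ (X v).H := by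
    simp only [h.H_eq]
    exact h.a.pow H
  have hr := hc.sub h.mainCands
  have hb := h.blk (hx.mod h.L)
  have hB := hr.div h.W
  have hpair : IsExpr fun v => (X v).pairCode (x v / (X v).L) ((X v).blk (x v % (X v).L))
      ((c v - (X v).mainCands) / (X v).W) :=
    ((((hx.div h.L).mul h.q).add (hb.sub (hb.sub hB))).mul h.q).add (hB.add (hb.sub hB))
  exact (IsExprCond.lt hc h.mainCands).ite ((hY.mul hA).add (h.mainCode hH hx hc))
    ((h.D.mul hA).add ((hpair.mul h.W).add (hr.mod h.W)))

end Computable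

open Classical in
/-- A solver for maximum coverage gives a solver for every problem that is presented as a computable
family of sparse orthogonality problems. -/
theorem Computable.solvableInTime {X : RamEnv → SparseOV} {k H : ℕ} (hXc : Computable X k H)
    {a b c e : ℕ} {T : ℕ → ℕ → ℕ → ℕ → ℝ}
    (hsolve : MaxCoverSolvable k a b c e T) (hT0 : ∀ n u s f, 0 ≤ T n u s f)
    (Q : RamProblem) {ι : Type} (x : ι → Q.Inst) (T' : ι → ℝ)
    (n d : ι → ℕ) (arr : ι → ℕ → ℕ) (Y : ι → SparseOV) (m F : ι → ℕ)
    (hin : ∀ i, Q.input (x i) = ⟨twoRegs (n i) (d i), fun A t => if A = 0 then arr i t else 0⟩)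
    (hsize : ∀ i, n i + d i ≤ Q.size (x i)) (harr : ∀ i t, arr i t ≤ 1)
    (hY : ∀ i s t, X ⟨![n i, d i, s, t], arr i⟩ = Y i) (hv : ∀ i, (Y i).Valid)
    (hans : ∀ i, Q.answer (x i) = if ∃ v, (Y i).Solution v then 1 else 0)
    (hm : ∀ i, 1 ≤ m i)
    (hF : ∀ i B, ((Finset.range (Y i).L).filter fun j => (Y i).blk j = B).card ≤ F i)
    (ha : ∀ i, (Y i).sets ≤ m i ^ a) (hb : ∀ i, (Y i).univ ≤ m i ^ b)
    (hc : ∀ i, (Y i).cands ≤ m i ^ c) (he : ∀ i, H * F i ≤ m i ^ e)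
    (C : ℝ) (hT : ∀ i, T (m i ^ a) (m i ^ b) (m i ^ c) (m i ^ e) ≤ C * T' i)
    (hT' : ∀ i, ((((Y i).sets + 1) * ((Y i).cands + 1) : ℕ) : ℝ) ≤ C * T' i) :
    Q.SolvableInTime x T' := by
  -- Some instance is needed to read off 0 < H from validity; without instances there is nothing to
  -- solve.
  by_cases hι : Nonempty ι
  swap
  · exact ⟨.skip, 0, 0, fun i => (hι ⟨i⟩).elim⟩
  obtain ⟨i0⟩ := hι
  have hk : ∀ i, (Y i).k = k := fun i => by rw [← hY i 0 0, hXc.k_eq]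
  have hH : ∀ i, (Y i).H = H := fun i => by rw [← hY i 0 0, hXc.H_eq]
  have hHpos : 0 < H := by
    have := (hv i0).two_le
    rw [hH] at this
    omega
  refine hsolve.of_coverExprs (fun q => hT0 _ _ _ _) Q x T'
    (fun i => ⟨(m i, (hv i).inst), hm i, ((hv i).bounded (hF i)).mono (ha i) (hb i) (hc i)
      (by rw [hH]; exact he i)⟩)
    hXc.sets hXc.univ hXc.cands (hXc.test hHpos (.var 2) (.var 3))
    (hXc.elem hHpos (.var 2) (.var 3)) hXc.thr n d arr (fun i => (Y i).cands)
    (fun i => (Y i).thr) hin hsize harr ?_ ?_ ?_ ?_ ?_ ?_ C hT hT'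
  · intro i
    simp only [hY]
    rfl
  · intro i
    simp only [hY]
    rfl
  · intro i s
    simp only [hY]
  · intro i s
    simp only [hY]
  · intro i z
    simp only [hY]
    exact (hv i).map_val_inst z
  · intro i
    rw [hans i]
    have := (hv i).thr_le_opt_iff
    rw [hk] at this
    simp only [this]

end SparseOV

/-! ### Hypercliques as sparse orthogonality problems -/

theorem finFunctionFinEquiv_symm_val {m n : ℕ} (c : Fin (m ^ n)) (i : Fin n) :
    ((finFunctionFinEquiv.symm c i : Fin m) : ℕ) = (c : ℕ) / m ^ (i : ℕ) % m := rfl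

theorem digit_finFunctionFinEquiv {m n : ℕ} (f : Fin n → Fin m) (i : Fin n) :
    (finFunctionFinEquiv f : ℕ) / m ^ (i : ℕ) % m = f i := by
  rw [← finFunctionFinEquiv_symm_val, Equiv.symm_apply_apply]

theorem digit_add_pow_mul {m n c x p : ℕ} (hm : 0 < m) (hp : p < n) :
    (c + m ^ n * x) / m ^ p % m = c / m ^ p % m := by
  obtain ⟨r, rfl⟩ : ∃ r, n = p + 1 + r := ⟨n - (p + 1), by omega⟩
  rw [show c + m ^ (p + 1 + r) * x = c + m ^ p * (m * (m ^ r * x)) by ring,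
    Nat.add_mul_div_left _ _ (Nat.pow_pos hm), Nat.add_mul_mod_self_left]

namespace HyperOV

variable (k h r G y t : ℕ)

/-- The number of groups that a constraint concerns. -/
abbrev pos : ℕ := min h k

/-- The choice of groups of the constraint `y`. -/
def zDigit (p : ℕ) : ℕ := y / k ^ p % k

/-- The choice of parts of the constraint `y`. -/
def partDigit : ℕ := y / k ^ pos k h / (pos k h * r) ^ t % (pos k h * r)

/-- The choice of vertices of the constraint `y`. -/
def vertexDigit : ℕ := y / k ^ pos k h / (pos k h * r) ^ h / G ^ t % G

def GroupsDistinct : Prop :=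
  ∀ p < pos k h, ∀ p' < pos k h, zDigit k y p = zDigit k y p' → p = p'

def PartsDistinct : Prop :=
  ∀ t < h, ∀ t' < h, partDigit k h r y t = partDigit k h r y t' → t = t'

instance : Decidable (GroupsDistinct k h y) := by unfold GroupsDistinct; infer_instance

instance : Decidable (PartsDistinct k h r y) := by unfold PartsDistinct; infer_instance

/-- The position in the adjacency tensor of the vertices of the constraint `y`. -/
def tensorIndex : ℕ := ∑ t ∈ Finset.range h, vertexDigit k h r G y t * G ^ t

/-- All codes are used as constraints so that they can be enumerated by arithmetic. Codes with
repeated groups or parts, and those that describe an edge, are padding that no choice violates. -/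
def Active (arr : ℕ → ℕ) : Prop :=
  GroupsDistinct k h y ∧ PartsDistinct k h r y ∧ arr (tensorIndex k h r G y) = 0

/-- The part p * r + e stands for entry e of the tuple chosen in the p-th group of the constraint,
and the entries of the tuple j are its digits in base G. No condition arises at a position that
contains none of the h parts. -/
def Matches (p j : ℕ) : Prop :=
  ∀ t < h, partDigit k h r y t / r = p →
    j / G ^ (partDigit k h r y t % r) % G = vertexDigit k h r G y t

instance (arr : ℕ → ℕ) : Decidable (Active k h r G y arr) := by unfold Active; infer_instance

instance (p j : ℕ) : Decidable (Matches k h r G y p j) := by unfold Matches; infer_instance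

/-- Padding constraints must also concern `pos k h` distinct groups. A cyclic interval starting at
the first digit achieves this and, like the digits themselves, moves along when all digits are
shifted modulo k; the balance of the groups rests on this symmetry. -/
def group (p : ℕ) : ℕ :=
  if GroupsDistinct k h y then (if p < pos k h then zDigit k y p else 0)
  else (zDigit k y 0 + p) % k

end HyperOV

open HyperOV in
/-- The vectors are the `r`-tuples of vertices; the constraints are the non-edges, distributed over
`h` of the `k * r` parts. -/
def hyperOV (k h r s G : ℕ) (arr : ℕ → ℕ) : SparseOV where
  k := k
  H := pos k h
  L := G ^ r
  q := G ^ s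
  D := G ^ h * (pos k h * r) ^ h * k ^ pos k h
  blk j := j / G ^ (r - s)
  grp y p := group k h y p
  bit y p j := if Active k h r G y arr ∧ Matches k h r G y p j then 1 else 0

namespace HyperOV

variable {k h r s G : ℕ} {arr : ℕ → ℕ}

theorem zDigit_lt (hk : 0 < k) (y p : ℕ) : zDigit k y p < k := Nat.mod_lt _ hk

theorem group_lt (hk : 0 < k) (y p : ℕ) : group k h y p < k := by
  unfold group
  split_ifs
  · exact zDigit_lt hk _ _
  · exact hk
  · exact Nat.mod_lt _ hk

theorem group_inj (y : ℕ) {p p' : ℕ} (hp : p < pos k h) (hp' : p' < pos k h)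
    (he : group k h y p = group k h y p') : p = p' := by
  unfold group at he
  split_ifs at he with hd
  · exact hd p hp p' hp' he
  · have h1 : pos k h ≤ k := min_le_right _ _
    have h2 : p ≡ p' [MOD k] := Nat.ModEq.add_left_cancel' _ he
    exact Nat.ModEq.eq_of_lt_of_lt h2 (by omega) (by omega)

/-- The groups of a constraint, as a function of the digits. -/
theorem card_group_eq (hk : 0 < k) (hH : 0 < pos k h) (i : ℕ) (hi : i < k) :
    ((Finset.range (k ^ pos k h)).filter fun c => ∃ p < pos k h, group k h c p = i).card =
      ((Finset.range (k ^ pos k h)).filter fun c => ∃ p < pos k h, group k h c p = 0).card := by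
  have : NeZero k := ⟨hk.ne'⟩
  set H := pos k h with hHdef
  let γ : (Fin H → Fin k) → Fin H → Fin k := fun f p =>
    if Function.Injective f then f p else f ⟨0, hH⟩ + Fin.ofNat k p
  -- Adding i to all digits modulo k preserves injectivity and shifts every group by i. This
  -- translation maps the codes that concern group 0 bijectively to those that concern group i.
  have hγ : ∀ (f : Fin H → Fin k) (i : Fin k) (p : Fin H),
      γ (f + fun _ => i) p = γ f p + i := by
    intro f i p
    have hinj : Function.Injective (f + fun _ => i) ↔ Function.Injective f := by
      constructor
      · exact fun h p q hpq => h (by simp [hpq])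
      · exact fun h p q hpq => h (by simpa using hpq)
    simp only [γ, hinj]
    split_ifs
    · rfl
    · simp only [Pi.add_apply]
      rw [add_right_comm]
  have hval : ∀ (c : Fin (k ^ H)) (p : Fin H),
      ((γ (finFunctionFinEquiv.symm c) p : Fin k) : ℕ) = group k h c p := by
    intro c p
    have hinj : Function.Injective (finFunctionFinEquiv.symm c : Fin H → Fin k) ↔
        GroupsDistinct k h c := by
      constructor
      · intro hf p hp p' hp' he
        exact congrArg Fin.val (@hf ⟨p, hp⟩ ⟨p', hp'⟩ (Fin.ext he))
      · intro hd p p' he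
        exact Fin.ext (hd p p.2 p' p'.2 (congrArg Fin.val he))
    simp only [γ, hinj, group]
    split_ifs with h1 h2
    · rfl
    · exact absurd p.2 h2
    · rw [Fin.val_add]
      simp only [finFunctionFinEquiv_symm_val, Fin.val_ofNat, Nat.add_mod_mod]
      rfl
  have hcount : ∀ i : Fin k,
      ((Finset.range (k ^ H)).filter fun c => ∃ p < H, group k h c p = i).card =
      (Finset.univ.filter fun f : Fin H → Fin k => ∃ p, γ f p = i).card := by
    intro i
    refine (Finset.card_bij (fun f _ => (finFunctionFinEquiv f : ℕ)) ?_ ?_ ?_).symm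
    · intro f hf
      simp only [Finset.mem_filter, Finset.mem_univ, true_and] at hf
      obtain ⟨p, hp⟩ := hf
      simp only [Finset.mem_filter, Finset.mem_range]
      refine ⟨(finFunctionFinEquiv f).2, p, p.2, ?_⟩
      rw [← hval, Equiv.symm_apply_apply, hp]
    · intro f _ g _ hfg
      exact finFunctionFinEquiv.injective (Fin.ext hfg)
    · intro c hc
      simp only [Finset.mem_filter, Finset.mem_range] at hc
      obtain ⟨hc, p, hp, he⟩ := hc
      refine ⟨finFunctionFinEquiv.symm ⟨c, hc⟩, ?_, by simp⟩
      simp only [Finset.mem_filter, Finset.mem_univ, true_and]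
      exact ⟨⟨p, hp⟩, Fin.ext ((hval ⟨c, hc⟩ ⟨p, hp⟩).trans he)⟩
  have h0 : (⟨0, hk⟩ : Fin k) = 0 := Fin.ext (by simp)
  refine (hcount ⟨i, hi⟩).trans (Eq.trans ?_ (hcount ⟨0, hk⟩).symm)
  rw [h0]
  refine (Finset.card_equiv (Equiv.addRight fun _ => (⟨i, hi⟩ : Fin k)) ?_).symm
  intro f
  simp only [Finset.mem_filter, Finset.mem_univ, true_and, Equiv.coe_addRight, hγ]
  refine exists_congr fun p => ?_
  constructor
  · intro h; rw [h, zero_add]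
  · intro h; exact add_eq_right.1 h

theorem group_mul_add (hk : 0 < k) (hH : 0 < pos k h) (y c : ℕ) {p : ℕ} (hp : p < pos k h) :
    group k h (y * k ^ pos k h + c) p = group k h c p := by
  have hz : ∀ p < pos k h, zDigit k (y * k ^ pos k h + c) p = zDigit k c p := fun p hp => by
    rw [zDigit, add_comm, mul_comm, digit_add_pow_mul hk hp]
    rfl
  have hd : GroupsDistinct k h (y * k ^ pos k h + c) ↔ GroupsDistinct k h c := by
    unfold GroupsDistinct
    refine forall₂_congr fun p hp => forall₂_congr fun p' hp' => ?_
    rw [hz p hp, hz p' hp']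
  simp only [group, hd, hz p hp, hz 0 hH]

theorem valid (hk : 2 ≤ k) (hh : 2 ≤ h) (hs : s ≤ r) (hG : 0 < G) :
    (hyperOV k h r s G arr).Valid where
  two_le := le_min hh hk
  k_pos := by change 0 < k; omega
  L_pos := Nat.pow_pos hG
  q_pos := Nat.pow_pos hG
  blk_lt j hj := by
    change j < G ^ r at hj
    change j / G ^ (r - s) < G ^ s
    rwa [Nat.div_lt_iff_lt_mul (Nat.pow_pos hG), ← pow_add, Nat.add_sub_cancel' hs]
  grp_lt y _ p _ := group_lt (by omega) y p
  grp_inj y _ p hp p' hp' := group_inj y hp hp'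
  bit_le y p j := by
    simp only [hyperOV]
    split_ifs <;> omega
  -- The groups of a constraint depend only on its lowest digits in base k, so the count over all
  -- constraints is a fixed multiple of the count over these digits.
  balanced i hi := by
    have hk0 : 0 < k := by omega
    have hH : 0 < pos k h := by have : 2 ≤ pos k h := le_min hh hk; omega
    have hcard : ∀ i, ((Finset.range (G ^ h * (pos k h * r) ^ h * k ^ pos k h)).filter fun y =>
        ∃ p < pos k h, group k h y p = i).card = G ^ h * (pos k h * r) ^ h *
        ((Finset.range (k ^ pos k h)).filter fun c => ∃ p < pos k h, group k h c p = i).card := by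
      intro i
      rw [Finset.card_filter, Finset.sum_range_mul_eq]
      have : ∀ y c, (∃ p < pos k h, group k h (y * k ^ pos k h + c) p = i) ↔
          ∃ p < pos k h, group k h c p = i := fun y c =>
        exists_congr fun p => and_congr_right fun hp => by rw [group_mul_add hk0 hH y c hp]
      simp only [this]
      rw [Finset.sum_const, Finset.card_range, smul_eq_mul, Finset.card_filter]
    change ((Finset.range (G ^ h * (pos k h * r) ^ h * k ^ pos k h)).filter fun y =>
        ∃ p < pos k h, group k h y p = i).card = ((Finset.range
        (G ^ h * (pos k h * r) ^ h * k ^ pos k h)).filter fun y =>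
        ∃ p < pos k h, group k h y p = 0).card
    rw [hcard, hcard, card_group_eq hk0 hH i hi]

theorem card_blk_le (hG : 0 < G) (B : ℕ) :
    ((Finset.range (hyperOV k h r s G arr).L).filter fun j =>
      (hyperOV k h r s G arr).blk j = B).card ≤ G ^ (r - s) := by
  change ((Finset.range (G ^ r)).filter fun j => j / G ^ (r - s) = B).card ≤ _
  have hP : 0 < G ^ (r - s) := Nat.pow_pos hG
  calc _ ≤ (Finset.range (G ^ (r - s))).card := by
        refine Finset.card_le_card_of_injOn (fun j => j % G ^ (r - s)) ?_ ?_
        · intro j _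
          simp only [Finset.coe_range, Set.mem_Iio]
          exact Nat.mod_lt _ hP
        · intro j hj j' hj' he
          simp only [Finset.coe_filter, Set.mem_ofPred_eq] at hj hj' he
          rw [← Nat.div_add_mod j (G ^ (r - s)), ← Nat.div_add_mod j' (G ^ (r - s)), hj.2, hj'.2, he]
    _ = _ := Finset.card_range _

theorem exists_code (hk : 0 < k) (hr : 0 < pos k h * r)
    (z : Fin (pos k h) → Fin k) (π : Fin h → Fin (pos k h * r)) (w : Fin h → Fin G) :
    ∃ y < G ^ h * (pos k h * r) ^ h * k ^ pos k h, (∀ p : Fin (pos k h), zDigit k y p = z p) ∧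
      (∀ t : Fin h, partDigit k h r y t = π t) ∧ ∀ t : Fin h, vertexDigit k h r G y t = w t := by
  set a := finFunctionFinEquiv z
  set b := finFunctionFinEquiv π
  set c := finFunctionFinEquiv w
  have e1 : ((a : ℕ) + k ^ pos k h * (b + (pos k h * r) ^ h * c)) / k ^ pos k h =
      b + (pos k h * r) ^ h * c := by
    rw [Nat.add_mul_div_left _ _ (Nat.pow_pos hk), Nat.div_eq_of_lt a.2, zero_add]
  have e2 : ((b : ℕ) + (pos k h * r) ^ h * c) / (pos k h * r) ^ h = c := by
    rw [Nat.add_mul_div_left _ _ (Nat.pow_pos hr), Nat.div_eq_of_lt b.2, zero_add]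
  refine ⟨a + k ^ pos k h * (b + (pos k h * r) ^ h * c), ?_, fun p => ?_, fun t => ?_, fun t => ?_⟩
  · rw [← Nat.div_lt_iff_lt_mul (Nat.pow_pos hk), e1, ← Nat.div_lt_iff_lt_mul (Nat.pow_pos hr), e2]
    exact c.2
  · rw [zDigit, digit_add_pow_mul hk p.2, digit_finFunctionFinEquiv]
  · rw [partDigit, e1, digit_add_pow_mul hr t.2, digit_finFunctionFinEquiv]
  · rw [vertexDigit, e1, e2, digit_finFunctionFinEquiv]

open Classical in
/-- The adjacency tensor. -/
noncomputable def _root_.HypergraphInst.tensor {h : ℕ} (I : HypergraphInst h) (t : ℕ) : ℕ :=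
  if ∃ x : Fin h → Fin I.n, t = ∑ j : Fin h, (x j : ℕ) * I.n ^ (j : ℕ) ∧
    Finset.univ.image x ∈ I.E then 1 else 0

theorem _root_.HypergraphInst.tensor_eq_zero_iff {h : ℕ} (I : HypergraphInst h)
    (w : Fin h → Fin I.n) : I.tensor (∑ j : Fin h, (w j : ℕ) * I.n ^ (j : ℕ)) = 0 ↔
      Finset.univ.image w ∉ I.E := by
  classical
  rw [HypergraphInst.tensor]
  constructor
  · intro h0 hw
    rw [if_pos ⟨w, rfl, by convert hw⟩] at h0
    exact one_ne_zero h0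
  · intro hw
    rw [if_neg]
    rintro ⟨x, hx, hE⟩
    rw [← finFunctionFinEquiv_apply, ← finFunctionFinEquiv_apply] at hx
    obtain rfl := finFunctionFinEquiv.injective (Fin.ext hx)
    exact hw (by convert hE)

/-- The vertex of a part. -/
def vertexOf {n : ℕ} (hn : 0 < n) (v : ℕ → ℕ) (u : Fin k × Fin r) : Fin n :=
  ⟨v u.1 / n ^ (u.2 : ℕ) % n, Nat.mod_lt _ hn⟩

/-- The h values of f are at most min h k groups; they are enlarged to exactly that many so that
each constraint concerns the same number of groups. -/
theorem exists_injective_covering {ι : Type*} [Fintype ι] (f : ι → Fin k)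
    (hf : Fintype.card ι = h) :
    ∃ z : Fin (pos k h) → Fin k, Function.Injective z ∧ ∀ t, ∃ p, z p = f t := by
  have h1 : (Finset.univ.image f).card ≤ pos k h := le_min
    (Finset.card_image_le.trans (by rw [Finset.card_univ, hf]))
    ((Finset.card_le_univ _).trans (by simp))
  obtain ⟨A, hA, hcard⟩ := Finset.exists_superset_card_eq h1 (by simp)
  refine ⟨fun p => ((A.equivFinOfCardEq hcard).symm p : Fin k), fun p p' he => ?_, fun t => ?_⟩
  · exact (A.equivFinOfCardEq hcard).symm.injective (Subtype.ext he)
  · have ht : f t ∈ A := hA (Finset.mem_image_of_mem f (Finset.mem_univ t))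
    exact ⟨A.equivFinOfCardEq hcard ⟨f t, ht⟩, by simp⟩

/-- If h distinct parts carried a non-edge, the code made of a covering choice of groups, of these
parts and of their vertices would be an active constraint that all chosen tuples match. -/
theorem image_mem_of_solution (hk : 2 ≤ k) (hh : 2 ≤ h) (hr : 0 < r) (I : HypergraphInst h)
    {v : ℕ → ℕ} (hv : (hyperOV k h r s I.n I.tensor).Solution v) (u : Fin h → Fin k × Fin r)
    (hu : Function.Injective u) :
    Finset.univ.image (fun t => vertexOf I.pos v (u t)) ∈ I.E := by
  by_contra hE
  have hH : 0 < pos k h := by have : 2 ≤ pos k h := le_min hh hk; omega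
  have hHr : 0 < pos k h * r := Nat.mul_pos hH hr
  obtain ⟨z, hz, hcov⟩ := exists_injective_covering (h := h) (fun t => (u t).1) (by simp)
  choose P hP using hcov
  have hlt : ∀ t, (P t : ℕ) * r + (u t).2 < pos k h * r := fun t => by
    have h1 : ((P t : ℕ) + 1) * r ≤ pos k h * r := Nat.mul_le_mul_right _ (P t).2
    have h2 := (u t).2.2
    rw [Nat.succ_mul] at h1
    omega
  obtain ⟨y, hy, hyz, hyp, hyw⟩ := exists_code (k := k) (h := h) (r := r) (G := I.n) (by omega) hHr z
    (fun t => ⟨(P t : ℕ) * r + (u t).2, hlt t⟩) fun t => vertexOf I.pos v (u t)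
  have hdiv : ∀ t : Fin h, partDigit k h r y t / r = P t := fun t => by
    rw [hyp]
    simp only
    rw [mul_comm, Nat.mul_add_div hr, Nat.div_eq_of_lt (u t).2.2, add_zero]
  have hmod : ∀ t : Fin h, partDigit k h r y t % r = (u t).2 := fun t => by
    rw [hyp]
    simp only
    rw [mul_comm, Nat.mul_add_mod, Nat.mod_eq_of_lt (u t).2.2]
  have hgd : GroupsDistinct k h y := fun p hp p' hp' he => by
    rw [hyz ⟨p, hp⟩, hyz ⟨p', hp'⟩] at he
    exact congrArg Fin.val (hz (Fin.ext he))
  have hpd : PartsDistinct k h r y := fun t ht t' ht' he => by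
    have e1 := congrArg (· / r) he
    have e2 := congrArg (· % r) he
    rw [hdiv ⟨t, ht⟩, hdiv ⟨t', ht'⟩] at e1
    rw [hmod ⟨t, ht⟩, hmod ⟨t', ht'⟩] at e2
    have : u ⟨t, ht⟩ = u ⟨t', ht'⟩ := by
      refine Prod.ext ?_ (Fin.ext e2)
      rw [← hP, ← hP, Fin.ext e1]
    exact congrArg Fin.val (hu this)
  have hact : Active k h r I.n y I.tensor := by
    refine ⟨hgd, hpd, ?_⟩
    rw [tensorIndex, Finset.sum_range]
    simp only [hyw]
    exact (I.tensor_eq_zero_iff _).2 hE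
  obtain ⟨p, hp, hbit⟩ := hv.2 y hy
  change p < pos k h at hp
  simp only [hyperOV] at hbit
  rw [if_pos] at hbit
  · exact one_ne_zero hbit
  refine ⟨hact, fun t ht he => ?_⟩
  have e1 := hdiv ⟨t, ht⟩
  have e2 := hmod ⟨t, ht⟩
  have e3 := hyw ⟨t, ht⟩
  simp only at e1 e2 e3
  rw [e2, e3, group, if_pos hgd, if_pos hp]
  have e4 : zDigit k y p = (u ⟨t, ht⟩).1 := by
    rw [hyz ⟨p, hp⟩, ← hP ⟨t, ht⟩]
    congr 2
    exact Fin.ext (he.symm.trans e1)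
  rw [e4]
  rfl

theorem exists_injective_image {α : Type*} [DecidableEq α] (A : Finset α) (hA : A.card = h) :
    ∃ u : Fin h → α, Function.Injective u ∧ Finset.univ.image u = A := by
  refine ⟨fun t => ((A.equivFinOfCardEq hA).symm t : α), fun t t' he =>
    (A.equivFinOfCardEq hA).symm.injective (Subtype.ext he), ?_⟩
  ext x
  simp only [Finset.mem_image, Finset.mem_univ, true_and]
  constructor
  · rintro ⟨t, rfl⟩
    exact ((A.equivFinOfCardEq hA).symm t).2
  · intro hx
    exact ⟨A.equivFinOfCardEq hA ⟨x, hx⟩, by simp⟩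

theorem exists_solution_iff (hk : 2 ≤ k) (hh : 2 ≤ h) (hr : 0 < r) (hkr : h ≤ k * r)
    (I : HypergraphInst h) :
    (∃ v, (hyperOV k h r s I.n I.tensor).Solution v) ↔
      ∃ K : Finset (Fin I.n), K.card = k * r ∧ ∀ e ⊆ K, e.card = h → e ∈ I.E := by
  constructor
  · rintro ⟨v, hv⟩
    have key := image_mem_of_solution hk hh hr I hv
    -- Two parts with the same vertex extend to h parts, as 2 ≤ h ≤ k * r. Their vertices would form
    -- an edge with fewer than h elements, against uniformity.
    have hinj : Function.Injective (vertexOf (k := k) (r := r) I.pos v) := by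
      intro a b hab
      by_contra hne
      have h1 : ({a, b} : Finset (Fin k × Fin r)).card ≤ h := by
        rw [Finset.card_pair hne]; exact hh
      obtain ⟨A, hA, hcard⟩ := Finset.exists_superset_card_eq h1
        (by simpa using hkr)
      obtain ⟨u, hu, himg⟩ := exists_injective_image A hcard
      have h2 := I.uniform _ (key u hu)
      have h3 : Function.Injective fun t => vertexOf I.pos v (u t) := by
        rw [← Set.injOn_univ, ← Finset.coe_univ]
        refine Finset.card_image_iff.1 ?_
        rw [h2]; simp
      have ha : a ∈ Finset.univ.image u := by rw [himg]; exact hA (by simp)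
      have hb : b ∈ Finset.univ.image u := by rw [himg]; exact hA (by simp)
      obtain ⟨ta, -, rfl⟩ := Finset.mem_image.1 ha
      obtain ⟨tb, -, rfl⟩ := Finset.mem_image.1 hb
      exact hne (congrArg u (h3 hab))
    refine ⟨Finset.univ.image (vertexOf (k := k) (r := r) I.pos v), ?_, fun e he hcard => ?_⟩
    · rw [Finset.card_image_of_injective _ hinj]
      simp
    · obtain ⟨A, -, rfl⟩ := Finset.subset_image_iff.1 he
      rw [Finset.card_image_of_injective _ hinj] at hcard
      obtain ⟨u, hu, rfl⟩ := exists_injective_image A hcard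
      rw [Finset.image_image]
      exact key u hu
  · rintro ⟨K, hK, hE⟩
    have hcard : Fintype.card (Fin k × Fin r) = Fintype.card K := by simp [hK]
    let φ : Fin k × Fin r ≃ K := Fintype.equivOfCardEq hcard
    -- The k * r vertices of the hyperclique are distributed bijectively over the parts, and the r
    -- vertices of each group are packed into one number in base n.
    set v : ℕ → ℕ := fun i => if hi : i < k then
      (finFunctionFinEquiv fun e : Fin r => (φ (⟨i, hi⟩, e) : Fin I.n) : ℕ) else 0 with hvdef
    have hdig : ∀ (i : ℕ) (hi : i < k) (e : ℕ) (he : e < r),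
        v i / I.n ^ e % I.n = (φ (⟨i, hi⟩, ⟨e, he⟩) : Fin I.n) := by
      intro i hi e he
      simp only [hvdef, dif_pos hi]
      exact digit_finFunctionFinEquiv (fun e : Fin r => (φ (⟨i, hi⟩, e) : Fin I.n)) ⟨e, he⟩
    refine ⟨v, fun i hi => ?_, fun y hy => ?_⟩
    · change i < k at hi
      simp only [hvdef, dif_pos hi]
      exact (finFunctionFinEquiv _).2
    · by_contra hne
      push Not at hne
      have hH : 0 < pos k h := by have : 2 ≤ pos k h := le_min hh hk; omega
      have hHr : 0 < pos k h * r := Nat.mul_pos hH hr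
      have hbit : ∀ p < pos k h, Active k h r I.n y I.tensor ∧
          Matches k h r I.n y p (v (group k h y p)) := by
        intro p hp
        have := hne p hp
        simp only [hyperOV] at this
        by_contra hc
        rw [if_neg hc] at this
        exact this rfl
      obtain ⟨⟨hgd, hpd, h0⟩, -⟩ := hbit 0 hH
      have hpl : ∀ t, partDigit k h r y t / r < pos k h := fun t => by
        rw [Nat.div_lt_iff_lt_mul hr]
        exact Nat.mod_lt _ hHr
      have hml : ∀ t, partDigit k h r y t % r < r := fun t => Nat.mod_lt _ hr
      let u : Fin h → Fin k × Fin r := fun t =>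
        (⟨zDigit k y (partDigit k h r y t / r), zDigit_lt (by omega) _ _⟩,
          ⟨partDigit k h r y t % r, hml t⟩)
      have hu : Function.Injective u := by
        intro t t' he
        have e1 := congrArg (fun z => (z.1 : ℕ)) he
        have e2 := congrArg (fun z => (z.2 : ℕ)) he
        simp only [u] at e1 e2
        have e3 := hgd _ (hpl t) _ (hpl t') e1
        refine Fin.ext (hpd t t.2 t' t'.2 ?_)
        rw [← Nat.div_add_mod (partDigit k h r y t) r, ← Nat.div_add_mod (partDigit k h r y t') r,
          e3, e2]
      have hw : ∀ t : Fin h, vertexDigit k h r I.n y t = (φ (u t) : Fin I.n) := by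
        intro t
        have h1 := (hbit _ (hpl t)).2 t t.2 rfl
        rw [group, if_pos hgd, if_pos (hpl t)] at h1
        rw [← h1]
        exact hdig _ _ _ _
      rw [tensorIndex, Finset.sum_range] at h0
      simp only [hw] at h0
      refine (I.tensor_eq_zero_iff _).1 h0 (hE _ ?_ ?_)
      · intro x hx
        obtain ⟨t, -, rfl⟩ := Finset.mem_image.1 hx
        exact (φ (u t)).2
      · rw [Finset.card_image_of_injective]
        · simp
        · exact fun t t' he => hu (φ.injective (Subtype.ext he))

theorem computable (hr : 0 < r) :
    SparseOV.Computable (fun v => hyperOV k h r s (v.var 0) v.arr) k (pos k h) := by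
  have hG : IsExpr fun v => v.var 0 := .var 0
  have hpd : ∀ {f}, IsExpr f → ∀ t, IsExpr fun v => partDigit k h r (f v) t := fun hf t =>
    ((hf.div (.const _)).div (.const _)).mod (.const _)
  have hvd : ∀ {f}, IsExpr f → ∀ t, IsExpr fun v => vertexDigit k h r (v.var 0) (f v) t :=
    fun hf t => (((hf.div (.const _)).div (.const _)).div (hG.pow t)).mod hG
  have hzd : ∀ {f}, IsExpr f → ∀ p, IsExpr fun v => zDigit k (f v) p :=
    fun hf p => (hf.div (.const _)).mod (.const _)
  have hgd : ∀ {f}, IsExpr f → IsExprCond fun v => GroupsDistinct k h (f v) := fun hf =>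
    .ball (fun p => .ball (fun p' => (IsExprCond.eq (hzd hf p) (hzd hf p')).imp
      (.eq (.const p) (.const p'))) _) _
  refine ⟨fun _ => rfl, fun _ => rfl, hG.pow r, hG.pow s,
    ((hG.pow h).mul (.const _)).mul (.const _), fun hf => hf.div (hG.pow _), fun {f g} hf hg => ?_,
    fun {f g j} hf hg hj => ?_⟩
  · exact (hgd hf).ite (IsExpr.select (F := fun p v => zDigit k (f v) p) (hzd hf) hg _)
      (((hzd hf 0).add hg).mod (.const k))
  · refine IsExprCond.ite (IsExprCond.and ((hgd hf).and (IsExprCond.and ?_ (.eq (.arr ?_) (.const 0))))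
      ?_) (.const 1) (.const 0)
    · exact .ball (fun t => .ball (fun t' => (IsExprCond.eq (hpd hf t) (hpd hf t')).imp
        (.eq (.const t) (.const t'))) _) _
    · exact .sum (fun t => (hvd hf t).mul (hG.pow t)) h
    · exact .ball (fun t => (IsExprCond.eq ((hpd hf t).div (.const r)) hg).imp
        (.eq ((hj.div (hG.pow_of_lt ((hpd hf t).mod (.const r)) r fun v => Nat.mod_lt _ hr)).mod hG)
          (hvd hf t))) h

end HyperOV

/-! ### Orthogonal vectors as sparse orthogonality problems -/

/-- The dimension d is the unit of size here: the vectors are numbered below n ≤ d ^ r, and d ^ (r -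
s) consecutive ones form a block. Every constraint concerns all k groups. -/
def denseOV (k r s n d : ℕ) (arr : ℕ → ℕ) : SparseOV where
  k := k
  H := k
  L := n
  q := d ^ s
  D := d
  blk j := j / d ^ (r - s)
  grp _ p := p
  bit y p j := if arr ((p * n + j) * d + y) = 0 then 0 else 1

namespace DenseOV

variable {k r s n d : ℕ} {arr : ℕ → ℕ}

theorem valid (hk : 2 ≤ k) (hs : s ≤ r) (hn : 0 < n) (hd : 0 < d) (hnd : n ≤ d ^ r) :
    (denseOV k r s n d arr).Valid where
  two_le := hk
  k_pos := by change 0 < k; omega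
  L_pos := hn
  q_pos := Nat.pow_pos hd
  blk_lt j hj := by
    change j < n at hj
    change j / d ^ (r - s) < d ^ s
    rw [Nat.div_lt_iff_lt_mul (Nat.pow_pos hd), ← pow_add, Nat.add_sub_cancel' hs]
    omega
  grp_lt _ _ _ hp := hp
  grp_inj _ _ _ _ _ _ he := he
  bit_le y p j := by
    simp only [denseOV]
    split_ifs <;> omega
  balanced i hi := by
    change i < k at hi
    rw [Finset.filter_true_of_mem fun y _ => ⟨i, hi, rfl⟩,
      Finset.filter_true_of_mem fun y _ => ⟨0, by change 0 < k; omega, rfl⟩]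

theorem card_blk_le (hd : 0 < d) (B : ℕ) :
    ((Finset.range (denseOV k r s n d arr).L).filter fun j =>
      (denseOV k r s n d arr).blk j = B).card ≤ d ^ (r - s) := by
  change ((Finset.range n).filter fun j => j / d ^ (r - s) = B).card ≤ _
  have hP : 0 < d ^ (r - s) := Nat.pow_pos hd
  calc _ ≤ (Finset.range (d ^ (r - s))).card := by
        refine Finset.card_le_card_of_injOn (fun j => j % d ^ (r - s)) ?_ ?_
        · intro j _
          simp only [Finset.coe_range, Set.mem_Iio]
          exact Nat.mod_lt _ hP
        · intro j hj j' hj' he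
          simp only [Finset.coe_filter, Set.mem_ofPred_eq] at hj hj' he
          rw [← Nat.div_add_mod j (d ^ (r - s)), ← Nat.div_add_mod j' (d ^ (r - s)), hj.2, hj'.2, he]
    _ = _ := Finset.card_range _

theorem computable :
    SparseOV.Computable (fun v => denseOV k r s (v.var 0) (v.var 1) v.arr) k k := by
  have hn : IsExpr fun v => v.var 0 := .var 0
  have hd : IsExpr fun v => v.var 1 := .var 1
  refine ⟨fun _ => rfl, fun _ => rfl, hn, hd.pow s, hd, fun hf => hf.div (hd.pow _),
    fun _ hg => hg, fun {f g j} hf hg hj => ?_⟩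
  exact (IsExprCond.eq (((((hg.mul hn).add hj).mul hd).add hf).arr) (.const 0)).ite (.const 0)
    (.const 1)

open Classical in
/-- The array of entries. -/
noncomputable def _root_.OVInst.entries {k : ℕ} (I : OVInst k) (t : ℕ) : ℕ :=
  if ∃ (i : Fin k) (j : Fin I.n) (y : Fin I.d),
    t = ((i : ℕ) * I.n + j) * I.d + y ∧ I.V i j y = true then 1 else 0

theorem _root_.OVInst.entries_eq_zero_iff {k : ℕ} (I : OVInst k) (i : Fin k) (j : Fin I.n)
    (y : Fin I.d) : I.entries (((i : ℕ) * I.n + j) * I.d + y) = 0 ↔ I.V i j y = false := by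
  have hd : 0 < I.d := by have := y.2; omega
  rw [OVInst.entries]
  constructor
  · intro h0
    by_contra hV
    rw [if_pos ⟨i, j, y, rfl, by simpa using hV⟩] at h0
    exact one_ne_zero h0
  · intro hV
    rw [if_neg]
    rintro ⟨i', j', y', he, hV'⟩
    rw [mul_comm, mul_comm _ I.d] at he
    have e1 := congrArg (· / I.d) he
    have e2 := congrArg (· % I.d) he
    simp only [Nat.mul_add_div hd, Nat.mul_add_mod] at e1 e2
    rw [Nat.div_eq_of_lt y.2, Nat.div_eq_of_lt y'.2, add_zero, add_zero, mul_comm,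
      mul_comm _ I.n] at e1
    rw [Nat.mod_eq_of_lt y.2, Nat.mod_eq_of_lt y'.2] at e2
    have e3 := congrArg (· / I.n) e1
    have e4 := congrArg (· % I.n) e1
    simp only [Nat.mul_add_div I.pos, Nat.mul_add_mod] at e3 e4
    rw [Nat.div_eq_of_lt j.2, Nat.div_eq_of_lt j'.2, add_zero, add_zero] at e3
    rw [Nat.mod_eq_of_lt j.2, Nat.mod_eq_of_lt j'.2] at e4
    obtain rfl := Fin.ext e2
    obtain rfl := Fin.ext e3
    obtain rfl := Fin.ext e4
    rw [hV] at hV'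
    exact absurd hV' (by simp)

theorem generalizedInner_eq_zero_iff {k d : ℕ} (v : Fin k → Fin d → Bool) :
    generalizedInner v = 0 ↔ ∀ y, ∃ i, v i y = false := by
  simp [generalizedInner, Finset.prod_eq_zero_iff]

theorem exists_solution_iff (I : OVInst k) :
    (∃ v, (denseOV k r s I.n I.d I.entries).Solution v) ↔
      ∃ x : Fin k → Fin I.n, generalizedInner (fun i => I.V i (x i)) = 0 := by
  simp only [generalizedInner_eq_zero_iff]
  constructor
  · rintro ⟨v, hv, hs⟩
    refine ⟨fun i => ⟨v i, hv i i.2⟩, fun y => ?_⟩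
    obtain ⟨p, hp, hb⟩ := hs y y.2
    refine ⟨⟨p, hp⟩, (I.entries_eq_zero_iff ⟨p, hp⟩ ⟨v p, hv p hp⟩ y).1 ?_⟩
    simp only [denseOV] at hb
    by_contra hne
    rw [if_neg hne] at hb
    exact one_ne_zero hb
  · rintro ⟨x, hx⟩
    let v : ℕ → ℕ := fun i => if hi : i < k then x ⟨i, hi⟩ else 0
    have hv : ∀ i : Fin k, v i = x i := fun i => dif_pos i.2
    refine ⟨v, fun i hi => (hv ⟨i, hi⟩).trans_lt (x ⟨i, hi⟩).2, fun y hy => ?_⟩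
    obtain ⟨i, hi⟩ := hx ⟨y, hy⟩
    refine ⟨i, i.2, ?_⟩
    have h0 := (I.entries_eq_zero_iff i (x i) ⟨y, hy⟩).2 hi
    rw [← hv] at h0
    exact if_pos h0

end DenseOV

/-! ### The exponent of matrix multiplication is at least two -/

section MatMul

variable {ι : Type} (a : ι → ℚ)

theorem straightLineRun_concat (p : List (ArithInstr ι)) (I : ArithInstr ι) :
    straightLineRun a (p ++ [I]) = straightLineRun a p ++ [I.eval a (straightLineRun a p)] := by
  simp [straightLineRun]

theorem length_straightLineRun (p : List (ArithInstr ι)) :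
    (straightLineRun a p).length = p.length := by
  induction p using List.reverseRecOn with
  | nil => rfl
  | append_singleton p I ih => rw [straightLineRun_concat]; simp [ih]

theorem getD_straightLineRun_append (p e : List (ArithInstr ι)) {t : ℕ} (ht : t < p.length) :
    (straightLineRun a (p ++ e)).getD t 0 = (straightLineRun a p).getD t 0 := by
  induction e using List.reverseRecOn with
  | nil => simp
  | append_singleton e I ih =>
    rw [← List.append_assoc, straightLineRun_concat, List.getD_append _ _ _ _
      (by rw [length_straightLineRun]; simp; omega), ih]

theorem getD_straightLineRun_concat (p : List (ArithInstr ι)) (I : ArithInstr ι) :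
    (straightLineRun a (p ++ [I])).getD p.length 0 = I.eval a (straightLineRun a p) := by
  rw [straightLineRun_concat, ← length_straightLineRun a p]
  simp

end MatMul

/-- The inputs of a program for matrix multiplication. -/
def matInput {n : ℕ} (A B : Matrix (Fin n) (Fin n) ℚ) : (Fin n × Fin n) ⊕ (Fin n × Fin n) → ℚ :=
  Sum.elim (fun e => A e.1 e.2) (fun e => B e.1 e.2)

theorem exists_dotProduct_program {n : ℕ} (i j : Fin n)
    (p : List (ArithInstr ((Fin n × Fin n) ⊕ (Fin n × Fin n)))) (l : List (Fin n)) :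
    ∃ e : List (ArithInstr ((Fin n × Fin n) ⊕ (Fin n × Fin n))), e.length = 2 * l.length + 1 ∧
      ∀ A B : Matrix (Fin n) (Fin n) ℚ,
        (straightLineRun (matInput A B) (p ++ e)).getD (p.length + 2 * l.length) 0 =
          (l.map fun x => A i x * B x j).sum := by
  induction l with
  | nil =>
    refine ⟨[.const 0], rfl, fun A B => ?_⟩
    simpa [ArithInstr.eval] using getD_straightLineRun_concat (matInput A B) p (.const 0)
  | cons x l ih =>
    obtain ⟨e, he, hv⟩ := ih
    set N := p.length + 2 * l.length with hN
    have hlen : (p ++ e).length = N + 1 := by simp [he, hN]; omega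
    set I1 : ArithInstr ((Fin n × Fin n) ⊕ (Fin n × Fin n)) :=
      .mul (.inl (.inl (i, x))) (.inl (.inr (x, j))) with hI1
    set I2 : ArithInstr ((Fin n × Fin n) ⊕ (Fin n × Fin n)) :=
      .add (.inr (N + 1)) (.inr N) with hI2
    refine ⟨e ++ [I1] ++ [I2], by simp [he]; ring, fun A B => ?_⟩
    have h1 := getD_straightLineRun_concat (matInput A B) (p ++ e) I1
    rw [hlen] at h1
    have h2 := getD_straightLineRun_append (matInput A B) (p ++ e) [I1] (t := N) (by omega)
    rw [hv] at h2
    have h3 := getD_straightLineRun_concat (matInput A B) (p ++ e ++ [I1]) I2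
    have hlen2 : (p ++ e ++ [I1]).length = N + 2 := by
      rw [List.length_append, hlen]; rfl
    rw [hlen2] at h3
    rw [show p.length + 2 * (x :: l).length = N + 2 by simp [hN]; ring,
      show p ++ (e ++ [I1] ++ [I2]) = p ++ e ++ [I1] ++ [I2] by simp, h3]
    simp only [hI2, ArithInstr.eval, operandVal, Sum.elim_inr]
    rw [h1, h2]
    simp [hI1, ArithInstr.eval, operandVal, matInput]

theorem exists_products_program {n : ℕ} (l : List (Fin n × Fin n)) :
    ∃ p : List (ArithInstr ((Fin n × Fin n) ⊕ (Fin n × Fin n))),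
      p.length = l.length * (2 * n + 1) ∧ ∀ z ∈ l, ∃ t < p.length,
        ∀ A B : Matrix (Fin n) (Fin n) ℚ,
          (straightLineRun (matInput A B) p).getD t 0 = (A * B) z.1 z.2 := by
  induction l with
  | nil => exact ⟨[], by simp, by simp⟩
  | cons z l ih =>
    obtain ⟨p, hp, hv⟩ := ih
    obtain ⟨e, he, hd⟩ := exists_dotProduct_program z.1 z.2 p (List.finRange n)
    rw [List.length_finRange] at he hd
    refine ⟨p ++ e, by simp [hp, he]; ring, fun w hw => ?_⟩
    rcases List.mem_cons.1 hw with rfl | hw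
    · refine ⟨p.length + 2 * n, by simp [he], fun A B => ?_⟩
      rw [hd, Matrix.mul_apply, ← List.ofFn_eq_map, List.sum_ofFn]
    · obtain ⟨t, ht, h⟩ := hv w hw
      exact ⟨t, by simp; omega, fun A B => by rw [getD_straightLineRun_append _ _ _ ht, h]⟩

theorem exists_multipliesMatrices (n : ℕ) :
    ∃ p, MultipliesMatrices n p ∧ p.length = n * n * (2 * n + 1) := by
  obtain ⟨p, hp, hv⟩ := exists_products_program (Finset.univ : Finset (Fin n × Fin n)).toList
  choose! t ht h using hv
  refine ⟨p, ⟨fun i j => .inr (t (i, j)), fun A B i j => h (i, j) (by simp) A B⟩, ?_⟩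
  simpa using hp

/-- The n ^ 2 outputs are the results of distinct instructions. No output is an input, since a
product with the zero matrix vanishes; none lies beyond the end of the program, where the default 0
would contradict the product of all-ones matrices; and multiplying the identity by a matrix unit
separates any two outputs. -/
theorem MultipliesMatrices.le_length {n : ℕ} (hn : 1 ≤ n)
    {p : List (ArithInstr ((Fin n × Fin n) ⊕ (Fin n × Fin n)))} (hp : MultipliesMatrices n p) :
    n * n ≤ p.length := by
  obtain ⟨out, hout⟩ := hp
  have : Nonempty (Fin n) := ⟨⟨0, hn⟩⟩
  have hex : ∀ z : Fin n × Fin n, ∃ t : Fin p.length, out z.1 z.2 = .inr (t : ℕ) := by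
    rintro ⟨i, j⟩
    rcases ho : out i j with (e | e) | t
    · have := hout (Matrix.of fun _ _ => 1) 0 i j
      rw [ho] at this
      simp [operandVal] at this
    · have := hout 0 (Matrix.of fun _ _ => 1) i j
      rw [ho] at this
      simp [operandVal] at this
    · by_cases ht : t < p.length
      · exact ⟨⟨t, ht⟩, rfl⟩
      · have := hout (Matrix.of fun _ _ => 1) (Matrix.of fun _ _ => 1) i j
        rw [ho] at this
        simp only [operandVal, Sum.elim_inr] at this
        rw [List.getD_eq_default _ _ (by rw [length_straightLineRun]; omega),
          Matrix.mul_apply] at this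
        simp only [Matrix.of_apply, mul_one, Finset.sum_const, Finset.card_univ,
          Fintype.card_fin, nsmul_eq_mul] at this
        have h0 : (n : ℚ) = 0 := this.symm
        rw [Nat.cast_eq_zero] at h0
        omega
  choose t ht using hex
  have hinj : Function.Injective t := by
    rintro ⟨i, j⟩ ⟨i', j'⟩ he
    have e1 := ht (i, j)
    have e2 := ht (i', j')
    rw [← he] at e2
    have h1 := hout 1 (Matrix.single i j 1) i j
    have h2 := hout 1 (Matrix.single i j 1) i' j'
    rw [show out i j = _ from e1, Matrix.one_mul, Matrix.single_apply_same] at h1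
    rw [show out i' j' = _ from e2, h1, Matrix.one_mul, Matrix.single_apply] at h2
    by_contra hne
    rw [if_neg] at h2
    · exact one_ne_zero h2
    · rintro ⟨rfl, rfl⟩
      exact hne rfl
  simpa using Fintype.card_le_of_injective t hinj

theorem two_le_matMulExponent : 2 ≤ matMulExponent := by
  -- The set of exponents must be nonempty, since the infimum of the empty set is 0; the schoolbook
  -- method supplies the exponent 3.
  refine le_csInf ?_ ?_
  · refine ⟨3, 3, fun n hn => ?_⟩
    obtain ⟨p, hp, hlen⟩ := exists_multipliesMatrices n
    refine ⟨p, hp, ?_⟩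
    rw [hlen, show (3 : ℝ) = ((3 : ℕ) : ℝ) by norm_num, Real.rpow_natCast]
    have : n * n * (2 * n + 1) ≤ 3 * n ^ 3 := by nlinarith
    exact_mod_cast this
  · rintro τ ⟨C, hC⟩
    by_contra hτ
    push Not at hτ
    have h1 : ∀ n : ℕ, 1 ≤ n → (n : ℝ) ^ (2 - τ) ≤ C := by
      intro n hn
      obtain ⟨p, hp, hlen⟩ := hC n hn
      have h2 : ((n * n : ℕ) : ℝ) ≤ p.length := by exact_mod_cast hp.le_length hn
      have hn0 : (0 : ℝ) < n := by exact_mod_cast hn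
      have h3 : (n : ℝ) ^ (2 : ℝ) ≤ C * (n : ℝ) ^ τ := by
        rw [Real.rpow_two, pow_two]
        push_cast at h2
        linarith
      rw [Real.rpow_sub hn0, div_le_iff₀ (Real.rpow_pos_of_pos hn0 _)]
      exact h3
    have h2 := (tendsto_rpow_atTop (show 0 < 2 - τ by linarith)).comp
      (tendsto_natCast_atTop_atTop (R := ℝ))
    obtain ⟨n, hn1, hn2⟩ := ((h2.eventually_gt_atTop C).and (Filter.eventually_ge_atTop 1)).exists
    exact absurd (h1 n hn2) (not_le.2 hn1)

/-! ### Reading the input -/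

/-- The coverage instance whose set `x` is the row `g x`. -/
def CoverInst.ofRows (n u Q : ℕ) (hn : 0 < n) (g : Fin n → Fin Q → Fin u)
    (hg : ∀ x, Function.Injective (g x)) : CoverInst where
  n := n
  pos := hn
  u := u
  S x := List.ofFn (g x)
  nodup x := List.nodup_ofFn.2 (hg x)

namespace PairCover

variable {n u Q : ℕ} {hn : 0 < n}

theorem mul_add_lt {n Q x B : ℕ} (hx : x < n) (hB : B < Q) : x * Q + B < n * Q := by
  have h1 : (x + 1) * Q ≤ n * Q := Nat.mul_le_mul_right _ hx
  rw [Nat.succ_mul] at h1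
  omega

theorem input_mem_one (k : ℕ) (g : Fin n → Fin Q → Fin u) (hg : ∀ x, Function.Injective (g x))
    (t : ℕ) : ((maxCoverProblem k).input (CoverInst.ofRows n u Q hn g hg)).mem 1 t =
      if h : t < n * Q then (g ⟨t / Q, Nat.div_lt_of_lt_mul (by rwa [mul_comm])⟩
        ⟨t % Q, Nat.mod_lt _ (Nat.pos_of_ne_zero (by rintro rfl; simp at h))⟩ : ℕ) else 0 := by
  have h1 : (List.ofFn fun x => List.ofFn (g x)).flatten = List.ofFn fun t : Fin (n * Q) =>
      g ⟨t / Q, Nat.div_lt_of_lt_mul (t.2.trans_eq (mul_comm _ _))⟩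
        ⟨t % Q, Nat.mod_lt _ (Nat.pos_of_ne_zero (by rintro rfl; exact absurd t.2 (by simp)))⟩ := by
    rw [List.ofFn_mul]
    congr 2
    funext x
    congr 1
    funext B
    have hQ : 0 < Q := by have := B.2; omega
    congr 1 <;> refine Fin.ext ?_
    · change _ = (x * Q + B) / Q
      rw [mul_comm, Nat.mul_add_div hQ, Nat.div_eq_of_lt B.2, add_zero]
    · change _ = (x * Q + B) % Q
      rw [mul_comm, Nat.mul_add_mod, Nat.mod_eq_of_lt B.2]
  rw [maxCoverProblem_mem_one]
  change (((List.ofFn fun x => List.ofFn (g x)).flatten).map Fin.val).getD t 0 = _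
  rw [h1, List.map_ofFn]
  split_ifs with h
  · rw [List.getD_eq_getElem _ _ (by simpa using h)]
    simp
  · rw [List.getD_eq_default _ _ (by simpa using h)]

theorem input_update (k : ℕ) (g g' : Fin n → Fin Q → Fin u) (hg : ∀ x, Function.Injective (g x))
    (hg' : ∀ x, Function.Injective (g' x)) (x₀ : Fin n) (B₀ : Fin Q)
    (h : ∀ x B, ¬ (x = x₀ ∧ B = B₀) → g' x B = g x B) :
    (maxCoverProblem k).input (CoverInst.ofRows n u Q hn g' hg') =
      ((maxCoverProblem k).input (CoverInst.ofRows n u Q hn g hg)).setMem 1 (x₀ * Q + B₀)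
        (g' x₀ B₀) := by
  have hQ : 0 < Q := by have := B₀.2; omega
  have hmem : ((maxCoverProblem k).input (CoverInst.ofRows n u Q hn g' hg')).mem =
      (((maxCoverProblem k).input (CoverInst.ofRows n u Q hn g hg)).setMem 1 (x₀ * Q + B₀)
        (g' x₀ B₀)).mem := by
    funext A t
    simp only [RamState.setMem]
    by_cases hA : A = 1
    · subst hA
      rw [Function.update_self]
      by_cases ht : t = x₀ * Q + B₀
      · subst ht
        rw [Function.update_self, input_mem_one, dif_pos (mul_add_lt x₀.2 B₀.2)]
        congr 2 <;> refine Fin.ext ?_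
        · change (x₀ * Q + B₀) / Q = (x₀ : ℕ)
          rw [mul_comm, Nat.mul_add_div hQ, Nat.div_eq_of_lt B₀.2, add_zero]
        · change (x₀ * Q + B₀) % Q = (B₀ : ℕ)
          rw [mul_comm, Nat.mul_add_mod, Nat.mod_eq_of_lt B₀.2]
      · rw [Function.update_of_ne ht, input_mem_one, input_mem_one]
        split_ifs with h'
        · rw [h]
          rintro ⟨rfl, rfl⟩
          apply ht
          change t = t / Q * Q + t % Q
          rw [mul_comm, Nat.div_add_mod]
        · rfl
    · rw [Function.update_of_ne hA]
      simp only [maxCoverProblem, hA, if_false]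
      by_cases hA0 : A = 0
      · simp only [hA0, if_true]
        change (if t ≤ n then ∑ i : Fin n, if (i : ℕ) < t then (List.ofFn (g' i)).length else 0
          else 0) = if t ≤ n then ∑ i : Fin n, if (i : ℕ) < t then (List.ofFn (g i)).length else 0
          else 0
        simp only [List.length_ofFn]
      · simp only [hA0, if_false]
  have hreg : ((maxCoverProblem k).input (CoverInst.ofRows n u Q hn g' hg')).reg =
      (((maxCoverProblem k).input (CoverInst.ofRows n u Q hn g hg)).setMem 1 (x₀ * Q + B₀)
        (g' x₀ B₀)).reg := rfl
  cases h1 : (maxCoverProblem k).input (CoverInst.ofRows n u Q hn g' hg')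
  cases h2 : ((maxCoverProblem k).input (CoverInst.ofRows n u Q hn g hg)).setMem 1 (x₀ * Q + B₀)
        (g' x₀ B₀)
  rw [h1, h2] at hmem hreg
  simp only at hmem hreg
  rw [hmem, hreg]

/-- The code of an unordered pair of blocks. -/
def code (Q B B' : ℕ) : ℕ := min B B' * Q + max B B'

theorem code_lt {B B' : ℕ} (hB : B < Q) (hB' : B' < Q) : code Q B B' < Q * Q :=
  mul_add_lt (by omega) (by omega)

theorem code_inj {B B' C C' : ℕ} (hB : B < Q) (hB' : B' < Q) (hC : C < Q) (hC' : C' < Q)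
    (h : code Q B C = code Q B' C') : min B C = min B' C' ∧ max B C = max B' C' := by
  have hQ : 0 < Q := by omega
  rw [code, code] at h
  have e1 := congrArg (· / Q) h
  have e2 := congrArg (· % Q) h
  simp only [Nat.mul_comm _ Q, Nat.mul_add_div hQ, Nat.mul_add_mod] at e1 e2
  rw [Nat.div_eq_of_lt (by omega), Nat.div_eq_of_lt (by omega), add_zero, add_zero] at e1
  rw [Nat.mod_eq_of_lt (by omega), Nat.mod_eq_of_lt (by omega)] at e2
  exact ⟨e1, e2⟩

variable (Q) (f : ℕ)

theorem block_lt {f : ℕ} (x : Fin (Q * f)) : (x : ℕ) / f < Q :=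
  Nat.div_lt_of_lt_mul (x.2.trans_eq (mul_comm _ _))

/-- The rows of the instance: the set `x` consists of the pairs of its block with all blocks. -/
def row (x : Fin (Q * f)) (B : Fin Q) : Fin (Q * Q + 1) :=
  ⟨code Q (x / f) B, (code_lt (block_lt Q x) B.2).trans (Nat.lt_succ_self _)⟩

theorem row_injective (x : Fin (Q * f)) : Function.Injective (row Q f x) := by
  intro B B' h
  have := code_inj (block_lt Q x) (block_lt Q x) B.2 B'.2 (congrArg Fin.val h)
  exact Fin.ext (by omega)

/-- The rows with one entry changed to a new element. -/
def row' (x₀ : Fin (Q * f)) (B₀ : Fin Q) (x : Fin (Q * f)) (B : Fin Q) : Fin (Q * Q + 1) :=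
  if x = x₀ ∧ B = B₀ then Fin.last _ else row Q f x B

theorem row_ne_last (x : Fin (Q * f)) (B : Fin Q) : row Q f x B ≠ Fin.last _ := fun h =>
  (code_lt (block_lt Q x) B.2).ne (congrArg Fin.val h)

theorem row'_injective (x₀ : Fin (Q * f)) (B₀ : Fin Q) (x : Fin (Q * f)) :
    Function.Injective (row' Q f x₀ B₀ x) := by
  intro B B' h
  simp only [row'] at h
  split_ifs at h with h1 h2 h2
  · rw [h1.2, h2.2]
  · exact absurd h.symm (row_ne_last _ _ _ _)
  · exact absurd h (row_ne_last _ _ _ _)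
  · exact row_injective _ _ _ h

variable {Q f}

/-- Any two sets share the pair formed by their blocks, so two sets of size Q never cover 2 * Q
elements. -/
theorem opt_row_lt (hn : 0 < Q * f) :
    (CoverInst.ofRows (Q * f) (Q * Q + 1) Q hn (row Q f) (row_injective Q f)).opt 2 < 2 * Q := by
  have hQ : 0 < Q := Nat.pos_of_ne_zero (by rintro rfl; simp at hn)
  rw [CoverInst.opt, Finset.sup_lt_iff (by rw [bot_eq_zero]; omega)]
  intro x _
  have hcard : ∀ y : Fin (Q * f), (List.ofFn (row Q f y)).toFinset.card = Q := fun y => by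
    rw [List.toFinset_card_of_nodup (List.nodup_ofFn.2 (row_injective Q f y)), List.length_ofFn]
  have h1 := card_biUnion_add_card_inter_le Finset.univ
    (fun j : Fin 2 => (List.ofFn (row Q f (x j))).toFinset)
    (Finset.mem_univ 0) (Finset.mem_univ 1) (by simp)
  have h2 : 0 < ((List.ofFn (row Q f (x 0))).toFinset ∩
      (List.ofFn (row Q f (x 1))).toFinset).card := by
    refine Finset.card_pos.2 ⟨row Q f (x 0) ⟨x 1 / f, block_lt Q _⟩, ?_⟩
    rw [Finset.mem_inter, List.mem_toFinset, List.mem_toFinset, List.mem_ofFn, List.mem_ofFn]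
    refine ⟨⟨_, rfl⟩, ⟨x 0 / f, block_lt Q _⟩, Fin.ext ?_⟩
    simp only [row, code]
    rw [min_comm, max_comm]
  rw [Fin.sum_univ_two] at h1
  have h3 := hcard (x 0)
  have h4 := hcard (x 1)
  change (Finset.univ.biUnion fun j : Fin 2 => (List.ofFn (row Q f (x j))).toFinset).card < 2 * Q
  omega

/-- The only common element of the set `x₀` and the sets of block `B₀` has been replaced, so `x₀`
and the first set of that block become disjoint. -/
theorem le_opt_row' (hn : 0 < Q * f) (x₀ : Fin (Q * f)) (B₀ : Fin Q) (hB : (B₀ : ℕ) ≠ x₀ / f) :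
    2 * Q ≤ (CoverInst.ofRows (Q * f) (Q * Q + 1) Q hn (row' Q f x₀ B₀)
      (row'_injective Q f x₀ B₀)).opt 2 := by
  have hf : 0 < f := Nat.pos_of_ne_zero (by rintro rfl; simp at hn)
  have hx1 : (B₀ : ℕ) * f < Q * f := Nat.mul_lt_mul_of_pos_right B₀.2 hf
  set x₁ : Fin (Q * f) := ⟨(B₀ : ℕ) * f, hx1⟩ with hx1def
  have hblk : (x₁ : ℕ) / f = B₀ := Nat.mul_div_cancel _ hf
  have hne : x₁ ≠ x₀ := by
    rintro rfl
    exact hB hblk.symm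
  have hcard : ∀ y : Fin (Q * f), (List.ofFn (row' Q f x₀ B₀ y)).toFinset.card = Q := fun y => by
    rw [List.toFinset_card_of_nodup (List.nodup_ofFn.2 (row'_injective Q f x₀ B₀ y)),
      List.length_ofFn]
  have hdisj : Disjoint (List.ofFn (row' Q f x₀ B₀ x₀)).toFinset
      (List.ofFn (row' Q f x₀ B₀ x₁)).toFinset := by
    rw [Finset.disjoint_left]
    intro e h1 h2
    rw [List.mem_toFinset, List.mem_ofFn] at h1 h2
    obtain ⟨B, rfl⟩ := h1
    obtain ⟨B', h⟩ := h2
    simp only [row'] at h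
    rw [if_neg fun h => hne h.1] at h
    split_ifs at h with hc
    · exact row_ne_last _ _ _ _ h
    · have h3 := code_inj (block_lt Q x₁) (block_lt Q x₀) B'.2 B.2 (congrArg Fin.val h)
      rw [hblk] at h3
      refine hc ⟨trivial, Fin.ext ?_⟩
      omega
  have hle := Finset.le_sup (s := Finset.univ) (f := fun x : Fin 2 → Fin (Q * f) =>
    (Finset.univ.biUnion fun j : Fin 2 => (List.ofFn (row' Q f x₀ B₀ (x j))).toFinset).card)
    (Finset.mem_univ ![x₀, x₁])
  have hval : (Finset.univ.biUnion fun j : Fin 2 =>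
      (List.ofFn (row' Q f x₀ B₀ (![x₀, x₁] j))).toFinset).card = 2 * Q := by
    rw [Finset.card_biUnion]
    · simp only [hcard, Finset.sum_const, Finset.card_univ, Fintype.card_fin, smul_eq_mul]
    · intro i _ j _ hij
      fin_cases i <;> fin_cases j
      · exact absurd rfl hij
      · exact hdisj
      · exact hdisj.symm
      · exact absurd rfl hij
  rw [← hval]
  exact hle

theorem card_block_le (hf : 0 < f) (b : ℕ) :
    (Finset.univ.filter fun x : Fin (Q * f) => (x : ℕ) / f = b).card ≤ f := by
  calc _ ≤ (Finset.range f).card := by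
        refine Finset.card_le_card_of_injOn (fun x : Fin (Q * f) => (x : ℕ) % f) ?_ ?_
        · intro x _
          simp only [Finset.coe_range, Set.mem_Iio]
          exact Nat.mod_lt _ hf
        · intro x hx x' hx' he
          simp only [Finset.coe_filter, Finset.mem_univ, true_and, Set.mem_ofPred_eq] at hx hx' he
          refine Fin.ext ?_
          rw [← Nat.div_add_mod (x : ℕ) f, ← Nat.div_add_mod (x' : ℕ) f, hx, hx', he]
    _ = f := Finset.card_range f

/-- Instances whose entries are those of the rows, up to one occurrence of the new element. -/
theorem bounded_ofRows (hn : 0 < Q * f) (g : Fin (Q * f) → Fin Q → Fin (Q * Q + 1))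
    (hg : ∀ x, Function.Injective (g x)) (x₀ : Fin (Q * f))
    (h : ∀ x B, g x B = row Q f x B ∨ x = x₀ ∧ g x B = Fin.last _) :
    (CoverInst.ofRows (Q * f) (Q * Q + 1) Q hn g hg).Bounded (Q * f) (Q * Q + 1) Q (2 * f) := by
  have hf : 0 < f := Nat.pos_of_ne_zero (by rintro rfl; simp at hn)
  refine ⟨le_rfl, le_rfl, fun x => (List.length_ofFn (f := g x)).le, fun (e : Fin (Q * Q + 1)) => ?_⟩
  change (Finset.univ.filter fun x : Fin (Q * f) => e ∈ List.ofFn (g x)).card ≤ 2 * f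
  simp only [List.mem_ofFn]
  by_cases he : e = Fin.last _
  · have hsub : (Finset.univ.filter fun x : Fin (Q * f) => ∃ B, g x B = e) ⊆ {x₀} := by
      intro x hx
      simp only [Finset.mem_filter, Finset.mem_univ, true_and] at hx
      obtain ⟨B, hB⟩ := hx
      rw [Finset.mem_singleton]
      rcases h x B with h1 | h1
      · exact absurd (h1.symm.trans (hB.trans he)) (row_ne_last _ _ _ _)
      · exact h1.1
    have := Finset.card_le_card hsub
    rw [Finset.card_singleton] at this
    exact this.trans (by omega)
  · by_cases hex : ∃ x B, row Q f x B = e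
    · obtain ⟨x1, B1, h1⟩ := hex
      have hsub : (Finset.univ.filter fun x : Fin (Q * f) => ∃ B, g x B = e) ⊆
          (Finset.univ.filter fun x : Fin (Q * f) => (x : ℕ) / f = x1 / f) ∪
          Finset.univ.filter fun x : Fin (Q * f) => (x : ℕ) / f = B1 := by
        intro x hx
        simp only [Finset.mem_filter, Finset.mem_univ, true_and] at hx
        obtain ⟨B, hB⟩ := hx
        simp only [Finset.mem_union, Finset.mem_filter, Finset.mem_univ, true_and]
        rcases h x B with h2 | h2
        · have h3 := code_inj (block_lt Q x) (block_lt Q x1) B.2 B1.2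
            (congrArg Fin.val (h2.symm.trans (hB.trans h1.symm)))
          omega
        · exact absurd (hB.symm.trans h2.2) he
      refine (Finset.card_le_card hsub).trans ((Finset.card_union_le _ _).trans ?_)
      have h2 := card_block_le (Q := Q) hf ((x1 : ℕ) / f)
      have h3 := card_block_le (Q := Q) hf (B1 : ℕ)
      omega
    · rw [Finset.filter_false_of_mem]
      · simp
      · rintro x - ⟨B, hB⟩
        rcases h x B with h2 | h2
        · exact hex ⟨x, B, h2.symm.trans hB⟩
        · exact he (hB.symm.trans h2.2)

/-- A program that is correct on the instance and on its changes has to read most of the input. -/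
theorem le_time (hn : 0 < Q * f) {W : ℕ} {P : Prog} {t : ℕ} {s : RamState}
    (hI : Exec W P ((maxCoverProblem 2).input
      (CoverInst.ofRows (Q * f) (Q * Q + 1) Q hn (row Q f) (row_injective Q f))) t s)
    (hs : s.reg 0 = (CoverInst.ofRows (Q * f) (Q * Q + 1) Q hn (row Q f) (row_injective Q f)).opt 2)
    (hJ : ∀ x₀ B₀, ∃ t' s', Exec W P ((maxCoverProblem 2).input (CoverInst.ofRows (Q * f) (Q * Q + 1)
      Q hn (row' Q f x₀ B₀) (row'_injective Q f x₀ B₀))) t' s' ∧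
      s'.reg 0 = (CoverInst.ofRows (Q * f) (Q * Q + 1) Q hn (row' Q f x₀ B₀)
        (row'_injective Q f x₀ B₀)).opt 2) :
    Q * f * (Q - 1) ≤ t := by
  obtain ⟨Z, hZ, hread⟩ := hI.exists_readSet
  by_contra hlt
  push Not at hlt
  have hQ : 0 < Q := Nat.pos_of_ne_zero (by rintro rfl; simp at hn)
  -- The cells whose change raises the optimum. The own block of a set is left out, so that the
  -- disjoint partner is a different set.
  let cells : Finset (Fin (Q * f) × Fin Q) := Finset.univ.filter fun z => (z.2 : ℕ) ≠ z.1 / f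
  have hcells : cells.card = Q * f * (Q - 1) := by
    have h1 : cells = (Finset.univ : Finset (Fin (Q * f) × Fin Q)) \
        Finset.univ.image fun x : Fin (Q * f) => (x, (⟨x / f, block_lt Q x⟩ : Fin Q)) := by
      ext ⟨x, B⟩
      simp only [cells, Finset.mem_filter, Finset.mem_univ, true_and, Finset.mem_sdiff,
        Finset.mem_image, Prod.mk.injEq, not_exists, not_and]
      constructor
      · rintro h x' rfl rfl
        exact h rfl
      · exact fun h he => h x rfl (Fin.ext he.symm)
    rw [h1, Finset.card_sdiff_of_subset (Finset.subset_univ _), Finset.card_image_of_injective _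
      fun x x' h => (Prod.mk.inj h).1, Finset.card_univ, Finset.card_univ, Fintype.card_prod,
      Fintype.card_fin, Fintype.card_fin, Nat.mul_sub, mul_one]
  let pos : Fin (Q * f) × Fin Q → ℕ × ℕ := fun z => (1, (z.1 : ℕ) * Q + z.2)
  have hpos : Function.Injective pos := by
    rintro ⟨x, B⟩ ⟨x', B'⟩ h
    have h1 := (Prod.mk.inj h).2
    simp only at h1
    rw [mul_comm, mul_comm (x' : ℕ)] at h1
    have e1 := congrArg (· / Q) h1
    have e2 := congrArg (· % Q) h1
    simp only [Nat.mul_add_div hQ, Nat.mul_add_mod] at e1 e2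
    rw [Nat.div_eq_of_lt B.2, Nat.div_eq_of_lt B'.2, add_zero, add_zero] at e1
    rw [Nat.mod_eq_of_lt B.2, Nat.mod_eq_of_lt B'.2] at e2
    rw [Fin.ext e1, Fin.ext e2]
  obtain ⟨c, hc, hcZ⟩ : ∃ c ∈ cells.image pos, c ∉ Z := by
    refine Finset.exists_mem_notMem_of_card_lt_card ?_
    rw [Finset.card_image_of_injective _ hpos, hcells]
    omega
  obtain ⟨⟨x₀, B₀⟩, hz, rfl⟩ := Finset.mem_image.1 hc
  simp only [cells, Finset.mem_filter, Finset.mem_univ, true_and] at hz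
  obtain ⟨s'', hex, hs''⟩ := hread 1 ((x₀ : ℕ) * Q + B₀) (row' Q f x₀ B₀ x₀ B₀ : ℕ) hcZ
  rw [← input_update 2 (row Q f) (row' Q f x₀ B₀) (row_injective Q f) (row'_injective Q f x₀ B₀)
    x₀ B₀ fun x B h => if_neg h] at hex
  obtain ⟨t', s', hex', hs'⟩ := hJ x₀ B₀
  have heq := hex.deterministic hex'
  have hreg : s'.reg 0 = s.reg 0 := by
    rw [← heq]
    rcases hs'' with rfl | rfl <;> rfl
  have h1 := opt_row_lt (Q := Q) (f := f) hn
  have h2 := le_opt_row' hn x₀ B₀ hz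
  rw [← hs, ← hreg, hs'] at h1
  omega

end PairCover

/-! ### The parameter regime -/

/-- The number that the lower bounds are powers of. -/
noncomputable def regimeBase (h n u s f : ℕ) : ℝ :=
  min (n : ℝ) ((f : ℝ) * min ((u : ℝ) ^ (1 / (h : ℝ))) ((s : ℝ) ^ (1 / ((h : ℝ) - 1))))

theorem regimeBase_two (n u s f : ℕ) :
    regimeBase 2 n u s f = min (n : ℝ) ((f : ℝ) * min (Real.sqrt u) (s : ℝ)) := by
  rw [regimeBase, Real.sqrt_eq_rpow, Nat.cast_ofNat, show (1 : ℝ) / (2 - 1) = 1 by norm_num,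
    Real.rpow_one]

theorem regimeBase_nonneg (h n u s f : ℕ) : 0 ≤ regimeBase h n u s f :=
  le_min (Nat.cast_nonneg _) (mul_nonneg (Nat.cast_nonneg _)
    (le_min (Real.rpow_nonneg (Nat.cast_nonneg _) _) (Real.rpow_nonneg (Nat.cast_nonneg _) _)))

theorem one_le_regimeBase {h n u s f : ℕ} (hh : 1 ≤ h) (hn : 1 ≤ n) (hu : 1 ≤ u) (hs : 1 ≤ s)
    (hf : 1 ≤ f) : 1 ≤ regimeBase h n u s f := by
  have h1 : (1 : ℝ) ≤ h := by exact_mod_cast hh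
  refine le_min (by exact_mod_cast hn) (one_le_mul_of_one_le_of_one_le (by exact_mod_cast hf)
    (le_min (Real.one_le_rpow (by exact_mod_cast hu) (by positivity))
      (Real.one_le_rpow (by exact_mod_cast hs) (one_div_nonneg.2 (by linarith)))))

/-- For m a power of M with exponent divisible by h * (h - 1), both roots are integer powers of M,
and minima of powers become minima of exponents. -/
theorem regimeBase_le {h μ a b c e M N : ℕ} (hh : 2 ≤ h) (hM : 1 ≤ M)
    (hN : N = min (h * (h - 1) * μ * a)
      (h * (h - 1) * μ * e + min ((h - 1) * μ * b) (h * μ * c))) :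
    regimeBase h ((M ^ (h * (h - 1) * μ)) ^ a) ((M ^ (h * (h - 1) * μ)) ^ b)
      ((M ^ (h * (h - 1) * μ)) ^ c) ((M ^ (h * (h - 1) * μ)) ^ e) ≤ (M : ℝ) ^ N := by
  have hM' : (1 : ℝ) ≤ M := by exact_mod_cast hM
  have hu : (((M ^ (h * (h - 1) * μ)) ^ b : ℕ) : ℝ) ^ (1 / (h : ℝ)) =
      (M : ℝ) ^ ((h - 1) * μ * b) := by
    rw [one_div, ← Real.pow_rpow_inv_natCast (x := (M : ℝ) ^ ((h - 1) * μ * b)) (n := h)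
      (by positivity) (by omega), Nat.cast_pow, Nat.cast_pow, ← pow_mul, ← pow_mul]
    congr 2
    ring
  have hs : (((M ^ (h * (h - 1) * μ)) ^ c : ℕ) : ℝ) ^ (1 / ((h : ℝ) - 1)) =
      (M : ℝ) ^ (h * μ * c) := by
    have h1 : (h : ℝ) - 1 = ((h - 1 : ℕ) : ℝ) := by
      rw [Nat.cast_sub (by omega), Nat.cast_one]
    rw [h1, one_div, ← Real.pow_rpow_inv_natCast (x := (M : ℝ) ^ (h * μ * c)) (n := h - 1)
      (by positivity) (by omega), Nat.cast_pow, Nat.cast_pow, ← pow_mul, ← pow_mul]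
    congr 2
    ring
  rw [regimeBase, hu, hs, hN, Nat.cast_pow, Nat.cast_pow, Nat.cast_pow, Nat.cast_pow, ← pow_mul,
    ← pow_mul]
  have hmono : Monotone fun i : ℕ => (M : ℝ) ^ i := pow_right_mono₀ hM'
  rw [hmono.map_min, pow_add]
  refine min_le_min le_rfl (mul_le_mul_of_nonneg_left ?_ (by positivity))
  exact (hmono.map_min (a := (h - 1) * μ * b) (b := h * μ * c)).ge

/-- Exponents `μ`, `r`, `s` such that the instances with `G ^ r` vectors in each group and `G ^ s`
blocks fit into the regime of parameters that are powers of `G ^ μ`. -/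
structure RegimeExponents (h a b c e μ r s : ℕ) : Prop where
  s_le : s ≤ r
  freq : r - s ≤ μ * e
  sets : r ≤ μ * a
  univ : h + s * h ≤ μ * b
  size : h + s * (h - 1) ≤ μ * c
  eq_or : s = 0 ∨ s + μ * e = r
  base_le : ∀ M : ℕ, 1 ≤ M →
    regimeBase h ((M ^ μ) ^ a) ((M ^ μ) ^ b) ((M ^ μ) ^ c) ((M ^ μ) ^ e) ≤ (M : ℝ) ^ (r + 2)

theorem exists_regimeExponents {h a b c e : ℕ} (hh : 2 ≤ h) (ha : 0 < a) (hb : 0 < b) (hc : 0 < c)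
    (he : 0 < e) (R : ℕ) : ∃ μ r s, R ≤ μ ∧ R ≤ r ∧ RegimeExponents h a b c e μ r s := by
  set R' := R + 1 with hR'
  set μ := h * (h - 1) * R' with hμ
  -- The largest block exponents allowed by universe and set size, where -1 makes room for the
  -- summand h in `univ` and -2 for the one in `size`, as h ≤ 2 * (h - 1). Then r is the smaller of
  -- μ * a and s₀ + μ * e, and s is the truncated r - μ * e. The loss of at most 2 in s₀ is the 2 in
  -- `base_le`.
  set s₀ := min ((h - 1) * R' * b - 1) (h * R' * c - 2) with hs₀
  have hb1 : R' ≤ (h - 1) * R' * b := by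
    rw [mul_right_comm]
    exact Nat.le_mul_of_pos_left _ (Nat.mul_pos (by omega) hb)
  have hc1 : 2 ≤ h * R' * c :=
    calc 2 ≤ h := hh
      _ ≤ h * (R' * c) := Nat.le_mul_of_pos_right _ (Nat.mul_pos (by omega) hc)
      _ = h * R' * c := (mul_assoc _ _ _).symm
  have hμR : R' ≤ μ := Nat.le_mul_of_pos_left _ (Nat.mul_pos (by omega) (by omega))
  have hμa : μ ≤ μ * a := Nat.le_mul_of_pos_right _ ha
  have hμe : μ ≤ μ * e := Nat.le_mul_of_pos_right _ he
  have hsb : (s₀ + 1) * h ≤ μ * b := by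
    calc (s₀ + 1) * h ≤ ((h - 1) * R' * b) * h := Nat.mul_le_mul_right _ (by omega)
      _ = μ * b := by rw [hμ]; ring
  have hsc : (s₀ + 2) * (h - 1) ≤ μ * c := by
    calc (s₀ + 2) * (h - 1) ≤ (h * R' * c) * (h - 1) := Nat.mul_le_mul_right _ (by omega)
      _ = μ * c := by rw [hμ]; ring
  have hs : min (μ * a) (s₀ + μ * e) - μ * e ≤ s₀ := by omega
  have hs1 : (min (μ * a) (s₀ + μ * e) - μ * e) * h ≤ s₀ * h := Nat.mul_le_mul_right _ hs
  have hs2 : (min (μ * a) (s₀ + μ * e) - μ * e) * (h - 1) ≤ s₀ * (h - 1) :=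
    Nat.mul_le_mul_right _ hs
  rw [add_mul] at hsb hsc
  refine ⟨μ, min (μ * a) (s₀ + μ * e), min (μ * a) (s₀ + μ * e) - μ * e, by omega, by omega,
    by omega, by omega, by omega, by omega, by omega, by omega, fun M hM => ?_⟩
  refine (regimeBase_le hh hM rfl).trans (pow_le_pow_right₀ (by exact_mod_cast hM) ?_)
  rw [← hμ]
  omega

/-! ### The size of the coverage instances -/

/-- Constant factors in the parameters of the instance are absorbed by taking m to be a power of K *
G instead of G. -/
theorem mul_pow_le_mul_pow {K G i j : ℕ} (hG : 1 ≤ G) (hij : i ≤ j) (hj : 1 ≤ j) :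
    K * G ^ i ≤ (K * G) ^ j := by
  rw [mul_pow]
  exact Nat.mul_le_mul (Nat.le_self_pow (by omega) K) (Nat.pow_le_pow_right hG hij)

/-- The base a is at most 3 * G ^ s, so W is of order G ^ (h + s * (H - 2)). The gadget contributes
q * W to a set and q ^ 2 * W per group to the universe, both within the order of the main part. -/
theorem SparseOV.exists_size_bound (k H D₀ : ℕ) : ∃ K : ℕ, 1 ≤ K ∧ H ≤ K ∧
    ∀ (X : SparseOV) (h r s G : ℕ), X.k = k → X.H = H → 2 ≤ H → 1 ≤ G → X.L ≤ G ^ r →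
      X.q = G ^ s → X.D ≤ D₀ * G ^ h →
      X.sets ≤ K * G ^ r ∧ X.univ ≤ K * G ^ (h + s * H) ∧ X.cands ≤ K * G ^ (h + s * (H - 1)) ∧
      (X.sets + 1) * (X.cands + 1) ≤ K * G ^ (r + h + s * (H - 1)) := by
  set w := D₀ * H ^ 2 * 3 ^ (H - 2) + 1 with hw
  set c₀ := D₀ * (H * 3 ^ (H - 1)) + w with hc₀
  set u₀ := D₀ * 3 ^ H + k * w with hu₀
  refine ⟨H + k + u₀ + (k + 1) * (c₀ + 1), ?_, by omega, ?_⟩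
  · have : 0 < (k + 1) * (c₀ + 1) := by positivity
    omega
  intro X h r s G hk hH h2 hG hL hq hD
  have hG' : ∀ i, 1 ≤ G ^ i := fun i => Nat.one_le_pow _ _ hG
  have ha : X.a ≤ 3 * G ^ s := by
    have := hG' s
    rw [SparseOV.a, hq]
    omega
  have hap : ∀ i, X.a ^ i ≤ 3 ^ i * G ^ (s * i) := fun i => by
    rw [pow_mul, ← mul_pow]
    exact Nat.pow_le_pow_left ha i
  obtain ⟨H', rfl⟩ : ∃ H', H = H' + 2 := ⟨H - 2, by omega⟩
  have e1 : H' + 2 - 2 = H' := by omega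
  have e2 : H' + 2 - 1 = H' + 1 := by omega
  rw [e1] at hw
  rw [e2] at hc₀ ⊢
  have hW : X.W ≤ w * G ^ (h + s * H') := by
    rw [SparseOV.W, hH, e1, hw, add_mul, one_mul]
    refine Nat.add_le_add ?_ (hG' _)
    calc X.D * (H' + 2) ^ 2 * X.a ^ H'
        ≤ D₀ * G ^ h * (H' + 2) ^ 2 * (3 ^ H' * G ^ (s * H')) :=
          Nat.mul_le_mul (Nat.mul_le_mul_right _ hD) (hap H')
      _ = D₀ * (H' + 2) ^ 2 * 3 ^ H' * G ^ (h + s * H') := by rw [pow_add]; ring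
  have hsets : X.sets ≤ k * G ^ r := by
    rw [SparseOV.sets, hk]
    exact Nat.mul_le_mul_left _ hL
  have hcands : X.cands ≤ c₀ * G ^ (h + s * (H' + 1)) := by
    rw [SparseOV.cands, SparseOV.mainCands, hH, e2, hq, hc₀, add_mul (D₀ * _) w]
    refine Nat.add_le_add ?_ ?_
    · calc X.D * ((H' + 2) * X.a ^ (H' + 1))
          ≤ D₀ * G ^ h * ((H' + 2) * (3 ^ (H' + 1) * G ^ (s * (H' + 1)))) :=
            Nat.mul_le_mul hD (Nat.mul_le_mul_left _ (hap _))
        _ = D₀ * ((H' + 2) * 3 ^ (H' + 1)) * G ^ (h + s * (H' + 1)) := by rw [pow_add G h]; ring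
    · calc G ^ s * X.W ≤ G ^ s * (w * G ^ (h + s * H')) := Nat.mul_le_mul_left _ hW
        _ = w * G ^ (h + s * (H' + 1)) := by
          rw [show h + s * (H' + 1) = s + (h + s * H') by ring, pow_add G s]; ring
  have huniv : X.univ ≤ u₀ * G ^ (h + s * (H' + 2)) := by
    rw [SparseOV.univ, hH, hk, hq, hu₀, add_mul]
    refine Nat.add_le_add ?_ ?_
    · calc X.D * X.a ^ (H' + 2) ≤ D₀ * G ^ h * (3 ^ (H' + 2) * G ^ (s * (H' + 2))) :=
            Nat.mul_le_mul hD (hap _)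
        _ = D₀ * 3 ^ (H' + 2) * G ^ (h + s * (H' + 2)) := by rw [pow_add G h]; ring
    · calc k * G ^ s * G ^ s * X.W ≤ k * G ^ s * G ^ s * (w * G ^ (h + s * H')) :=
            Nat.mul_le_mul_left _ hW
        _ = k * w * G ^ (h + s * (H' + 2)) := by
          rw [show h + s * (H' + 2) = s + s + (h + s * H') by ring, pow_add G (s + s),
            pow_add G s]; ring
  clear_value c₀
  have hkc : k + c₀ ≤ (k + 1) * (c₀ + 1) := by nlinarith
  refine ⟨hsets.trans (Nat.mul_le_mul_right _ (by omega)),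
    huniv.trans (Nat.mul_le_mul_right _ (by omega)),
    hcands.trans (Nat.mul_le_mul_right _ (by omega)), ?_⟩
  calc (X.sets + 1) * (X.cands + 1)
      ≤ ((k + 1) * G ^ r) * ((c₀ + 1) * G ^ (h + s * (H' + 1))) := by
        rw [add_mul k 1, add_mul c₀ 1, one_mul, one_mul]
        exact Nat.mul_le_mul (Nat.add_le_add hsets (hG' _)) (Nat.add_le_add hcands (hG' _))
    _ = (k + 1) * (c₀ + 1) * G ^ (r + h + s * (H' + 1)) := by
        rw [add_assoc r, pow_add G r]; ring
    _ ≤ _ := Nat.mul_le_mul_right _ (by omega)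

/-- The time bound, for instances of size `G ^ r`. -/
theorem RegimeExponents.time_le {h a b c e μ r s : ℕ} (hp : RegimeExponents h a b c e μ r s)
    (hh : 2 ≤ h) {ε τ ρ : ℝ} (hτ : 0 ≤ τ) (hr : 3 ≤ r * min ε (1 / 2)) (hρ : τ * (r - 1) ≤ ρ)
    {K G : ℕ} (hK : 1 ≤ K) (hG : 1 ≤ G) :
    regimeBase h (((K * G) ^ μ) ^ a) (((K * G) ^ μ) ^ b) (((K * G) ^ μ) ^ c) (((K * G) ^ μ) ^ e) ^
      (τ * (1 - ε)) ≤ (K : ℝ) ^ ρ * (G : ℝ) ^ ρ := by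
  have hM : 1 ≤ K * G := Nat.mul_pos hK hG
  have hpow : ∀ i, 1 ≤ ((K * G) ^ μ) ^ i := fun i => Nat.one_le_pow _ _ (Nat.one_le_pow _ _ hM)
  have h1 := one_le_regimeBase (h := h) (by omega) (hpow a) (hpow b) (hpow c) (hpow e)
  have hM' : (1 : ℝ) ≤ ((K * G : ℕ) : ℝ) := by exact_mod_cast hM
  have hε1 := min_le_left ε (1 / 2 : ℝ)
  have hε2 := min_le_right ε (1 / 2 : ℝ)
  -- Replacing ε by a smaller δ ≤ 1/2 keeps 1 - δ positive, as the monotonicity in the base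
  -- requires.
  set δ := min ε (1 / 2 : ℝ)
  have hδ : 0 ≤ δ := by
    by_contra hneg
    push Not at hneg
    have := mul_nonpos_of_nonneg_of_nonpos (Nat.cast_nonneg (α := ℝ) r) hneg.le
    linarith
  calc _ ≤ regimeBase h _ _ _ _ ^ (τ * (1 - δ)) :=
        Real.rpow_le_rpow_of_exponent_le h1 (mul_le_mul_of_nonneg_left (by linarith) hτ)
    _ ≤ (((K * G : ℕ) : ℝ) ^ (r + 2)) ^ (τ * (1 - δ)) :=
        Real.rpow_le_rpow (by linarith) (hp.base_le _ hM) (mul_nonneg hτ (by linarith))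
    _ = ((K * G : ℕ) : ℝ) ^ (((r + 2 : ℕ) : ℝ) * (τ * (1 - δ))) := by
        rw [Real.rpow_natCast_mul (by linarith)]
    _ ≤ ((K * G : ℕ) : ℝ) ^ ρ := by
        -- Since r * δ ≥ 3, the product (r + 2) * (1 - δ) is at most r - 1.
        refine Real.rpow_le_rpow_of_exponent_le hM' (le_trans ?_ hρ)
        rw [mul_left_comm]
        refine mul_le_mul_of_nonneg_left ?_ hτ
        push_cast
        nlinarith
    _ = _ := by rw [Nat.cast_mul, Real.mul_rpow (Nat.cast_nonneg _) (Nat.cast_nonneg _)]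

/-! ### Hypercliques -/

/-- The hypotheses on ρ are the two costs on n vertices: `hρ` bounds the run of the solver and `hρ'`
the construction of the instance. The exponent τ is left open because cliques need ω * k / 3 in
place of k. -/
theorem hypercliqueProblem_solvableInTime {k h a b c e μ r s : ℕ} (hk : 2 ≤ k) (hh : 2 ≤ h)
    (ha : 0 < a) (he : 0 < e) (hμ : 0 < μ) (hr : h ≤ r) (hp : RegimeExponents h a b c e μ r s)
    {ε τ ρ : ℝ} (hτ : 0 ≤ τ) (hrε : 3 ≤ r * min ε (1 / 2)) (hρ : τ * (r - 1) ≤ ρ)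
    (hρ' : ((r + h + s * (min h k - 1) : ℕ) : ℝ) ≤ ρ)
    (hsolve : MaxCoverSolvable k a b c e fun n u Δs Δf => regimeBase h n u Δs Δf ^ (τ * (1 - ε))) :
    (hypercliqueProblem h (k * r)).SolvableInTime (fun I : HypergraphInst h => I)
      (fun I : HypergraphInst h => (I.n : ℝ) ^ ρ) := by
  classical
  obtain ⟨K, hK, hHK, hbound⟩ := SparseOV.exists_size_bound k (min h k)
    ((min h k * r) ^ h * k ^ min h k)
  have hB := fun I : HypergraphInst h => hbound (hyperOV k h r s I.n I.tensor) h r s I.n rfl rfl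
    (by omega) I.pos le_rfl rfl (by rw [hyperOV, mul_comm _ (I.n ^ h), mul_assoc])
  have hsH : s * min h k ≤ s * h := Nat.mul_le_mul_left _ (by omega)
  have hsH' : s * (min h k - 1) ≤ s * (h - 1) := Nat.mul_le_mul_left _ (by omega)
  have hpu := hp.univ
  have hps := hp.size
  have hρ0 : 0 ≤ ρ := le_trans (Nat.cast_nonneg _) hρ'
  refine (HyperOV.computable (k := k) (h := h) (s := s) (by omega : 0 < r)).solvableInTime hsolve
    (fun n u s f => Real.rpow_nonneg (regimeBase_nonneg _ _ _ _ _) _) _ _ _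
    (fun I : HypergraphInst h => I.n) (fun _ => 0) (fun I => I.tensor)
    (fun I => hyperOV k h r s I.n I.tensor) (fun I => (K * I.n) ^ μ) (fun I => I.n ^ (r - s))
    ?_ ?_ ?_ (fun _ _ _ => rfl) (fun I => HyperOV.valid hk hh hp.s_le I.pos) ?_
    (fun I => Nat.one_le_pow _ _ (Nat.mul_pos hK I.pos)) (fun I => HyperOV.card_blk_le I.pos)
    ?_ ?_ ?_ ?_ (max ((K : ℝ) ^ ρ) K) ?_ ?_
  · intro I
    simp only [hypercliqueProblem, HypergraphInst.tensor, ite_and]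
  · intro I
    exact le_rfl
  · intro I t
    simp only [HypergraphInst.tensor]
    split_ifs <;> omega
  · intro I
    have hkr : h ≤ k * r := hr.trans (Nat.le_mul_of_pos_left _ (by omega))
    simp only [hypercliqueProblem, HyperOV.exists_solution_iff hk hh (by omega : 0 < r) hkr I]
  · intro I
    rw [← pow_mul]
    exact (hB I).1.trans (mul_pow_le_mul_pow I.pos hp.sets (Nat.mul_pos hμ ha))
  · intro I
    rw [← pow_mul]
    exact (hB I).2.1.trans (mul_pow_le_mul_pow I.pos (by omega) (by omega))
  · intro I
    rw [← pow_mul]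
    exact (hB I).2.2.1.trans (mul_pow_le_mul_pow I.pos (by omega) (by omega))
  · intro I
    rw [← pow_mul]
    exact (Nat.mul_le_mul_right _ hHK).trans
      (mul_pow_le_mul_pow I.pos hp.freq (Nat.mul_pos hμ he))
  · intro I
    exact (hp.time_le hh hτ hrε hρ hK I.pos).trans (mul_le_mul_of_nonneg_right (le_max_left _ _)
      (Real.rpow_nonneg (Nat.cast_nonneg _) _))
  · intro I
    have h1 : (1 : ℝ) ≤ I.n := by exact_mod_cast I.pos
    calc _ ≤ ((K * I.n ^ (r + h + s * (min h k - 1)) : ℕ) : ℝ) := Nat.cast_le.2 (hB I).2.2.2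
      _ = (K : ℝ) * (I.n : ℝ) ^ ((r + h + s * (min h k - 1) : ℕ) : ℝ) := by
        rw [Nat.cast_mul, Nat.cast_pow, Real.rpow_natCast]
      _ ≤ max ((K : ℝ) ^ ρ) K * (I.n : ℝ) ^ ρ :=
        mul_le_mul (le_max_right _ _) (Real.rpow_le_rpow_of_exponent_le h1 hρ')
          (Real.rpow_nonneg (Nat.cast_nonneg _) _) (le_trans (Nat.cast_nonneg _) (le_max_right _ _))

/-! ### Orthogonal vectors -/

/-- The dimension `n ^ (1 / r)`, rounded up. -/
noncomputable def rootDim (r n : ℕ) : ℕ := ⌈(n : ℝ) ^ (r : ℝ)⁻¹⌉₊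

theorem le_rootDim_pow {r : ℕ} (hr : 0 < r) (n : ℕ) : n ≤ rootDim r n ^ r := by
  have h1 := Nat.le_ceil ((n : ℝ) ^ (r : ℝ)⁻¹)
  have h2 := pow_le_pow_left₀ (Real.rpow_nonneg (Nat.cast_nonneg n) _) h1 r
  rw [Real.rpow_inv_natCast_pow (Nat.cast_nonneg n) (by omega)] at h2
  exact_mod_cast h2

theorem rootDim_pos (r : ℕ) {n : ℕ} (hn : 0 < n) : 0 < rootDim r n :=
  Nat.ceil_pos.2 (Real.rpow_pos_of_pos (Nat.cast_pos.2 hn) _)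

theorem rootDim_le (r : ℕ) {n : ℕ} (hn : 0 < n) :
    (rootDim r n : ℝ) ≤ 2 * (n : ℝ) ^ (r : ℝ)⁻¹ := by
  have h1 := (Nat.ceil_lt_add_one (Real.rpow_nonneg (Nat.cast_nonneg n) (r : ℝ)⁻¹)).le
  have h2 : (1 : ℝ) ≤ (n : ℝ) ^ (r : ℝ)⁻¹ :=
    Real.one_le_rpow (by exact_mod_cast hn) (by positivity)
  rw [rootDim]
  linarith

theorem isLittleO_log_rootDim {r : ℕ} (hr : 0 < r) :
    (fun n : ℕ => Real.log n) =o[Filter.atTop] (fun n : ℕ => (rootDim r n : ℝ)) := by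
  have h1 : (fun n : ℕ => Real.log n) =o[Filter.atTop] (fun n : ℕ => (n : ℝ) ^ (r : ℝ)⁻¹) :=
    (isLittleO_log_rpow_atTop (by positivity)).comp_tendsto tendsto_natCast_atTop_atTop
  refine h1.trans_le fun n => ?_
  rw [Real.norm_of_nonneg (by positivity), Real.norm_of_nonneg (by positivity)]
  exact Nat.le_ceil _

/-- The dimension of order n ^ (1 / r) grows faster than log n and still gives few constraints.
Costs are powers of d, and d ^ ρ is at most 2 ^ ρ * n ^ (ρ / r). -/
theorem ovProblem_solvableInTime {k a b c e μ r s : ℕ} (hk : 2 ≤ k) (ha : 0 < a) (he : 0 < e)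
    (hμ : 0 < μ) (hr : 0 < r) (hp : RegimeExponents k a b c e μ r s) {ε τ ρ : ℝ} (hτ : 0 ≤ τ)
    (hrε : 3 ≤ r * min ε (1 / 2)) (hρ : τ * (r - 1) ≤ ρ)
    (hρ' : ((r + k + s * (k - 1) : ℕ) : ℝ) ≤ ρ)
    (hsolve : MaxCoverSolvable k a b c e fun n u Δs Δf => regimeBase k n u Δs Δf ^ (τ * (1 - ε))) :
    (ovProblem k).SolvableInTime (fun I : {I : OVInst k // I.d = rootDim r I.n} => I.1)
      (fun I => (I.1.n : ℝ) ^ (ρ / r)) := by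
  classical
  obtain ⟨K, hK, hHK, hbound⟩ := SparseOV.exists_size_bound k k 1
  have hd : ∀ I : {I : OVInst k // I.d = rootDim r I.n}, 0 < I.1.d := fun I => by
    rw [I.2]
    exact rootDim_pos r I.1.pos
  have hnd : ∀ I : {I : OVInst k // I.d = rootDim r I.n}, I.1.n ≤ I.1.d ^ r := fun I => by
    rw [I.2]
    exact le_rootDim_pow hr _
  have hB := fun I : {I : OVInst k // I.d = rootDim r I.n} =>
    hbound (denseOV k r s I.1.n I.1.d I.1.entries) k r s I.1.d rfl rfl hk (hd I) (hnd I) rfl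
      (by rw [one_mul]; exact Nat.le_self_pow (by omega) _)
  have hpu := hp.univ
  have hps := hp.size
  have hρ0 : 0 ≤ ρ := le_trans (Nat.cast_nonneg _) hρ'
  have hC0 : 0 ≤ max ((K : ℝ) ^ ρ) K := le_trans (Nat.cast_nonneg _) (le_max_right _ _)
  have hdim : ∀ I : {I : OVInst k // I.d = rootDim r I.n},
      (I.1.d : ℝ) ^ ρ ≤ 2 ^ ρ * (I.1.n : ℝ) ^ (ρ / r) := fun I => by
    have h1 := rootDim_le r I.1.pos
    rw [← I.2] at h1
    refine (Real.rpow_le_rpow (Nat.cast_nonneg _) h1 hρ0).trans_eq ?_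
    rw [Real.mul_rpow (by norm_num) (Real.rpow_nonneg (Nat.cast_nonneg _) _),
      ← Real.rpow_mul (Nat.cast_nonneg _), inv_mul_eq_div]
  refine (DenseOV.computable (k := k) (r := r) (s := s)).solvableInTime hsolve
    (fun n u s f => Real.rpow_nonneg (regimeBase_nonneg _ _ _ _ _) _) _ _ _
    (fun I => I.1.n) (fun I => I.1.d) (fun I => I.1.entries)
    (fun I => denseOV k r s I.1.n I.1.d I.1.entries) (fun I => (K * I.1.d) ^ μ)
    (fun I => I.1.d ^ (r - s))
    ?_ ?_ ?_ (fun _ _ _ => rfl) (fun I => DenseOV.valid hk hp.s_le I.1.pos (hd I) (hnd I)) ?_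
    (fun I => Nat.one_le_pow _ _ (Nat.mul_pos hK (hd I))) (fun I => DenseOV.card_blk_le (hd I))
    ?_ ?_ ?_ ?_ (max ((K : ℝ) ^ ρ) K * 2 ^ ρ) ?_ ?_
  · intro I
    simp only [ovProblem, OVInst.entries, ite_and]
  · intro I
    exact le_rfl
  · intro I t
    simp only [OVInst.entries]
    split_ifs <;> omega
  · intro I
    simp only [ovProblem, DenseOV.exists_solution_iff]
  · intro I
    rw [← pow_mul]
    exact (hB I).1.trans (mul_pow_le_mul_pow (hd I) hp.sets (Nat.mul_pos hμ ha))
  · intro I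
    rw [← pow_mul]
    exact (hB I).2.1.trans (mul_pow_le_mul_pow (hd I) (by omega) (by omega))
  · intro I
    rw [← pow_mul]
    exact (hB I).2.2.1.trans (mul_pow_le_mul_pow (hd I) (by omega) (by omega))
  · intro I
    rw [← pow_mul]
    exact (Nat.mul_le_mul_right _ hHK).trans
      (mul_pow_le_mul_pow (hd I) hp.freq (Nat.mul_pos hμ he))
  · intro I
    rw [mul_assoc]
    exact (hp.time_le hk hτ hrε hρ hK (hd I)).trans (mul_le_mul (le_max_left _ _) (hdim I)
      (Real.rpow_nonneg (Nat.cast_nonneg _) _) hC0)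
  · intro I
    have h1 : (1 : ℝ) ≤ I.1.d := by exact_mod_cast hd I
    rw [mul_assoc]
    calc _ ≤ ((K * I.1.d ^ (r + k + s * (k - 1)) : ℕ) : ℝ) := Nat.cast_le.2 (hB I).2.2.2
      _ = (K : ℝ) * (I.1.d : ℝ) ^ ((r + k + s * (k - 1) : ℕ) : ℝ) := by
        rw [Nat.cast_mul, Nat.cast_pow, Real.rpow_natCast]
      _ ≤ max ((K : ℝ) ^ ρ) K * (2 ^ ρ * (I.1.n : ℝ) ^ (ρ / r)) :=
        mul_le_mul (le_max_right _ _)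
          ((Real.rpow_le_rpow_of_exponent_le h1 hρ').trans (hdim I))
          (Real.rpow_nonneg (Nat.cast_nonneg _) _) hC0

/-! ### Cliques -/

/-- The graph as a hypergraph. -/
def GraphInst.toHypergraph (I : GraphInst) : HypergraphInst 2 where
  n := I.n
  pos := I.pos
  E := {e | ∃ i j, I.G.Adj i j ∧ e = {i, j}}
  uniform := by
    rintro e ⟨i, j, hij, rfl⟩
    exact Finset.card_pair hij.ne

theorem GraphInst.pair_mem_toHypergraph (I : GraphInst) (i j : Fin I.n) :
    ({i, j} : Finset (Fin I.n)) ∈ I.toHypergraph.E ↔ I.G.Adj i j := by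
  constructor
  · rintro ⟨i', j', h, he⟩
    have hi : i' ∈ ({i, j} : Finset (Fin I.n)) := he ▸ Finset.mem_insert_self _ _
    have hj : j' ∈ ({i, j} : Finset (Fin I.n)) :=
      he ▸ Finset.mem_insert_of_mem (Finset.mem_singleton_self _)
    rw [Finset.mem_insert, Finset.mem_singleton] at hi hj
    rcases hi with rfl | rfl <;> rcases hj with rfl | rfl
    · exact absurd rfl h.ne
    · exact h
    · exact h.symm
    · exact absurd rfl h.ne
  · exact fun h => ⟨i, j, h, rfl⟩

theorem GraphInst.input_toHypergraph (I : GraphInst) (l : ℕ) :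
    (hypercliqueProblem 2 l).input I.toHypergraph = (cliqueProblem l).input I := by
  have h1 : ∀ t : ℕ, (∃ x : Fin 2 → Fin I.n, t = ∑ j : Fin 2, (x j : ℕ) * I.n ^ (j : ℕ) ∧
      Finset.univ.image x ∈ I.toHypergraph.E) ↔
      ∃ i j : Fin I.n, t = (i : ℕ) * I.n + j ∧ I.G.Adj i j := by
    intro t
    constructor
    · rintro ⟨x, rfl, hx⟩
      have h2 : Finset.univ.image x = {x 1, x 0} := by
        ext y
        simp only [Finset.mem_image, Finset.mem_univ, true_and, Fin.exists_fin_two,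
          Finset.mem_insert, Finset.mem_singleton]
        tauto
      rw [h2] at hx
      -- The low-order coordinate of the tensor is `x 0`, which is the column of the adjacency
      -- matrix.
      exact ⟨x 1, x 0, by simp [Fin.sum_univ_two, add_comm], (I.pair_mem_toHypergraph _ _).1 hx⟩
    · rintro ⟨i, j, rfl, hij⟩
      refine ⟨![j, i], by simp [Fin.sum_univ_two, add_comm], ?_⟩
      have h2 : Finset.univ.image ![j, i] = {i, j} := by
        ext y
        simp only [Finset.mem_image, Finset.mem_univ, true_and, Fin.exists_fin_two,
          Finset.mem_insert, Finset.mem_singleton, Matrix.cons_val_zero, Matrix.cons_val_one]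
        tauto
      rw [h2]
      exact (I.pair_mem_toHypergraph _ _).2 hij
  classical
  exact congrArg (RamState.mk (twoRegs I.n 0))
    (funext₂ fun A t => if_congr (and_congr Iff.rfl (h1 t)) rfl rfl)

theorem GraphInst.answer_toHypergraph (I : GraphInst) (l : ℕ) :
    (hypercliqueProblem 2 l).answer I.toHypergraph = (cliqueProblem l).answer I := by
  have h1 : (∃ K : Finset (Fin I.n), K.card = l ∧
      ∀ e ⊆ K, e.card = 2 → e ∈ I.toHypergraph.E) ↔ ∃ K : Finset (Fin I.n), I.G.IsNClique l K := by
    refine exists_congr fun K => ?_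
    rw [SimpleGraph.isNClique_iff, and_comm (a := K.card = l)]
    refine and_congr_left fun _ => ?_
    constructor
    · intro h i hi j hj hij
      refine (I.pair_mem_toHypergraph i j).1 (h _ ?_ (Finset.card_pair hij))
      exact Finset.insert_subset hi (Finset.singleton_subset_iff.2 hj)
    · intro h e he he2
      obtain ⟨i, j, hij, rfl⟩ := Finset.card_eq_two.1 he2
      exact (I.pair_mem_toHypergraph i j).2
        (h (he (Finset.mem_insert_self _ _)) (he (Finset.mem_insert_of_mem
          (Finset.mem_singleton_self _))) hij)
  classical
  exact if_congr h1 rfl rfl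

theorem cliqueProblem_solvableInTime {l : ℕ} {T : ℕ → ℝ}
    (h : (hypercliqueProblem 2 l).SolvableInTime (fun I : HypergraphInst 2 => I)
      (fun I : HypergraphInst 2 => T I.n)) :
    (cliqueProblem l).SolvableInTime (fun I : GraphInst => I) (fun I : GraphInst => T I.n) := by
  obtain ⟨P, c, C, hP⟩ := h
  refine ⟨P, c, C, fun I => ?_⟩
  obtain ⟨t, s, h1, h2, h3⟩ := hP I.toHypergraph
  exact ⟨t, s, by rw [← I.input_toHypergraph]; exact h1, h2,
    by rw [← I.answer_toHypergraph]; exact h3⟩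

/-! ### Times in which the input cannot be read -/

/-- At m = M ^ 2 the base of the bound is at most M ^ N, while the regime contains instances of
`PairCover` with about M ^ N sets of about M ^ (N - 2 * e) elements. By `PairCover.le_time` almost
all of this input has to be read, which takes time of order M ^ (2 * N - 2 * e). -/
theorem not_maxCoverSolvable_two {a b c e N : ℕ} (he : 0 < e)
    (hN : N = min (2 * a) (2 * e + min b (2 * c))) (hNe : 2 * e < N) {β : ℝ}
    (hβ : β * N < 2 * N - 2 * e) :
    ¬ MaxCoverSolvable 2 a b c e fun n u Δs Δf => regimeBase 2 n u Δs Δf ^ β := by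
  rintro ⟨P, w, C, hP⟩
  have hNe' : (2 * e : ℝ) < N := by exact_mod_cast hNe
  have he' : (0 : ℝ) < e := by exact_mod_cast he
  have hβ' : max β 0 * N < 2 * N - 2 * e := by
    rcases max_choice β 0 with h | h <;> rw [h] <;> linarith
  have hexp : 0 < 2 * (N : ℝ) - 2 * e - N * max β 0 := by linarith
  have key : ∀ R : ℕ, 2 ≤ R →
      ((2 * R : ℕ) : ℝ) ^ (2 * (N : ℝ) - 2 * e - N * max β 0) ≤ 16 * max C 0 := by
    intro R hR
    -- An even M makes Q and f, half of M ^ (N - 2 * e) and of M ^ (2 * e), integers. The halves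
    -- leave room for the frequency 2 * f and for the additional element of the universe.
    set M := 2 * R with hM
    have hM1 : 1 ≤ M := by omega
    have hMR : (1 : ℝ) ≤ M := by exact_mod_cast hM1
    obtain ⟨κ, hκ⟩ : ∃ κ, N = 2 * e + (κ + 1) := ⟨N - 2 * e - 1, by omega⟩
    obtain ⟨g, hg⟩ : ∃ g, 2 * e = g + 1 := ⟨2 * e - 1, by omega⟩
    set Q := R * M ^ κ with hQ
    set f := R * M ^ g with hf
    have hQ2 : 2 * Q = M ^ (κ + 1) := by rw [hQ, pow_succ, hM]; ring
    have hf2 : 2 * f = M ^ (2 * e) := by rw [hf, hg, pow_succ, hM]; ring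
    have hQ1 : 2 ≤ Q := hR.trans (Nat.le_mul_of_pos_right _ (Nat.pow_pos hM1))
    have hf1 : 0 < f := Nat.mul_pos (by omega) (Nat.pow_pos hM1)
    have hn : 0 < Q * f := Nat.mul_pos (by omega) hf1
    have hQf : 4 * (Q * f) = M ^ N := by
      rw [hκ, pow_add, ← hQ2, ← hf2]; ring
    have hpow : ∀ {i j : ℕ}, i ≤ j → M ^ i ≤ M ^ j := fun h => Nat.pow_le_pow_right hM1 h
    have hna : Q * f ≤ (M ^ 2) ^ a := by
      rw [← pow_mul]
      have := hpow (show N ≤ 2 * a by omega)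
      omega
    have hub : Q * Q + 1 ≤ (M ^ 2) ^ b := by
      rw [← pow_mul]
      have h1 := hpow (show (κ + 1) + (κ + 1) ≤ 2 * b by omega)
      rw [pow_add, ← hQ2] at h1
      nlinarith
    have hsc : Q ≤ (M ^ 2) ^ c := by
      rw [← pow_mul]
      have h1 := hpow (show κ + 1 ≤ 2 * c by omega)
      omega
    have hfe : 2 * f ≤ (M ^ 2) ^ e := by rw [← pow_mul, hf2]
    have hm : 1 ≤ M ^ 2 := Nat.one_le_pow _ _ hM1
    obtain ⟨t, s, hex, ht, hs⟩ := hP ⟨(M ^ 2, CoverInst.ofRows (Q * f) (Q * Q + 1) Q hn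
      (PairCover.row Q f) (PairCover.row_injective Q f)), hm,
      (PairCover.bounded_ofRows hn _ (PairCover.row_injective Q f) ⟨0, hn⟩ fun x B =>
        Or.inl rfl).mono hna hub hsc hfe⟩
    have hread := PairCover.le_time hn hex hs fun x₀ B₀ => by
      obtain ⟨t', s', hex', -, hs'⟩ := hP ⟨(M ^ 2, CoverInst.ofRows (Q * f) (Q * Q + 1) Q hn
        (PairCover.row' Q f x₀ B₀) (PairCover.row'_injective Q f x₀ B₀)), hm,
        (PairCover.bounded_ofRows hn _ (PairCover.row'_injective Q f x₀ B₀) x₀ fun x B => by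
          simp only [PairCover.row']
          split_ifs with h
          · exact Or.inr ⟨h.1, rfl⟩
          · exact Or.inl rfl).mono hna hub hsc hfe⟩
      exact ⟨t', s', hex', hs'⟩
    have hbase := regimeBase_le (h := 2) (μ := 1) (a := a) (b := b) (c := c) (e := e) (N := N)
      le_rfl hM1 (by rw [hN]; simp)
    simp only [Nat.add_one_sub_one, mul_one] at hbase
    have hone : ∀ i, 1 ≤ (M ^ 2) ^ i := fun i => Nat.one_le_pow _ _ hm
    have hbase1 := one_le_regimeBase (h := 2) (by omega) (hone a) (hone b) (hone c) (hone e)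
    have htime : (t : ℝ) ≤ max C 0 * (M : ℝ) ^ (N * max β 0) := by
      refine ht.trans ?_
      refine mul_le_mul (le_max_left _ _) ?_ (Real.rpow_nonneg (regimeBase_nonneg _ _ _ _ _) _)
        (le_max_right _ _)
      refine (Real.rpow_le_rpow_of_exponent_le hbase1 (le_max_left β 0)).trans ?_
      rw [Real.rpow_natCast_mul (by linarith)]
      exact Real.rpow_le_rpow (by linarith) hbase (le_max_right _ _)
    have hlow : M ^ (N + (κ + 1)) ≤ 16 * (Q * f * (Q - 1)) := by
      have h1 : 2 * Q ≤ 4 * (Q - 1) := by omega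
      rw [pow_add, ← hQf, ← hQ2]
      calc 4 * (Q * f) * (2 * Q) ≤ 4 * (Q * f) * (4 * (Q - 1)) := Nat.mul_le_mul_left _ h1
        _ = _ := by ring
    have hlow' : (M : ℝ) ^ (2 * (N : ℝ) - 2 * e) ≤ 16 * t := by
      have h1 : (2 * (N : ℝ) - 2 * e) = ((N + (κ + 1) : ℕ) : ℝ) := by
        have h2 : (N : ℝ) = 2 * e + (κ + 1) := by exact_mod_cast hκ
        push_cast
        linarith
      rw [h1, Real.rpow_natCast]
      exact_mod_cast hlow.trans (Nat.mul_le_mul_left 16 hread)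
    rw [Real.rpow_sub (by linarith), div_le_iff₀ (Real.rpow_pos_of_pos (by linarith) _)]
    linarith
  have htend := (tendsto_rpow_atTop hexp).comp
    (tendsto_natCast_atTop_atTop.comp (Filter.tendsto_id.const_mul_atTop' (show 0 < 2 by norm_num)))
  obtain ⟨R, hR, hR2⟩ := ((htend.eventually_gt_atTop (16 * max C 0)).and
    (Filter.eventually_ge_atTop 2)).exists
  exact absurd (key R hR2) (not_le.2 hR)

/-! ### The lower bounds -/

/-- If s = 0, writing the instance costs G ^ (r + h), and h + 1 ≤ r. Otherwise r = s + μ * e, and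
each of the k - 1 factors G ^ s in place of G ^ r saves μ * e ≥ h + 1 in the exponent. -/
theorem RegimeExponents.build_le {h k a b c e μ r s : ℕ} (hp : RegimeExponents h a b c e μ r s)
    (hk : 2 ≤ k) (he : 0 < e) (hμ : h + 1 ≤ μ) (hr : h + 1 ≤ r) :
    r + h + s * (min h k - 1) + 1 ≤ k * r := by
  have h2 : 2 * r ≤ k * r := Nat.mul_le_mul_right _ hk
  rcases hp.eq_or with rfl | hs
  · omega
  · have h1 : s * (min h k - 1) ≤ s * (k - 1) := Nat.mul_le_mul_left _ (by omega)
    have h3 : s * (k - 1) + s = k * s := by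
      rw [mul_comm k, ← Nat.mul_succ, Nat.succ_eq_add_one, Nat.sub_add_cancel (by omega)]
    have h4 : 2 * (μ * e) ≤ k * (μ * e) := Nat.mul_le_mul_right _ hk
    have h5 : μ ≤ μ * e := Nat.le_mul_of_pos_right _ he
    rw [← hs, mul_add]
    omega

theorem exists_three_le_mul {δ : ℝ} (hδ : 0 < δ) : ∃ R : ℕ, ∀ r : ℕ, R ≤ r → 3 ≤ r * δ := by
  refine ⟨⌈3 / δ⌉₊, fun r hr => ?_⟩
  rw [← div_le_iff₀ hδ]
  exact (Nat.le_ceil _).trans (by exact_mod_cast hr)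

theorem not_hypercliqueHypothesis {k a b c e h : ℕ} (hk : 2 ≤ k) (ha : 0 < a) (hb : 0 < b)
    (hc : 0 < c) (he : 0 < e) (hh : 2 ≤ h) {ε : ℝ} (hε : 0 < ε)
    (hsolve : MaxCoverSolvable k a b c e fun n u Δs Δf =>
      regimeBase h n u Δs Δf ^ ((k : ℝ) * (1 - ε))) : ¬ HypercliqueHypothesis h := by
  obtain ⟨R, hR⟩ := exists_three_le_mul (lt_min hε (by norm_num : (0 : ℝ) < 1 / 2))
  obtain ⟨μ, r, s, hμ, hr, hp⟩ := exists_regimeExponents hh ha hb hc he (R + h + 1)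
  have hbuild := hp.build_le hk he (by omega) (by omega)
  have hbuild' : ((r + h + s * (min h k - 1) : ℕ) : ℝ) + 1 ≤ ((k * r : ℕ) : ℝ) := by
    exact_mod_cast hbuild
  have hk' : (2 : ℝ) ≤ k := by exact_mod_cast hk
  intro hyp
  refine hyp (k * r) (by omega) 1 one_pos (hypercliqueProblem_solvableInTime hk hh ha he (by omega)
    (by omega) hp (Nat.cast_nonneg k) (hR r (by omega)) ?_ (by linarith) hsolve)
  push_cast
  linarith

theorem not_ovHypothesis {k a b c e : ℕ} (hk : 2 ≤ k) (ha : 0 < a) (hb : 0 < b)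
    (hc : 0 < c) (he : 0 < e) {ε : ℝ} (hε : 0 < ε)
    (hsolve : MaxCoverSolvable k a b c e fun n u Δs Δf =>
      regimeBase k n u Δs Δf ^ ((k : ℝ) * (1 - ε))) : ¬ OVHypothesis k := by
  obtain ⟨R, hR⟩ := exists_three_le_mul (lt_min hε (by norm_num : (0 : ℝ) < 1 / 2))
  obtain ⟨μ, r, s, hμ, hr, hp⟩ := exists_regimeExponents hk ha hb hc he (R + k + 1)
  have hbuild := hp.build_le hk he (by omega) (by omega)
  rw [min_self] at hbuild
  have hbuild' : ((r + k + s * (k - 1) : ℕ) : ℝ) + 1 ≤ ((k * r : ℕ) : ℝ) := by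
    exact_mod_cast hbuild
  have hk' : (2 : ℝ) ≤ k := by exact_mod_cast hk
  have hr' : (0 : ℝ) < r := Nat.cast_pos.2 (by omega)
  intro hyp
  have hsol := ovProblem_solvableInTime (ρ := ((k * r : ℕ) : ℝ) - 1) hk ha he (by omega)
    (by omega) hp (Nat.cast_nonneg k) (hR r (by omega)) (by push_cast; linarith) (by linarith) hsolve
  -- One factor d saved is n ^ (1 / r) saved in terms of the number of vectors.
  rw [show (((k * r : ℕ) : ℝ) - 1) / r = (k : ℝ) - 1 / r by push_cast; field_simp] at hsol
  exact hyp (1 / r) (by positivity) (rootDim r) (isLittleO_log_rootDim (by omega)) hsol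

/-- The construction is fast enough, or the input cannot be read in the given time. -/
theorem exists_clique_build_bound {k a b c e : ℕ} (hk : 2 ≤ k) (he : 0 < e) {ε : ℝ} (hε : 0 < ε)
    (hsolve : MaxCoverSolvable k a b c e fun n u Δs Δf =>
      regimeBase 2 n u Δs Δf ^ (matMulExponent / 3 * (k : ℝ) * (1 - ε))) :
    ∃ R : ℕ, ∀ μ r s, R ≤ μ → R ≤ r → RegimeExponents 2 a b c e μ r s →
      ((r + 2 + s : ℕ) : ℝ) ≤ matMulExponent / 3 * k * r - 1 := by
  have hω := two_le_matMulExponent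
  have hk' : (2 : ℝ) ≤ k := by exact_mod_cast hk
  have he' : (1 : ℝ) ≤ e := by exact_mod_cast he
  have hτ : 4 / 3 ≤ matMulExponent / 3 * k := by nlinarith
  have hcast : ∀ μ r s : ℕ, s + μ * e = r → (s : ℝ) = r - μ * e := fun μ r s h => by
    have : (s : ℝ) + μ * e = r := by exact_mod_cast h
    linarith
  rcases hk.eq_or_lt with rfl | hk3
  · set N := min (2 * a) (2 * e + min b (2 * c)) with hN
    set τ := matMulExponent / 3 * ((2 : ℕ) : ℝ) with hτdef
    have hN0 : (0 : ℝ) ≤ N := Nat.cast_nonneg _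
    -- The slack of the construction. For N ≤ 2 * e it is positive because τ ≥ 4/3. For N > 2 * e,
    -- its failure gives 2 * N - 2 * e ≥ τ * N > τ * (1 - ε) * N, a time too short to read the
    -- input.
    have hδ : 0 < 2 * (e : ℝ) - (2 - τ) * N := by
      by_cases hNe : 2 * e < N
      · have hNe' : (2 * e : ℝ) < N := by exact_mod_cast hNe
        by_contra hneg
        refine not_maxCoverSolvable_two he hN hNe (β := τ * (1 - ε)) ?_ hsolve
        have : 0 < τ * ε * N := by
          have : 0 < τ := by linarith
          have : (0 : ℝ) < N := by linarith
          positivity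
        nlinarith
      · have hNe' : (N : ℝ) ≤ 2 * e := by exact_mod_cast not_lt.1 hNe
        nlinarith
    obtain ⟨R, hR⟩ := exists_three_le_mul hδ
    refine ⟨2 * R + 9, fun μ r s hμ hr hp => ?_⟩
    have hr9 : (9 : ℝ) ≤ r := by exact_mod_cast (by omega : 9 ≤ r)
    rcases hp.eq_or with rfl | hs
    · push_cast
      nlinarith
    · have hs' := hcast μ r s hs
      -- The number of vectors is within the base of the bound, whichever term attains the minimum
      -- N.
      have hrN : 2 * r ≤ μ * N := by
        have h1 := hp.sets
        have h2 := hp.univ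
        have h3 := hp.size
        have hN' : N = 2 * a ∨ N = 2 * e + b ∨ N = 2 * e + 2 * c := by omega
        rcases hN' with h | h | h <;> rw [h]
        · rw [mul_left_comm]
          omega
        · rw [mul_add, mul_left_comm]
          omega
        · rw [mul_add, mul_left_comm, mul_left_comm μ 2 c]
          omega
      have hrN' : (2 : ℝ) * r ≤ μ * N := by exact_mod_cast hrN
      have hμ' : (2 * R + 9 : ℝ) ≤ μ := by exact_mod_cast hμ
      have h3 := hR R le_rfl
      -- The claim reduces to (2 - τ) * r + 3 ≤ μ * e. By 2 * r ≤ μ * N this holds for τ ≤ 2 as soon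
      -- as μ times the slack is at least 6.
      have hμδ : 6 ≤ μ * (2 * (e : ℝ) - (2 - τ) * N) :=
        calc (6 : ℝ) ≤ 2 * (R * (2 * (e : ℝ) - (2 - τ) * N)) := by linarith
          _ = (2 * R) * (2 * (e : ℝ) - (2 - τ) * N) := by ring
          _ ≤ _ := mul_le_mul_of_nonneg_right (by linarith) hδ.le
      push_cast
      rw [hs']
      rcases le_total 2 τ with h2 | h2
      · have h4 : (2 : ℝ) * r ≤ τ * r := mul_le_mul_of_nonneg_right h2 (by linarith)
        have h5 : (μ : ℝ) * 1 ≤ μ * e := mul_le_mul_of_nonneg_left he' (by positivity)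
        have hR0 : (0 : ℝ) ≤ R := Nat.cast_nonneg R
        linarith
      · have h4 := mul_le_mul_of_nonneg_left hrN' (sub_nonneg.2 h2)
        linarith
  · have hk3' : (3 : ℝ) ≤ k := by exact_mod_cast hk3
    -- For k ≥ 3 the target exponent is at least 2 * r, which exceeds the construction cost without
    -- any comparison with the input size.
    have hτ2 : 2 ≤ matMulExponent / 3 * k := by nlinarith
    refine ⟨3, fun μ r s hμ hr hp => ?_⟩
    have hr3 : (3 : ℝ) ≤ r := by exact_mod_cast hr
    have hμ3 : (3 : ℝ) ≤ μ := by exact_mod_cast hμ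
    have h4 : (2 : ℝ) * r ≤ matMulExponent / 3 * k * r :=
      mul_le_mul_of_nonneg_right hτ2 (by linarith)
    have h5 : (μ : ℝ) * 1 ≤ μ * e := mul_le_mul_of_nonneg_left he' (by positivity)
    rcases hp.eq_or with rfl | hs
    · push_cast
      linarith
    · have hs' := hcast μ r s hs
      push_cast
      linarith

theorem mainTheorem4 (k : ℕ) (hk : 2 ≤ k) (a b c e : ℕ)
    (ha : 0 < a) (hb : 0 < b) (hc : 0 < c) (he : 0 < e) :
    (∀ ε : ℝ, 0 < ε →
      MaxCoverSolvable k a b c e (fun n u Δs Δf =>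
        (min (n : ℝ) ((Δf : ℝ) * min (Real.sqrt u) (Δs : ℝ)))
          ^ (matMulExponent / 3 * (k : ℝ) * (1 - ε))) →
      ¬ CliqueHypothesis) ∧
    (∀ h : ℕ, 3 ≤ h → ∀ ε : ℝ, 0 < ε →
      MaxCoverSolvable k a b c e (fun n u Δs Δf =>
        (min (n : ℝ) ((Δf : ℝ) *
            min ((u : ℝ) ^ (1 / (h : ℝ))) ((Δs : ℝ) ^ (1 / ((h : ℝ) - 1)))))
          ^ ((k : ℝ) * (1 - ε))) →
      ¬ HypercliqueHypothesis h) ∧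
    (∀ ε : ℝ, 0 < ε →
      MaxCoverSolvable k a b c e (fun n u Δs Δf =>
        (min (n : ℝ) ((Δf : ℝ) *
            min ((u : ℝ) ^ (1 / (k : ℝ))) ((Δs : ℝ) ^ (1 / ((k : ℝ) - 1)))))
          ^ ((k : ℝ) * (1 - ε))) →
      ¬ OVHypothesis k) := by
  refine ⟨fun ε hε hsolve => ?_, fun h hh ε hε hsolve =>
    not_hypercliqueHypothesis hk ha hb hc he (by omega) hε hsolve,
    fun ε hε hsolve => not_ovHypothesis hk ha hb hc he hε hsolve⟩
  simp only [← regimeBase_two] at hsolve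
  have hω := two_le_matMulExponent
  have hk' : (2 : ℝ) ≤ k := by exact_mod_cast hk
  have hτ : 1 ≤ matMulExponent / 3 * k := by nlinarith
  obtain ⟨R₁, hR₁⟩ := exists_three_le_mul (lt_min hε (by norm_num : (0 : ℝ) < 1 / 2))
  obtain ⟨R₂, hR₂⟩ := exists_clique_build_bound hk he hε hsolve
  obtain ⟨μ, r, s, hμ, hr, hp⟩ :=
    exists_regimeExponents (le_refl 2) ha hb hc he (R₁ + R₂ + 3)
  have hbuild := hR₂ μ r s (by omega) (by omega) hp
  have hkr : r ≤ k * r := Nat.le_mul_of_pos_left _ (by omega)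
  have hρ : ((k * r : ℕ) : ℝ) * matMulExponent / 3 - 1 = matMulExponent / 3 * k * r - 1 := by
    push_cast
    ring
  intro hyp
  refine hyp (k * r) (by omega) 1 one_pos (cliqueProblem_solvableInTime (T := fun n : ℕ =>
    (n : ℝ) ^ (((k * r : ℕ) : ℝ) * matMulExponent / 3 - 1)) ?_)
  refine hypercliqueProblem_solvableInTime hk le_rfl ha he (by omega) (by omega) hp
    (by linarith : 0 ≤ matMulExponent / 3 * k) (hR₁ r (by omega)) ?_ ?_ hsolve
  · rw [hρ]
    linarith
  · rw [hρ, min_eq_left hk, Nat.add_one_sub_one, mul_one]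
    exact hbuild
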